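/- Let $N\ge 2$, let $\Omega\subset\mathbb{R}^N$ be open, let $1\le p\le\infty$, and let $u\in W^{1,p}(\Omega;\mathbb{R}^N)$ with weak gradient $\nabla u$. Call $x_0\in\Omega$ a discontinuity point of $u$ if no function that agrees with $u$ almost everywhere in $\Omega$ is continuous at $x_0$. Suppose that for every discontinuity point $x_0\in\Omega$ of $u$ a radius $\rho=\rho(x_0)>0$ is given such that $B_\rho(x_0)\subset\Omega$ and the function $$x\mapsto |x-x_0|^{-N}\,|\nabla u(x)(x-x_0)|$$ belongs to $L^1(B_\rho(x_0))$. Then there is a Borel field $v:\mathbb{R}^N\to\mathbb{R}^N$ with $v=u$ almost everywhere in $\Omega$ such that: 1. $v$ is self-continuous in $\Omega$, that is, for every $x\in\Omega$ there are $\epsilon_0>0$ and a $\mathcal C^1$ curve $\phi:[0,\epsilon_0)\to\Omega$ with $\phi(0)=x$, $\phi'(0)=v(x)$ and $\lim_{\epsilon\to0^+}[\phi'(\epsilon)-v(\phi(\epsilon))]=0$; 2. for every discontinuity point $x_0\in\Omega$ of $u$, with $\rho=\rho(x_0)$, and for almost every $e$ in the unit sphere (with respect to surface measure), the function $r\mapsto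 v(x_0+re)$ belongs to $W^{1,1}((0,\rho);\mathbb{R}^N)$ with weak derivative $r\mapsto\nabla u(x_0+re)\,e$, and $\lim_{r\to0^+}v(x_0+re)$ exists. -/

import Mathlib

open MeasureTheory Set Filter Topology
open scoped ContDiff ENNReal

/-- `u ∈ W^{1,p}(Ω; F)` with weak gradient `Du`: both `u` and `Du` are in `L^p(Ω)` and
`∫_Ω (∂_w φ) u = - ∫_Ω φ (Du w)` for every direction `w` and every test function
`φ ∈ C_c^∞(Ω)`. It is meant for `1 ≤ p ≤ ∞` and `Ω` open. -/
structure IsSobolevWithGradient {E F : Type*} [NormedAddCommGroup E] [NormedSpace ℝ E]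
    [MeasureSpace E] [NormedAddCommGroup F] [NormedSpace ℝ F]
    (p : ℝ≥0∞) (Ω : Set E) (u : E → F) (Du : E → E →L[ℝ] F) : Prop where
  memLp : MemLp u p (volume.restrict Ω)
  memLp_gradient : MemLp Du p (volume.restrict Ω)
  integral_eq : ∀ φ : E → ℝ, ContDiff ℝ ∞ φ → HasCompactSupport φ → tsupport φ ⊆ Ω →
    ∀ w : E, ∫ x in Ω, (fderiv ℝ φ x w) • u x = - ∫ x in Ω, φ x • Du x w

/-- `x` is a discontinuity point of the class of `u` on `Ω`: no function that agrees with `u`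
almost everywhere in `Ω` is continuous at `x`. -/
def IsDiscontinuityPoint {N : ℕ} (Ω : Set (EuclideanSpace ℝ (Fin N)))
    (u : EuclideanSpace ℝ (Fin N) → EuclideanSpace ℝ (Fin N))
    (x : EuclideanSpace ℝ (Fin N)) : Prop :=
  ∀ w : EuclideanSpace ℝ (Fin N) → EuclideanSpace ℝ (Fin N),
    w =ᵐ[volume.restrict Ω] u → ¬ ContinuousAt w x

/-- The field `f` is self-continuous at `x ∈ Ω`: there is a `C^1` curve `φ : [0, ε₀) → Ω` with
`φ 0 = x`, `φ' 0 = f x` and `φ' ε - f (φ ε) → 0` as `ε → 0⁺` (derivatives at `0` are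
one-sided). -/
def IsSelfContinuousAt {N : ℕ} (Ω : Set (EuclideanSpace ℝ (Fin N)))
    (f : EuclideanSpace ℝ (Fin N) → EuclideanSpace ℝ (Fin N))
    (x : EuclideanSpace ℝ (Fin N)) : Prop :=
  ∃ ε₀ : ℝ, 0 < ε₀ ∧ ∃ φ : ℝ → EuclideanSpace ℝ (Fin N),
    ContDiffOn ℝ 1 φ (Ico 0 ε₀) ∧ MapsTo φ (Ico 0 ε₀) Ω ∧ φ 0 = x ∧
    derivWithin φ (Ico 0 ε₀) 0 = f x ∧
    Tendsto (fun ε => derivWithin φ (Ico 0 ε₀) ε - f (φ ε)) (𝓝[>] 0) (𝓝 0)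

/-- The Borel field `f` is self-continuous in `Ω`. -/
def IsSelfContinuousOn {N : ℕ} (Ω : Set (EuclideanSpace ℝ (Fin N)))
    (f : EuclideanSpace ℝ (Fin N) → EuclideanSpace ℝ (Fin N)) : Prop :=
  Measurable f ∧ ∀ x ∈ Ω, IsSelfContinuousAt Ω f x

/-!
The field `v` is the limit of mollifications of `u`, and zero wherever this limit is not available.

Mollify `u` and its weak gradient `D` with kernels whose radii `ε k` decrease so fast that the
errors are summable in `L¹_loc` (`FastMollification`). Call a point regular if the mollifications
of `u` converge there and `ε k` times the average of `‖D‖` over the ball of radius `ε k` tends to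
zero; let `v` be the limit at regular points and zero elsewhere (`preciseRep`). Summability passes
to almost every curve of a family that does not concentrate: the measure that the family spreads
over space has bounded density. Along such a curve every point is regular, and `v` satisfies the
fundamental theorem of calculus with derivative `D` (`regular_curve`, `ae_regular_curve`). Three
kinds of families are used. Segments in a ball yield a Poincaré inequality, so that `v` is the
Lebesgue value of `u` at regular points along the radii `ε k` (`tendsto_laverage_enorm_sub`). Rays
from a point `x₀`, in polar coordinates, yield the assertion on almost every direction
(`ae_sobolev_ray`), for the hypothesis on `x₀` says that `D (x₀ + r e) e` is integrable on almost
every ray. Tubes `t ↦ x₀ + t w + ψ(t) a`, with `a` in a ball, are curves with initial velocity `w`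
if `ψ'(0) = 0`.

Self-continuity at `x` is trivial if `v x = 0`, by a constant curve; in particular it is trivial at
all points that are not regular. If `w = v x₀ ≠ 0`, then `x₀` is regular, and a curve of a tube in
direction `w` is sought along which `v` tends to `w`. If some representative of `u` is continuous
at `x₀`, then `v` is continuous there along the regular points, and almost every curve of any tube
will do (`exists_tangent_curve_of_continuousAt`). If not, the radial hypothesis holds at `x₀`, but
it only controls derivatives along rays from `x₀`, and the single ray in direction `w` may be
exceptional. The profile `ψ` is therefore chosen linear, `ψ(t) = 2⁻ⁿ⁻¹ t`, on long
intervals, where the curves of the tube are rays and the derivative of `v` along them is controlled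
by the radial integral; its slope is halved as `t` decreases through `[r n, 2 r n]`, where the
derivative is controlled by the average of `‖D‖`. As both quantities tend to zero at `x₀`, the
scales `r n` can be chosen so small that all losses, including the constants due to the narrowing
of the tube, are summable. Hence `v` has a limit at `x₀` along almost every curve of the tube, and
this limit is `w` by the Lebesgue value at the times `r n` (`exists_tangent_curve`).
-/

/-! ### Mean oscillation over balls -/

section Averages

variable {E F : Type*} [NormedAddCommGroup E] [NormedSpace ℝ E] [FiniteDimensional ℝ E]
  [MeasureSpace E] [BorelSpace E] [(volume : Measure E).IsAddHaarMeasure]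
  [NormedAddCommGroup F]

theorem measurable_lintegral_ball {G : E → E → ℝ≥0∞} (hG : Measurable (Function.uncurry G))
    (r : ℝ) : Measurable fun x => ∫⁻ y in Metric.ball x r, G x y := by
  have h : ∀ x, ∫⁻ y in Metric.ball x r, G x y =
      ∫⁻ y, {q : E × E | dist q.2 q.1 < r}.indicator (Function.uncurry G) (x, y) := by
    intro x
    rw [← lintegral_indicator Metric.isOpen_ball.measurableSet]
    rfl
  simp_rw [h]
  refine Measurable.lintegral_prod_right' (f := _) (hG.indicator ?_)
  exact (isOpen_lt (by fun_prop) continuous_const).measurableSet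

/-- Tonelli: every point of the larger ball is counted with the measure of a ball of radius `r`. -/
theorem lintegral_lintegral_ball_le {f : E → ℝ≥0∞} (hf : Measurable f) (R r : ℝ) :
    ∫⁻ x in Metric.ball (0 : E) R, ∫⁻ y in Metric.ball x r, f y ≤
      volume (Metric.ball (0 : E) r) * ∫⁻ y in Metric.ball (0 : E) (R + r), f y := by
  have hO : MeasurableSet {q : E × E | dist q.2 q.1 < r} :=
    (isOpen_lt (by fun_prop) continuous_const).measurableSet
  have h1 : ∀ x ∈ Metric.ball (0 : E) R, ∫⁻ y in Metric.ball x r, f y ≤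
      ∫⁻ y, {q : E × E | dist q.2 q.1 < r}.indicator
        (fun q => (Metric.ball (0 : E) (R + r)).indicator f q.2) (x, y) := by
    intro x hx
    rw [← lintegral_indicator Metric.isOpen_ball.measurableSet]
    refine lintegral_mono fun y => ?_
    by_cases hy : y ∈ Metric.ball x r
    · have hy' : y ∈ Metric.ball (0 : E) (R + r) := by
        rw [Metric.mem_ball] at *
        linarith [dist_triangle y x 0]
      rw [indicator_of_mem hy, indicator_of_mem (by exact hy), indicator_of_mem hy']
    · rw [indicator_of_notMem hy]; exact zero_le
  calc ∫⁻ x in Metric.ball (0 : E) R, ∫⁻ y in Metric.ball x r, f y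
      ≤ ∫⁻ x in Metric.ball (0 : E) R, ∫⁻ y, {q : E × E | dist q.2 q.1 < r}.indicator
        (fun q => (Metric.ball (0 : E) (R + r)).indicator f q.2) (x, y) :=
        setLIntegral_mono' Metric.isOpen_ball.measurableSet h1
    _ ≤ ∫⁻ x, ∫⁻ y, {q : E × E | dist q.2 q.1 < r}.indicator
        (fun q => (Metric.ball (0 : E) (R + r)).indicator f q.2) (x, y) :=
        setLIntegral_le_lintegral _ _
    _ = ∫⁻ y, ∫⁻ x, {q : E × E | dist q.2 q.1 < r}.indicator
        (fun q => (Metric.ball (0 : E) (R + r)).indicator f q.2) (x, y) := by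
        apply lintegral_lintegral_swap
        refine (Measurable.indicator ?_ hO).aemeasurable
        exact (hf.indicator Metric.isOpen_ball.measurableSet).comp measurable_snd
    _ = ∫⁻ y, volume (Metric.ball (0 : E) r) * (Metric.ball (0 : E) (R + r)).indicator f y := by
        refine lintegral_congr fun y => ?_
        rw [← Measure.addHaar_ball_center volume y r, mul_comm, ← lintegral_indicator_const
          Metric.isOpen_ball.measurableSet]
        refine lintegral_congr fun x => ?_
        by_cases hxy : x ∈ Metric.ball y r
        · rw [indicator_of_mem hxy, indicator_of_mem]
          simpa [dist_comm] using hxy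
        · rw [indicator_of_notMem hxy, indicator_of_notMem]
          simpa [dist_comm] using hxy
    _ = _ := by
        rw [lintegral_const_mul _ (hf.indicator Metric.isOpen_ball.measurableSet),
          lintegral_indicator Metric.isOpen_ball.measurableSet]

theorem lintegral_laverage_ball_le {f : E → ℝ≥0∞} (hf : Measurable f) (R : ℝ) {r : ℝ}
    (hr : 0 < r) :
    ∫⁻ x in Metric.ball (0 : E) R, ⨍⁻ y in Metric.ball x r, f y ∂volume ≤
      ∫⁻ y in Metric.ball (0 : E) (R + r), f y := by
  have h0 : volume (Metric.ball (0 : E) r) ≠ 0 := (Metric.measure_ball_pos _ _ hr).ne'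
  have h1 : volume (Metric.ball (0 : E) r) ≠ ⊤ := measure_ball_lt_top.ne
  simp_rw [setLAverage_eq, Measure.addHaar_ball_center, div_eq_mul_inv]
  rw [lintegral_mul_const _ (measurable_lintegral_ball (by exact hf.comp measurable_snd) r),
    ← div_eq_mul_inv]
  refine ENNReal.div_le_of_le_mul ?_
  rw [mul_comm]
  exact lintegral_lintegral_ball_le hf R r

/-- The average of a nonnegative function over a ball is at most `2 ^ dim E` times its average
over a ball of twice the radius containing it. -/
theorem laverage_ball_le_of_dist_le (f : E → ℝ≥0∞) {x z : E} {r : ℝ} (hr : 0 < r)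
    (hxz : dist x z ≤ r) :
    ⨍⁻ y in Metric.ball x r, f y ∂volume ≤
      2 ^ Module.finrank ℝ E * ⨍⁻ y in Metric.ball z (2 * r), f y ∂volume := by
  have h0 : volume (Metric.ball (0 : E) r) ≠ 0 := (Metric.measure_ball_pos _ _ hr).ne'
  have h1 : volume (Metric.ball (0 : E) r) ≠ ⊤ := measure_ball_lt_top.ne
  have h2 : volume (Metric.ball z (2 * r)) =
      2 ^ Module.finrank ℝ E * volume (Metric.ball (0 : E) r) := by
    rw [Measure.addHaar_ball_mul_of_pos volume z two_pos r, ENNReal.ofReal_pow two_pos.le]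
    simp
  rw [setLAverage_eq, setLAverage_eq, h2, Measure.addHaar_ball_center, ENNReal.div_eq_inv_mul,
    ENNReal.div_eq_inv_mul, ENNReal.mul_inv (Or.inr h1) (Or.inr h0), ← mul_assoc, ← mul_assoc,
    ENNReal.mul_inv_cancel (by simp) (by simp), one_mul]
  gcongr
  intro y hy
  rw [Metric.mem_ball] at *
  linarith [dist_triangle y x z]

/-- The mean oscillation `⨍_{B(x,r)} ‖f y - f x‖ dy` of `f` around the value `f x`. -/
noncomputable def meanOsc (r : ℝ) (f : E → F) (x : E) : ℝ≥0∞ :=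
  ⨍⁻ y in Metric.ball x r, ‖f y - f x‖ₑ ∂volume

theorem measurable_meanOsc {f : E → F} (hf : StronglyMeasurable f) (r : ℝ) :
    Measurable (meanOsc r f) := by
  unfold meanOsc
  simp_rw [setLAverage_eq, Measure.addHaar_ball_center]
  refine Measurable.div_const (measurable_lintegral_ball (G := fun x y => ‖f y - f x‖ₑ) ?_ r) _
  exact ((hf.comp_measurable measurable_snd).sub (hf.comp_measurable measurable_fst)).enorm

/-- Continuity of translations in `L¹`, in the form used here: the mean oscillation of a locally
integrable function tends to zero in `L¹_loc`. -/
theorem tendsto_lintegral_meanOsc [NormedSpace ℝ F] {f : E → F} (hf : StronglyMeasurable f)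
    (hfi : LocallyIntegrable f volume) (R : ℝ) :
    Tendsto (fun r => ∫⁻ x in Metric.ball (0 : E) R, meanOsc r f x) (𝓝[>] 0) (𝓝 0) := by
  rw [ENNReal.tendsto_nhds_zero]
  intro ε hε
  set δ : ℝ≥0∞ := min ε 1 / 3 with hδ
  have hδ0 : δ ≠ 0 := by
    simp [hδ, hε.ne']
  -- approximate `f` on a slightly larger ball by a uniformly continuous function
  have hint : Integrable ((Metric.closedBall (0 : E) (R + 1)).indicator f) volume :=
    (hfi.integrableOn_isCompact (isCompact_closedBall _ _)).integrable_indicator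
      Metric.isClosed_closedBall.measurableSet
  obtain ⟨g, hgs, hg, hgc, -⟩ := hint.exists_hasCompactSupport_lintegral_sub_le hδ0
  have hfg : ∫⁻ x in Metric.ball (0 : E) (R + 1), ‖f x - g x‖ₑ ≤ δ := by
    refine le_trans ?_ hg
    refine le_trans (setLIntegral_mono' Metric.isOpen_ball.measurableSet fun x hx => ?_)
      (setLIntegral_le_lintegral _ _)
    rw [indicator_of_mem (Metric.ball_subset_closedBall hx)]
  have hguc : UniformContinuous g := hgs.uniformContinuous_of_continuous hgc
  set V := volume (Metric.ball (0 : E) R) with hV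
  have hVt : V ≠ ⊤ := measure_ball_lt_top.ne
  -- a modulus of continuity of `g` that costs at most `δ` on the whole ball
  obtain ⟨η, hη0, hη⟩ : ∃ η : ℝ, 0 < η ∧ ENNReal.ofReal η * V ≤ δ := by
    have : Tendsto (fun η : ℝ => ENNReal.ofReal η * V) (𝓝[>] 0) (𝓝 0) := by
      have := ENNReal.Tendsto.mul_const (b := V)
        ((ENNReal.continuous_ofReal.tendsto (0 : ℝ)).mono_left
          (nhdsWithin_le_nhds (s := Ioi 0))) (Or.inr hVt)
      simpa using this
    obtain ⟨η, h1, h2⟩ := ((this.eventually (ge_mem_nhds hδ0.bot_lt)).and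
      self_mem_nhdsWithin).exists
    exact ⟨η, h2, h1⟩
  obtain ⟨r₀, hr₀, hgr⟩ := Metric.uniformContinuous_iff.1 hguc η hη0
  filter_upwards [Ioo_mem_nhdsGT (lt_min hr₀ one_pos)] with r hr
  have hr0 : 0 < r := hr.1
  have hrr : r < r₀ := hr.2.trans_le (min_le_left _ _)
  have hr1 : r < 1 := hr.2.trans_le (min_le_right _ _)
  have hdm : Measurable fun y => ‖f y - g y‖ₑ := (hf.sub hgc.stronglyMeasurable).enorm
  have hpt : ∀ x, meanOsc r f x ≤
      (⨍⁻ y in Metric.ball x r, ‖f y - g y‖ₑ ∂volume) + (ENNReal.ofReal η + ‖f x - g x‖ₑ) := by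
    intro x
    have h0 : volume (Metric.ball x r) ≠ 0 := (Metric.measure_ball_pos _ _ hr0).ne'
    have h1 : volume (Metric.ball x r) ≠ ⊤ := measure_ball_lt_top.ne
    unfold meanOsc
    rw [← setLAverage_const h0 h1 (ENNReal.ofReal η + ‖f x - g x‖ₑ), setLAverage_eq,
      setLAverage_eq, setLAverage_eq, ← ENNReal.add_div, ← lintegral_add_right _ measurable_const]
    gcongr ?_ / _
    refine setLIntegral_mono' Metric.isOpen_ball.measurableSet fun y hy => ?_
    have h3 : ‖g y - g x‖ₑ ≤ ENNReal.ofReal η := by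
      rw [← ofReal_norm, ← dist_eq_norm]
      exact ENNReal.ofReal_le_ofReal (hgr ((Metric.mem_ball.1 hy).trans hrr)).le
    calc ‖f y - f x‖ₑ = ‖(f y - g y) + ((g y - g x) - (f x - g x))‖ₑ := by congr 1; abel
      _ ≤ ‖f y - g y‖ₑ + (‖g y - g x‖ₑ + ‖f x - g x‖ₑ) :=
        (enorm_add_le _ _).trans (add_le_add le_rfl enorm_sub_le)
      _ ≤ _ := by gcongr
  calc ∫⁻ x in Metric.ball (0 : E) R, meanOsc r f x
      ≤ ∫⁻ x in Metric.ball (0 : E) R, ((⨍⁻ y in Metric.ball x r, ‖f y - g y‖ₑ ∂volume) +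
        (ENNReal.ofReal η + ‖f x - g x‖ₑ)) := lintegral_mono hpt
    _ = (∫⁻ x in Metric.ball (0 : E) R, (⨍⁻ y in Metric.ball x r, ‖f y - g y‖ₑ ∂volume)) +
        (ENNReal.ofReal η * V + ∫⁻ x in Metric.ball (0 : E) R, ‖f x - g x‖ₑ) := by
        rw [lintegral_add_right _ (show Measurable fun x => ENNReal.ofReal η + ‖f x - g x‖ₑ from
          measurable_const.add hdm),
          lintegral_add_left measurable_const, setLIntegral_const]
    _ ≤ δ + (δ + δ) := by
        gcongr
        · exact (lintegral_laverage_ball_le hdm R hr0).trans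
            ((lintegral_mono_set (Metric.ball_subset_ball (by linarith))).trans hfg)
        · exact (lintegral_mono_set (Metric.ball_subset_ball (by linarith))).trans hfg
    _ = min ε 1 := by
        rw [hδ, ← add_assoc, ENNReal.add_thirds]
    _ ≤ ε := min_le_left _ _

end Averages

/-! ### Mollification -/

section Mollification

variable {E F : Type*} [NormedAddCommGroup E] [NormedSpace ℝ E] [FiniteDimensional ℝ E]
  [MeasureSpace E] [BorelSpace E] [(volume : Measure E).IsAddHaarMeasure]
  [NormedAddCommGroup F] [NormedSpace ℝ F]

/-- The mollification of `f` by the normalized bump function `φ`. -/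
noncomputable def mollify (φ : ContDiffBump (0 : E)) (f : E → F) : E → F :=
  convolution (φ.normed volume) f (ContinuousLinearMap.lsmul ℝ ℝ) volume

theorem mollify_apply (φ : ContDiffBump (0 : E)) (f : E → F) (x : E) :
    mollify φ f x = ∫ y, φ.normed volume (x - y) • f y := by
  rw [mollify, convolution_eq_swap]
  rfl

theorem continuous_mollify (φ : ContDiffBump (0 : E)) {f : E → F}
    (hf : LocallyIntegrable f volume) : Continuous (mollify φ f) :=
  φ.hasCompactSupport_normed.continuous_convolution_left _ φ.continuous_normed hf

theorem integrable_mollify_integrand (φ : ContDiffBump (0 : E)) {f : E → F}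
    (hf : LocallyIntegrable f volume) (x : E) :
    Integrable (fun y => φ.normed volume (x - y) • f y) volume := by
  have hc : Continuous fun y => φ.normed volume (x - y) :=
    φ.continuous_normed.comp (continuous_const.sub continuous_id)
  refine hf.integrable_smul_left_of_hasCompactSupport hc ?_
  exact φ.hasCompactSupport_normed.comp_homeomorph (Homeomorph.subLeft x)

/-- A mollification at `x` is as close to a constant `c` as `f` is on average over the ball of
radius `φ.rOut` at `x`: since `φ.rOut = 2 * φ.rIn`, the kernel is at most `2 ^ dim E` divided by the
volume of that ball. -/
theorem enorm_mollify_sub_le [CompleteSpace F] (φ : ContDiffBump (0 : E))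
    (hφ : φ.rOut = 2 * φ.rIn) {f : E → F} (hf : LocallyIntegrable f volume) (x : E) (c : F) :
    ‖mollify φ f x - c‖ₑ ≤
      2 ^ Module.finrank ℝ E * ⨍⁻ y in Metric.ball x φ.rOut, ‖f y - c‖ₑ ∂volume := by
  have hc : c = ∫ y, φ.normed volume (x - y) • c := by
    rw [integral_sub_left_eq_self (fun y => φ.normed volume y • c) volume x,
      φ.integral_normed_smul volume c]
  have hci : LocallyIntegrable (fun _ : E => c) volume := locallyIntegrable_const c
  have h1 : mollify φ f x - c = ∫ y, φ.normed volume (x - y) • (f y - c) := by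
    conv_lhs => rw [hc, mollify_apply]
    rw [← integral_sub (integrable_mollify_integrand φ hf x)
      (integrable_mollify_integrand φ hci x)]
    simp_rw [smul_sub]
  have hpos : 0 < φ.rOut := φ.rOut_pos
  set W := volume (Metric.ball x φ.rOut) with hW
  have hWr : volume.real (Metric.closedBall (0 : E) φ.rOut) = W.toReal := by
    rw [Measure.real, hW, Measure.addHaar_ball_of_pos _ _ hpos,
      Measure.addHaar_closedBall _ _ hpos.le]
  have hW0 : W ≠ 0 := (Metric.measure_ball_pos _ _ hpos).ne'
  have hWt : W ≠ ⊤ := measure_ball_lt_top.ne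
  have hk : ∀ y, ‖φ.normed volume (x - y)‖ₑ ≤ 2 ^ Module.finrank ℝ E / W := by
    intro y
    have h2 := φ.normed_le_div_measure_closedBall_rOut volume 2 hφ.le (x - y)
    rw [hWr] at h2
    rw [Real.enorm_eq_ofReal (φ.nonneg_normed _)]
    refine (ENNReal.ofReal_le_ofReal h2).trans_eq ?_
    rw [ENNReal.ofReal_div_of_pos (ENNReal.toReal_pos hW0 hWt), ENNReal.ofReal_toReal hWt,
      ENNReal.ofReal_pow two_pos.le]
    simp
  rw [h1, setLAverage_eq, ← mul_div_assoc, mul_comm, mul_div_assoc, mul_comm]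
  refine (enorm_integral_le_lintegral_enorm _).trans ?_
  rw [← lintegral_const_mul' _ _ (ENNReal.div_ne_top (by simp) hW0),
    ← lintegral_indicator Metric.isOpen_ball.measurableSet]
  refine lintegral_mono fun y => ?_
  rw [enorm_smul]
  by_cases hy : y ∈ Metric.ball x φ.rOut
  · rw [indicator_of_mem hy]
    gcongr
    exact hk y
  · have : φ.normed volume (x - y) = 0 := by
      by_contra h
      have := (φ.support_normed_eq (μ := volume)).le (Function.mem_support.2 h)
      refine hy ?_
      rw [Metric.mem_ball, dist_comm, dist_eq_norm]
      simpa using this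
    simp [this]

theorem enorm_mollify_sub_self_le [CompleteSpace F] (φ : ContDiffBump (0 : E))
    (hφ : φ.rOut = 2 * φ.rIn) {f : E → F} (hf : LocallyIntegrable f volume) (x : E) :
    ‖mollify φ f x - f x‖ₑ ≤
      2 ^ Module.finrank ℝ E * (2 ^ Module.finrank ℝ E * meanOsc (2 * φ.rOut) f x) := by
  refine (enorm_mollify_sub_le φ hφ hf x (f x)).trans ?_
  gcongr
  exact laverage_ball_le_of_dist_le _ φ.rOut_pos (by simpa using φ.rOut_pos.le)

/-- The weak gradient commutes with mollification at points whose distance from the complement of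
`Ω` exceeds `φ.rOut`, where the translated kernel is a test function on `Ω`. -/
theorem hasFDerivAt_mollify [CompleteSpace F] {Ω : Set E} {u : E → F} {D : E → E →L[ℝ] F}
    (hu : LocallyIntegrable u volume) (hD : LocallyIntegrable D volume)
    (hweak : ∀ φ : E → ℝ, ContDiff ℝ ∞ φ → HasCompactSupport φ → tsupport φ ⊆ Ω →
      ∀ w : E, ∫ x, (fderiv ℝ φ x w) • u x = - ∫ x, φ x • D x w)
    (φ : ContDiffBump (0 : E)) {x : E} (hx : Metric.closedBall x φ.rOut ⊆ Ω) :
    HasFDerivAt (mollify φ u) (mollify φ D x) x := by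
  have h := φ.hasCompactSupport_normed.hasFDerivAt_convolution_left (μ := volume)
    (ContinuousLinearMap.lsmul ℝ ℝ : ℝ →L[ℝ] F →L[ℝ] F)
    (φ.contDiff_normed (μ := volume) (n := 1)) hu x
  suffices hD' : mollify φ D x = convolution (fderiv ℝ (φ.normed volume)) u
      ((ContinuousLinearMap.lsmul ℝ ℝ : ℝ →L[ℝ] F →L[ℝ] F).precompL E) volume x by
    rw [hD']; exact h
  ext w
  have hsm : ContDiff ℝ ∞ (φ.normed (volume : Measure E)) := φ.contDiff_normed
  have hdiff : Differentiable ℝ (φ.normed (volume : Measure E)) := hsm.differentiable (by simp)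
  have hψ : ContDiff ℝ ∞ fun y => φ.normed volume (x - y) :=
    hsm.comp (contDiff_const.sub contDiff_id)
  have hψd : ∀ y, fderiv ℝ (fun y => φ.normed volume (x - y)) y w =
      - fderiv ℝ (φ.normed volume) (x - y) w := by
    intro y
    have := ((hdiff (x - y)).hasFDerivAt.comp y ((hasFDerivAt_id y).const_sub x)).fderiv
    have h2 : (fun y => φ.normed volume (x - y)) = φ.normed volume ∘ fun y => x - y := rfl
    rw [h2]
    erw [this]
    simp
  have hψc : HasCompactSupport fun y => φ.normed volume (x - y) :=
    φ.hasCompactSupport_normed.comp_homeomorph (Homeomorph.subLeft x)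
  have hψs : tsupport (fun y => φ.normed volume (x - y)) ⊆ Ω := by
    refine subset_trans ?_ hx
    refine closure_minimal (fun y hy => ?_) Metric.isClosed_closedBall
    have := (φ.support_normed_eq (μ := volume)).le (Function.mem_support.2 hy)
    rw [Metric.mem_closedBall, dist_comm, dist_eq_norm]
    exact le_of_lt (by simpa using this)
  have h3 := hweak _ hψ hψc hψs w
  have h4 : (mollify φ D x) w = ∫ y, φ.normed volume (x - y) • D y w := by
    rw [mollify_apply, ContinuousLinearMap.integral_apply (integrable_mollify_integrand φ hD x)]
    rfl
  rw [h4, convolution_eq_swap, ContinuousLinearMap.integral_apply]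
  · rw [← neg_eq_iff_eq_neg] at h3
    rw [← h3, ← integral_neg]
    refine integral_congr_ae (Eventually.of_forall fun y => ?_)
    simp only [hψd]
    simp [ContinuousLinearMap.precompL_apply]
  · have := (φ.hasCompactSupport_normed (μ := volume)).fderiv (𝕜 := ℝ) |>.convolutionExists_left
      ((ContinuousLinearMap.lsmul ℝ ℝ : ℝ →L[ℝ] F →L[ℝ] F).precompL E) (μ := volume)
      (hsm.continuous_fderiv (by simp)) hu x
    exact this.integrable_swap

end Mollification

/-! ### Fast mollifications and the precise representative -/

section PreciseRepresentative

variable {E F : Type*} [NormedAddCommGroup E] [NormedSpace ℝ E] [FiniteDimensional ℝ E]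
  [MeasureSpace E] [BorelSpace E] [(volume : Measure E).IsAddHaarMeasure]
  [NormedAddCommGroup F] [NormedSpace ℝ F]

/-- A locally integrable function `u` on `E` that has the locally integrable weak gradient `D`
on `Ω`, with a sequence of bump functions whose radii decrease so fast that the mollifications
of `u` and `D` converge with summable errors in `L¹_loc`. The functions are defined on all of `E`,
and the test functions, though not the integrals, are confined to `Ω`. Oscillations are measured on
balls of twice the radius `(φ k).rOut`, so that they also control averages over balls of that radius
with a nearby centre. -/
structure FastMollification (Ω : Set E) (u : E → F) (D : E → E →L[ℝ] F)
    (φ : ℕ → ContDiffBump (0 : E)) : Prop where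
  isOpen : IsOpen Ω
  stronglyMeasurable : StronglyMeasurable u
  stronglyMeasurable_gradient : StronglyMeasurable D
  locallyIntegrable : LocallyIntegrable u volume
  locallyIntegrable_gradient : LocallyIntegrable D volume
  integral_eq : ∀ ψ : E → ℝ, ContDiff ℝ ∞ ψ → HasCompactSupport ψ → tsupport ψ ⊆ Ω →
    ∀ w : E, ∫ x, (fderiv ℝ ψ x w) • u x = - ∫ x, ψ x • D x w
  rOut_eq : ∀ k, (φ k).rOut = 2 * (φ k).rIn
  rOut_succ_le : ∀ k, (φ (k + 1)).rOut ≤ (φ k).rOut / 2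
  tendsto_rOut : Tendsto (fun k => (φ k).rOut) atTop (𝓝 0)
  lintegral_meanOsc_le : ∀ k : ℕ,
    ∫⁻ x in Metric.ball (0 : E) k, meanOsc (2 * (φ k).rOut) u x ≤ 2⁻¹ ^ k
  lintegral_meanOsc_gradient_le : ∀ k : ℕ,
    ∫⁻ x in Metric.ball (0 : E) k, meanOsc (2 * (φ k).rOut) D x ≤ 2⁻¹ ^ k

/-- The radius of the bump function times the average of `‖D‖` over the ball of that radius. -/
noncomputable def scaledAverage (D : E → E →L[ℝ] F) (φ : ContDiffBump (0 : E)) (x : E) : ℝ≥0∞ :=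
  ENNReal.ofReal φ.rOut * ⨍⁻ y in Metric.ball x φ.rOut, ‖D y‖ₑ ∂volume

/-- The points of `Ω` at which the mollifications of `u` converge and the gradient does not
concentrate. -/
def regularSet (Ω : Set E) (u : E → F) (D : E → E →L[ℝ] F)
    (φ : ℕ → ContDiffBump (0 : E)) : Set E :=
  {x | x ∈ Ω ∧ (∃ l, Tendsto (fun k => mollify (φ k) u x) atTop (𝓝 l)) ∧
    Tendsto (fun k => scaledAverage D (φ k) x) atTop (𝓝 0)}

open Classical in
/-- The limit of the mollifications at points of `regularSet`, and zero elsewhere. The value zero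
is a choice that matters: where a field vanishes it is self-continuous, by a constant curve. -/
noncomputable def preciseRep (Ω : Set E) (u : E → F) (D : E → E →L[ℝ] F)
    (φ : ℕ → ContDiffBump (0 : E)) (x : E) : F :=
  if h : x ∈ regularSet Ω u D φ then h.2.1.choose else 0

omit [BorelSpace E] [(volume : Measure E).IsAddHaarMeasure] in
theorem tendsto_preciseRep {Ω : Set E} {u : E → F} {D : E → E →L[ℝ] F}
    {φ : ℕ → ContDiffBump (0 : E)} {x : E} (hx : x ∈ regularSet Ω u D φ) :
    Tendsto (fun k => mollify (φ k) u x) atTop (𝓝 (preciseRep Ω u D φ x)) := by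
  rw [preciseRep, dif_pos hx]
  exact hx.2.1.choose_spec

omit [BorelSpace E] [(volume : Measure E).IsAddHaarMeasure] in
theorem preciseRep_of_notMem {Ω : Set E} {u : E → F} {D : E → E →L[ℝ] F}
    {φ : ℕ → ContDiffBump (0 : E)} {x : E} (hx : x ∉ regularSet Ω u D φ) :
    preciseRep Ω u D φ x = 0 := dif_neg hx

namespace FastMollification

variable {Ω : Set E} {u : E → F} {D : E → E →L[ℝ] F} {φ : ℕ → ContDiffBump (0 : E)}

omit [FiniteDimensional ℝ E] [BorelSpace E] [(volume : Measure E).IsAddHaarMeasure] in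
theorem eventually_closedBall_subset (h : FastMollification Ω u D φ) {K : Set E}
    (hK : IsCompact K) (hKΩ : K ⊆ Ω) :
    ∀ᶠ k in atTop, ∀ x ∈ K, Metric.closedBall x (φ k).rOut ⊆ Ω := by
  obtain ⟨δ, hδ, hδΩ⟩ := hK.exists_cthickening_subset_open h.isOpen hKΩ
  filter_upwards [h.tendsto_rOut.eventually (gt_mem_nhds hδ)] with k hk x hx y hy
  exact hδΩ (Metric.mem_cthickening_of_dist_le y x δ K hx
    ((Metric.mem_closedBall.1 hy).trans hk.le))

/-- The pointwise bound behind the vanishing of `scaledAverage` along curves: at two points at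
distance at most the radius, averages of `‖D‖` are compared through the mean oscillation. -/
theorem laverage_enorm_le (D : E → E →L[ℝ] F) {r : ℝ} (hr : 0 < r) {x z : E}
    (hxz : dist x z ≤ r) :
    ⨍⁻ y in Metric.ball x r, ‖D y‖ₑ ∂volume ≤
      2 ^ Module.finrank ℝ E * (meanOsc (2 * r) D z + ‖D z‖ₑ) := by
  refine (laverage_ball_le_of_dist_le _ hr hxz).trans ?_
  gcongr
  have h0 : volume (Metric.ball z (2 * r)) ≠ 0 :=
    (Metric.measure_ball_pos _ _ (by linarith)).ne'
  have h1 : volume (Metric.ball z (2 * r)) ≠ ⊤ := measure_ball_lt_top.ne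
  rw [meanOsc, ← setLAverage_const h0 h1 ‖D z‖ₑ, setLAverage_eq, setLAverage_eq, setLAverage_eq,
    ← ENNReal.add_div, ← lintegral_add_right _ measurable_const]
  gcongr ?_ / _
  refine lintegral_mono fun y => ?_
  calc ‖D y‖ₑ = ‖(D y - D z) + D z‖ₑ := by rw [sub_add_cancel]
    _ ≤ _ := enorm_add_le _ _

/-- Along a `C¹` curve on which the errors of the mollifications are summable, `scaledAverage`
tends to zero at every point: a ball centred on the curve is covered by the balls of twice the
radius around nearby points of the curve, and the time spent near is proportional to the radius. -/
theorem tendsto_scaledAverage_curve (h : FastMollification Ω u D φ) {s t : ℝ} (hst : s < t)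
    {γ : ℝ → E} {V : ℝ} (hV : 0 < V)
    (hlip : ∀ τ₁ ∈ Icc s t, ∀ τ₂ ∈ Icc s t, dist (γ τ₁) (γ τ₂) ≤ V * |τ₁ - τ₂|)
    (hγm : Measurable γ)
    (hD : ∫⁻ τ in Icc s t, ‖D (γ τ)‖ₑ ≠ ⊤)
    (hosc : Tendsto (fun k => ∫⁻ τ in Icc s t, meanOsc (2 * (φ k).rOut) D (γ τ)) atTop (𝓝 0))
    {τ : ℝ} (hτ : τ ∈ Icc s t) :
    Tendsto (fun k => scaledAverage D (φ k) (γ τ)) atTop (𝓝 0) := by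
  set C : ℝ≥0∞ := 2 ^ Module.finrank ℝ E with hC
  have hCt : C ≠ ⊤ := by simp [hC]
  -- the times at which the curve is certainly within `(φ k).rOut` of `γ τ`
  set J : ℕ → Set ℝ := fun k => Icc s t ∩ Metric.closedBall τ ((φ k).rOut / V) with hJ
  have hJm : ∀ k, MeasurableSet (J k) := fun k =>
    measurableSet_Icc.inter Metric.isClosed_closedBall.measurableSet
  have hJs : ∀ k, J k ⊆ Icc s t := fun k => inter_subset_left
  have hrV : Tendsto (fun k => (φ k).rOut / V) atTop (𝓝 0) := by
    simpa using h.tendsto_rOut.div_const V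
  have hJ0 : Tendsto (fun k => volume (J k)) atTop (𝓝 0) := by
    refine tendsto_of_tendsto_of_tendsto_of_le_of_le tendsto_const_nhds ?_
      (fun k => zero_le) (fun k => measure_mono (inter_subset_right))
    simp_rw [Real.volume_closedBall]
    have h1 := (ENNReal.continuous_ofReal.tendsto _).comp (hrV.const_mul 2)
    rw [mul_zero, ENNReal.ofReal_zero] at h1
    exact h1
  have hDJ : Tendsto (fun k => ∫⁻ τ' in J k, ‖D (γ τ')‖ₑ) atTop (𝓝 0) := by
    have h1 : Tendsto (fun k => (volume.restrict (Icc s t)) (J k)) atTop (𝓝 0) := by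
      refine hJ0.congr fun k => ?_
      rw [Measure.restrict_apply (hJm k), inter_eq_left.2 (hJs k)]
    refine (tendsto_setLIntegral_zero hD h1).congr fun k => ?_
    rw [Measure.restrict_restrict (hJm k), inter_eq_left.2 (hJs k)]
  -- one side of the time window around `τ` stays inside `[s, t]`
  have hJl : ∀ᶠ k in atTop, ENNReal.ofReal ((φ k).rOut / V) ≤ volume (J k) := by
    have hpos : (0 : ℝ) < (t - s) / 2 := by linarith
    filter_upwards [hrV.eventually (gt_mem_nhds hpos)] with k hk
    have hk0 : 0 < (φ k).rOut / V := div_pos (φ k).rOut_pos hV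
    rcases le_total τ ((s + t) / 2) with hm | hm
    · have : Icc τ (τ + (φ k).rOut / V) ⊆ J k := by
        intro y hy
        refine ⟨⟨hτ.1.trans hy.1, by linarith [hy.2]⟩, ?_⟩
        rw [Metric.mem_closedBall, Real.dist_eq, abs_le]
        constructor <;> linarith [hy.1, hy.2]
      refine le_trans ?_ (measure_mono this)
      rw [Real.volume_Icc]
      exact ENNReal.ofReal_le_ofReal (by linarith)
    · have : Icc (τ - (φ k).rOut / V) τ ⊆ J k := by
        intro y hy
        refine ⟨⟨by linarith [hy.1], hy.2.trans hτ.2⟩, ?_⟩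
        rw [Metric.mem_closedBall, Real.dist_eq, abs_le]
        constructor <;> linarith [hy.1, hy.2]
      refine le_trans ?_ (measure_mono this)
      rw [Real.volume_Icc]
      exact ENNReal.ofReal_le_ofReal (by linarith)
  have hmeas : ∀ k, Measurable fun τ' => meanOsc (2 * (φ k).rOut) D (γ τ') := fun k =>
    (measurable_meanOsc h.stronglyMeasurable_gradient _).comp hγm
  have hbound : ∀ᶠ k in atTop, scaledAverage D (φ k) (γ τ) ≤ ENNReal.ofReal V * (C *
      ((∫⁻ τ' in Icc s t, meanOsc (2 * (φ k).rOut) D (γ τ')) + ∫⁻ τ' in J k, ‖D (γ τ')‖ₑ)) := by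
    filter_upwards [hJl] with k hk
    set A := ⨍⁻ y in Metric.ball (γ τ) (φ k).rOut, ‖D y‖ₑ ∂volume with hA
    have hr := (φ k).rOut_pos
    have h1 : A * volume (J k) ≤ C *
        ((∫⁻ τ' in Icc s t, meanOsc (2 * (φ k).rOut) D (γ τ')) + ∫⁻ τ' in J k, ‖D (γ τ')‖ₑ) := by
      calc A * volume (J k) = ∫⁻ _ in J k, A := by rw [setLIntegral_const]
        _ ≤ ∫⁻ τ' in J k, C * (meanOsc (2 * (φ k).rOut) D (γ τ') + ‖D (γ τ')‖ₑ) := by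
          refine setLIntegral_mono' (hJm k) fun τ' hτ' => laverage_enorm_le D hr ?_
          refine (hlip τ hτ τ' hτ'.1).trans ?_
          have h2 := hτ'.2
          rw [Metric.mem_closedBall, dist_comm, Real.dist_eq, le_div_iff₀ hV] at h2
          linarith
        _ = C * ((∫⁻ τ' in J k, meanOsc (2 * (φ k).rOut) D (γ τ')) +
            ∫⁻ τ' in J k, ‖D (γ τ')‖ₑ) := by
          rw [lintegral_const_mul' _ _ hCt, lintegral_add_left (hmeas k)]
        _ ≤ _ := by
          gcongr
          exact hJs k
    calc scaledAverage D (φ k) (γ τ) = ENNReal.ofReal V *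
          (A * ENNReal.ofReal ((φ k).rOut / V)) := by
          rw [scaledAverage, mul_comm A, ← mul_assoc, ← ENNReal.ofReal_mul hV.le,
            mul_div_cancel₀ _ hV.ne']
      _ ≤ ENNReal.ofReal V * (A * volume (J k)) := by gcongr
      _ ≤ _ := by gcongr
  have hlim : Tendsto (fun k => ENNReal.ofReal V * (C *
      ((∫⁻ τ' in Icc s t, meanOsc (2 * (φ k).rOut) D (γ τ')) + ∫⁻ τ' in J k, ‖D (γ τ')‖ₑ)))
      atTop (𝓝 0) := by
    have h1 := ENNReal.Tendsto.const_mul (hosc.add hDJ) (Or.inr hCt)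
    have h2 := ENNReal.Tendsto.const_mul h1 (Or.inr (ENNReal.ofReal_ne_top (r := V)))
    simpa using h2
  exact tendsto_of_tendsto_of_tendsto_of_le_of_le' tendsto_const_nhds hlim
    (Eventually.of_forall fun k => zero_le) hbound

end FastMollification

end PreciseRepresentative

/-! ### Regularity along almost every curve of a family -/

section Curves

variable {E F : Type*} [NormedAddCommGroup E] [NormedSpace ℝ E] [FiniteDimensional ℝ E]
  [MeasureSpace E] [BorelSpace E] [(volume : Measure E).IsAddHaarMeasure]
  [NormedAddCommGroup F] [NormedSpace ℝ F]

namespace FastMollification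

variable {Ω : Set E} {u : E → F} {D : E → E →L[ℝ] F} {φ : ℕ → ContDiffBump (0 : E)}

/-- Pointwise convergence of the mollifications wherever the mean oscillations are summable. -/
theorem tendsto_mollify_of_tsum_ne_top [CompleteSpace F] (h : FastMollification Ω u D φ) {x : E}
    (hx : ∑' k, meanOsc (2 * (φ k).rOut) u x ≠ ⊤) :
    Tendsto (fun k => mollify (φ k) u x) atTop (𝓝 (u x)) := by
  rw [tendsto_iff_edist_tendsto_0]
  have h0 := ENNReal.tendsto_atTop_zero_of_tsum_ne_top hx
  have h1 := ENNReal.Tendsto.const_mul (a := 2 ^ Module.finrank ℝ E)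
    (ENNReal.Tendsto.const_mul (a := 2 ^ Module.finrank ℝ E) h0 (Or.inr (by simp)))
    (Or.inr (by simp))
  rw [mul_zero, mul_zero] at h1
  refine tendsto_of_tendsto_of_tendsto_of_le_of_le tendsto_const_nhds h1 (fun k => zero_le)
    (fun k => ?_)
  simp only [edist_eq_enorm_sub]
  exact enorm_mollify_sub_self_le (φ k) (h.rOut_eq k) h.locallyIntegrable x

theorem lintegral_meanOsc_ne_top {G : Type*} [NormedAddCommGroup G] {f : E → G}
    (hf : StronglyMeasurable f) (hfi : LocallyIntegrable f volume) {r : ℝ} (hr : 0 < r) (R : ℝ) :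
    ∫⁻ x in Metric.ball (0 : E) R, meanOsc r f x ≠ ⊤ := by
  have hfin : ∀ R : ℝ, ∫⁻ x in Metric.ball (0 : E) R, ‖f x‖ₑ ≠ ⊤ := fun R =>
    ((hfi.integrableOn_isCompact (isCompact_closedBall 0 R)).mono_set
      Metric.ball_subset_closedBall).2.ne
  have hpt : ∀ x, meanOsc r f x ≤ (⨍⁻ y in Metric.ball x r, ‖f y‖ₑ ∂volume) + ‖f x‖ₑ := by
    intro x
    have h0 : volume (Metric.ball x r) ≠ 0 := (Metric.measure_ball_pos _ _ hr).ne'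
    have h1 : volume (Metric.ball x r) ≠ ⊤ := measure_ball_lt_top.ne
    rw [meanOsc, ← setLAverage_const h0 h1 ‖f x‖ₑ, setLAverage_eq, setLAverage_eq, setLAverage_eq,
      ← ENNReal.add_div, ← lintegral_add_right _ measurable_const]
    gcongr ?_ / _
    exact lintegral_mono fun y => enorm_sub_le
  refine ne_top_of_le_ne_top ?_ (lintegral_mono hpt)
  rw [lintegral_add_right _ hf.enorm]
  exact ENNReal.add_ne_top.2 ⟨ne_top_of_le_ne_top (hfin (R + r))
    (lintegral_laverage_ball_le hf.enorm R hr), hfin R⟩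

theorem measurable_tsum_meanOsc (h : FastMollification Ω u D φ) :
    Measurable fun x => ∑' k, (meanOsc (2 * (φ k).rOut) u x + meanOsc (2 * (φ k).rOut) D x) :=
  Measurable.tsum fun _ => (measurable_meanOsc h.stronglyMeasurable _).add
    (measurable_meanOsc h.stronglyMeasurable_gradient _)

theorem lintegral_tsum_meanOsc_ne_top (h : FastMollification Ω u D φ) (R : ℝ) :
    ∫⁻ x in Metric.ball (0 : E) R, ∑' k,
      (meanOsc (2 * (φ k).rOut) u x + meanOsc (2 * (φ k).rOut) D x) ≠ ⊤ := by
  have hmu : ∀ k, Measurable (meanOsc (2 * (φ k).rOut) u) := fun k =>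
    measurable_meanOsc h.stronglyMeasurable _
  have hmD : ∀ k, Measurable (meanOsc (2 * (φ k).rOut) D) := fun k =>
    measurable_meanOsc h.stronglyMeasurable_gradient _
  have hm : ∀ k, Measurable fun x =>
      meanOsc (2 * (φ k).rOut) u x + meanOsc (2 * (φ k).rOut) D x := fun k => (hmu k).add (hmD k)
  rw [lintegral_tsum fun k => (hm k).aemeasurable]
  obtain ⟨m, hm⟩ := exists_nat_ge R
  have hfin : ∀ k, ∫⁻ x in Metric.ball (0 : E) R,
      (meanOsc (2 * (φ k).rOut) u x + meanOsc (2 * (φ k).rOut) D x) ≠ ⊤ := by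
    intro k
    have hr : 0 < 2 * (φ k).rOut := by linarith [(φ k).rOut_pos]
    rw [lintegral_add_left (hmu k)]
    exact ENNReal.add_ne_top.2
      ⟨lintegral_meanOsc_ne_top h.stronglyMeasurable h.locallyIntegrable hr R,
      lintegral_meanOsc_ne_top h.stronglyMeasurable_gradient h.locallyIntegrable_gradient hr R⟩
  rw [← ENNReal.summable.sum_add_tsum_nat_add' (k := m)]
  refine ENNReal.add_ne_top.2 ⟨(ENNReal.sum_lt_top.2 fun k _ => (hfin k).lt_top).ne, ?_⟩
  have hle : ∀ k : ℕ, ∫⁻ x in Metric.ball (0 : E) R,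
      (meanOsc (2 * (φ (k + m)).rOut) u x + meanOsc (2 * (φ (k + m)).rOut) D x) ≤
        2 * 2⁻¹ ^ k := by
    intro k
    have hsub : Metric.ball (0 : E) R ⊆ Metric.ball 0 ((k + m : ℕ) : ℝ) := by
      apply Metric.ball_subset_ball
      push_cast
      have : (0 : ℝ) ≤ k := k.cast_nonneg
      linarith
    have hpow : (2⁻¹ : ℝ≥0∞) ^ (k + m) ≤ 2⁻¹ ^ k :=
      pow_le_pow_right_of_le_one' (ENNReal.inv_le_one.2 one_le_two) (Nat.le_add_right k m)
    rw [lintegral_add_left (hmu _), two_mul ((2⁻¹ : ℝ≥0∞) ^ k)]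
    exact add_le_add
      (((lintegral_mono_set hsub).trans (h.lintegral_meanOsc_le _)).trans hpow)
      (((lintegral_mono_set hsub).trans (h.lintegral_meanOsc_gradient_le _)).trans hpow)
  refine ne_top_of_le_ne_top ?_ (ENNReal.tsum_le_tsum hle)
  rw [ENNReal.tsum_mul_left, ENNReal.tsum_geometric]
  simp [ENNReal.mul_eq_top]

/-- The precise representative is a representative of `u`. -/
theorem ae_mem_regularSet [CompleteSpace F] (h : FastMollification Ω u D φ) :
    ∀ᵐ x ∂volume, x ∈ Ω → x ∈ regularSet Ω u D φ ∧ preciseRep Ω u D φ x = u x := by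
  have h1 : ∀ᵐ x : E ∂volume,
      ∑' k, (meanOsc (2 * (φ k).rOut) u x + meanOsc (2 * (φ k).rOut) D x) ≠ ⊤ := by
    have h2 : ∀ n : ℕ, ∀ᵐ x : E ∂volume, x ∈ Metric.ball (0 : E) n →
        ∑' k, (meanOsc (2 * (φ k).rOut) u x + meanOsc (2 * (φ k).rOut) D x) ≠ ⊤ := by
      intro n
      rw [← ae_restrict_iff' Metric.isOpen_ball.measurableSet]
      filter_upwards [ae_lt_top h.measurable_tsum_meanOsc (h.lintegral_tsum_meanOsc_ne_top n)]
        with x hx using hx.ne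
    filter_upwards [ae_all_iff.2 h2] with x hx
    obtain ⟨n, hn⟩ := exists_nat_gt (dist x 0)
    exact hx n hn
  filter_upwards [h1] with x hx hxΩ
  have hxu : ∑' k, meanOsc (2 * (φ k).rOut) u x ≠ ⊤ :=
    ne_top_of_le_ne_top hx (ENNReal.tsum_le_tsum fun k => le_self_add)
  have hxD : ∑' k, meanOsc (2 * (φ k).rOut) D x ≠ ⊤ :=
    ne_top_of_le_ne_top hx (ENNReal.tsum_le_tsum fun k => le_add_self)
  have hlim := h.tendsto_mollify_of_tsum_ne_top hxu
  have hsc : Tendsto (fun k => scaledAverage D (φ k) x) atTop (𝓝 0) := by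
    have h3 : Tendsto (fun k => ENNReal.ofReal (φ k).rOut * (2 ^ Module.finrank ℝ E *
        (meanOsc (2 * (φ k).rOut) D x + ‖D x‖ₑ))) atTop (𝓝 0) := by
      have h4 : Tendsto (fun k => ENNReal.ofReal (φ k).rOut) atTop (𝓝 0) := by
        have := (ENNReal.continuous_ofReal.tendsto _).comp h.tendsto_rOut
        rwa [ENNReal.ofReal_zero] at this
      have h5 := ENNReal.Tendsto.const_mul (a := 2 ^ Module.finrank ℝ E)
        ((ENNReal.tendsto_atTop_zero_of_tsum_ne_top hxD).add_const ‖D x‖ₑ) (Or.inr (by simp))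
      have h6 := ENNReal.Tendsto.mul h4 (Or.inr (by finiteness)) h5 (Or.inr (by simp))
      simpa using h6
    refine tendsto_of_tendsto_of_tendsto_of_le_of_le tendsto_const_nhds h3 (fun k => zero_le)
      (fun k => ?_)
    simp only [scaledAverage]
    gcongr
    exact laverage_enorm_le D (φ k).rOut_pos (by simpa using (φ k).rOut_pos.le)
  have hmem : x ∈ regularSet Ω u D φ := ⟨hxΩ, ⟨_, hlim⟩, hsc⟩
  exact ⟨hmem, tendsto_nhds_unique (tendsto_preciseRep hmem) hlim⟩

/-- Along a `C¹` curve in `Ω` on which the errors of the mollifications are summable, every point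
is regular and the fundamental theorem of calculus holds for the precise representative: the
derivatives of the mollifications converge in `L¹` along the curve, and their values converge at
one time, hence at every time. -/
theorem regular_curve [CompleteSpace F] (h : FastMollification Ω u D φ) {s t : ℝ} (hst : s < t)
    {K : Set E} (hK : IsCompact K) (hKΩ : K ⊆ Ω) {γ γ' : ℝ → E} (hγm : Measurable γ)
    (hγ : ∀ τ ∈ Icc s t, HasDerivAt γ (γ' τ) τ) (hγ' : ContinuousOn γ' (Icc s t))
    (hmaps : ∀ τ ∈ Icc s t, γ τ ∈ K)
    (hD : ∫⁻ τ in Icc s t, ‖D (γ τ)‖ₑ ≠ ⊤)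
    (hosc : ∑' k, ∫⁻ τ in Icc s t,
      (meanOsc (2 * (φ k).rOut) u (γ τ) + meanOsc (2 * (φ k).rOut) D (γ τ)) ≠ ⊤) :
    (∀ τ ∈ Icc s t, γ τ ∈ regularSet Ω u D φ) ∧
    IntegrableOn (fun τ => D (γ τ) (γ' τ)) (Icc s t) ∧
    ∀ τ₁ ∈ Icc s t, ∀ τ₂ ∈ Icc s t,
      preciseRep Ω u D φ (γ τ₂) - preciseRep Ω u D φ (γ τ₁) = ∫ τ in τ₁..τ₂, D (γ τ) (γ' τ) := by
  obtain ⟨V, hV, hVb⟩ : ∃ V : ℝ, 0 < V ∧ ∀ τ ∈ Icc s t, ‖γ' τ‖ ≤ V := by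
    obtain ⟨V, hVb⟩ := isCompact_Icc.exists_bound_of_continuousOn hγ'
    exact ⟨max V 1, lt_max_of_lt_right one_pos, fun τ hτ => (hVb τ hτ).trans (le_max_left _ _)⟩
  have hlip : ∀ τ₁ ∈ Icc s t, ∀ τ₂ ∈ Icc s t, dist (γ τ₁) (γ τ₂) ≤ V * |τ₁ - τ₂| := by
    intro τ₁ h₁ τ₂ h₂
    rw [dist_eq_norm, ← Real.norm_eq_abs]
    exact (convex_Icc s t).norm_image_sub_le_of_norm_hasDerivWithin_le
      (fun τ hτ => (hγ τ hτ).hasDerivWithinAt) hVb h₂ h₁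
  have hmu : ∀ k, Measurable fun τ => meanOsc (2 * (φ k).rOut) u (γ τ) := fun k =>
    (measurable_meanOsc h.stronglyMeasurable _).comp hγm
  have hmD : ∀ k, Measurable fun τ => meanOsc (2 * (φ k).rOut) D (γ τ) := fun k =>
    (measurable_meanOsc h.stronglyMeasurable_gradient _).comp hγm
  have hosc0 := ENNReal.tendsto_atTop_zero_of_tsum_ne_top hosc
  have hoscD : Tendsto (fun k => ∫⁻ τ in Icc s t, meanOsc (2 * (φ k).rOut) D (γ τ)) atTop (𝓝 0) :=
    tendsto_of_tendsto_of_tendsto_of_le_of_le tendsto_const_nhds hosc0 (fun k => zero_le)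
      (fun k => lintegral_mono fun τ => le_add_self)
  -- the mollifications of `u` converge at almost every time, so at some time `τ₀`
  obtain ⟨τ₀, hτ₀, hlim₀⟩ : ∃ τ₀ ∈ Icc s t,
      Tendsto (fun k => mollify (φ k) u (γ τ₀)) atTop (𝓝 (u (γ τ₀))) := by
    have h1 : ∫⁻ τ in Icc s t, ∑' k, meanOsc (2 * (φ k).rOut) u (γ τ) ≠ ⊤ := by
      rw [lintegral_tsum fun k => (hmu k).aemeasurable]
      refine ne_top_of_le_ne_top hosc (ENNReal.tsum_le_tsum fun k => ?_)
      exact lintegral_mono fun τ => le_self_add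
    have h2 := ae_lt_top (Measurable.tsum hmu) h1
    have h3 : (ae (volume.restrict (Icc s t))).NeBot := by
      rw [ae_neBot, Ne, Measure.restrict_eq_zero, Real.volume_Icc]
      simpa using hst
    obtain ⟨τ₀, h4, h5⟩ := (h2.and (ae_restrict_mem measurableSet_Icc)).exists
    exact ⟨τ₀, h5, h.tendsto_mollify_of_tsum_ne_top h4.ne⟩
  have hγ'm : AEStronglyMeasurable γ' (volume.restrict (Icc s t)) :=
    hγ'.aestronglyMeasurable measurableSet_Icc
  have hγc : ContinuousOn γ (Icc s t) := fun τ hτ => (hγ τ hτ).continuousAt.continuousWithinAt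
  have hDm : StronglyMeasurable fun τ => D (γ τ) :=
    h.stronglyMeasurable_gradient.comp_measurable hγm
  have hint : IntegrableOn (fun τ => D (γ τ) (γ' τ)) (Icc s t) := by
    have hDi : IntegrableOn (fun τ => D (γ τ)) (Icc s t) :=
      ⟨hDm.aestronglyMeasurable, hD.lt_top⟩
    refine Integrable.mono' (hDi.norm.mul_const V) ?_ ?_
    · exact (ContinuousLinearMap.apply ℝ F : E →L[ℝ] (E →L[ℝ] F) →L[ℝ] F).flip
        |>.aestronglyMeasurable_comp₂ hDm.aestronglyMeasurable hγ'm
    · filter_upwards [ae_restrict_mem measurableSet_Icc] with τ hτ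
      exact ((D (γ τ)).le_opNorm _).trans (by gcongr; exact hVb τ hτ)
  have hmollD : ∀ k, Continuous (mollify (φ k) D) := fun k =>
    continuous_mollify _ h.locallyIntegrable_gradient
  have hcontk : ∀ k, ContinuousOn (fun τ => mollify (φ k) D (γ τ) (γ' τ)) (Icc s t) := fun k =>
    ((hmollD k).comp_continuousOn hγc).clm_apply hγ'
  have hintk : ∀ k, IntegrableOn (fun τ => mollify (φ k) D (γ τ) (γ' τ)) (Icc s t) := fun k =>
    (hcontk k).integrableOn_compact isCompact_Icc
  have hL1 : Tendsto (fun k => ∫⁻ τ in Icc s t,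
      ‖mollify (φ k) D (γ τ) (γ' τ) - D (γ τ) (γ' τ)‖ₑ) atTop (𝓝 0) := by
    set C : ℝ≥0∞ := 2 ^ Module.finrank ℝ E with hC
    have h1 : Tendsto (fun k => C * (C * ENNReal.ofReal V) *
        ∫⁻ τ in Icc s t, meanOsc (2 * (φ k).rOut) D (γ τ)) atTop (𝓝 0) := by
      have := ENNReal.Tendsto.const_mul (a := C * (C * ENNReal.ofReal V)) hoscD
        (Or.inr (by finiteness))
      simpa using this
    refine tendsto_of_tendsto_of_tendsto_of_le_of_le tendsto_const_nhds h1 (fun k => zero_le)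
      (fun k => ?_)
    simp only
    rw [← lintegral_const_mul _ (hmD k)]
    refine setLIntegral_mono' measurableSet_Icc fun τ hτ => ?_
    rw [← sub_apply]
    calc ‖(mollify (φ k) D (γ τ) - D (γ τ)) (γ' τ)‖ₑ
        ≤ ‖mollify (φ k) D (γ τ) - D (γ τ)‖ₑ * ‖γ' τ‖ₑ := ContinuousLinearMap.le_opENorm _ _
      _ ≤ C * (C * meanOsc (2 * (φ k).rOut) D (γ τ)) * ENNReal.ofReal V := by
        gcongr
        · exact enorm_mollify_sub_self_le (φ k) (h.rOut_eq k) h.locallyIntegrable_gradient _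
        · rw [← ofReal_norm]
          exact ENNReal.ofReal_le_ofReal (hVb τ hτ)
      _ = _ := by ring
  have hlimint : ∀ τ₁ ∈ Icc s t, ∀ τ₂ ∈ Icc s t,
      Tendsto (fun k => ∫ τ in τ₁..τ₂, mollify (φ k) D (γ τ) (γ' τ)) atTop
        (𝓝 (∫ τ in τ₁..τ₂, D (γ τ) (γ' τ))) := by
    have key : ∀ τ₁ ∈ Icc s t, ∀ τ₂ ∈ Icc s t,
        Tendsto (fun k => ∫ τ in Ioc τ₁ τ₂, mollify (φ k) D (γ τ) (γ' τ)) atTop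
          (𝓝 (∫ τ in Ioc τ₁ τ₂, D (γ τ) (γ' τ))) := by
      intro τ₁ h₁ τ₂ h₂
      have hsub : Ioc τ₁ τ₂ ⊆ Icc s t := fun y hy => ⟨h₁.1.trans hy.1.le, hy.2.trans h₂.2⟩
      have := tendsto_setIntegral_of_L1 _ hint.aestronglyMeasurable
        (Eventually.of_forall hintk) hL1 (Ioc τ₁ τ₂)
      simpa only [Measure.restrict_restrict measurableSet_Ioc, inter_eq_left.2 hsub] using this
    intro τ₁ h₁ τ₂ h₂
    simp only [intervalIntegral]
    exact (key τ₁ h₁ τ₂ h₂).sub (key τ₂ h₂ τ₁ h₁)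
  have hftc : ∀ᶠ k in atTop, ∀ τ₁ ∈ Icc s t, ∀ τ₂ ∈ Icc s t,
      ∫ τ in τ₁..τ₂, mollify (φ k) D (γ τ) (γ' τ) =
        mollify (φ k) u (γ τ₂) - mollify (φ k) u (γ τ₁) := by
    filter_upwards [h.eventually_closedBall_subset hK hKΩ] with k hk τ₁ h₁ τ₂ h₂
    have hsub : uIcc τ₁ τ₂ ⊆ Icc s t := ordConnected_Icc.uIcc_subset h₁ h₂
    refine intervalIntegral.integral_eq_sub_of_hasDerivAt
      (f := fun τ => mollify (φ k) u (γ τ)) (fun τ hτ => ?_) ?_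
    · exact (hasFDerivAt_mollify h.locallyIntegrable h.locallyIntegrable_gradient h.integral_eq
        (φ k) (hk _ (hmaps τ (hsub hτ)))).comp_hasDerivAt τ (hγ τ (hsub hτ))
    · exact ((hcontk k).mono hsub).intervalIntegrable
  have hconv : ∀ τ ∈ Icc s t, Tendsto (fun k => mollify (φ k) u (γ τ)) atTop
      (𝓝 (u (γ τ₀) + ∫ τ' in τ₀..τ, D (γ τ') (γ' τ'))) := by
    intro τ hτ
    refine (hlim₀.add (hlimint τ₀ hτ₀ τ hτ)).congr' ?_
    filter_upwards [hftc] with k hk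
    rw [hk τ₀ hτ₀ τ hτ]; abel
  have hreg : ∀ τ ∈ Icc s t, γ τ ∈ regularSet Ω u D φ := fun τ hτ =>
    ⟨hKΩ (hmaps τ hτ), ⟨_, hconv τ hτ⟩, h.tendsto_scaledAverage_curve hst hV hlip hγm hD hoscD hτ⟩
  refine ⟨hreg, hint, fun τ₁ h₁ τ₂ h₂ => ?_⟩
  refine tendsto_nhds_unique ?_ (hlimint τ₁ h₁ τ₂ h₂)
  refine ((tendsto_preciseRep (hreg τ₂ h₂)).sub (tendsto_preciseRep (hreg τ₁ h₁))).congr' ?_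
  filter_upwards [hftc] with k hk
  rw [hk τ₁ h₁ τ₂ h₂]

/-- The conclusions of `regular_curve` for almost every curve of a measured family that does not
concentrate, i.e. that maps `μ × dτ` to a measure of bounded density on `K`. -/
theorem ae_regular_curve [CompleteSpace F] (h : FastMollification Ω u D φ) {A : Type*}
    [MeasurableSpace A] {μ : Measure A} [SFinite μ] {s t : ℝ} (hst : s < t)
    {K : Set E} (hK : IsCompact K) (hKΩ : K ⊆ Ω) {γ γ' : A → ℝ → E}
    (hγm : Measurable (Function.uncurry γ))
    (hγ : ∀ a, ∀ τ ∈ Icc s t, HasDerivAt (γ a) (γ' a τ) τ)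
    (hγ' : ∀ a, ContinuousOn (γ' a) (Icc s t))
    (hmaps : ∀ᵐ a ∂μ, ∀ τ ∈ Icc s t, γ a τ ∈ K) {C : ℝ≥0∞} (hC : C ≠ ⊤)
    (hbound : ∀ f : E → ℝ≥0∞, Measurable f →
      ∫⁻ a, ∫⁻ τ in Icc s t, f (γ a τ) ∂volume ∂μ ≤ C * ∫⁻ x in K, f x) :
    ∀ᵐ a ∂μ, (∀ τ ∈ Icc s t, γ a τ ∈ regularSet Ω u D φ) ∧
      IntegrableOn (fun τ => D (γ a τ) (γ' a τ)) (Icc s t) ∧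
      ∀ τ₁ ∈ Icc s t, ∀ τ₂ ∈ Icc s t,
        preciseRep Ω u D φ (γ a τ₂) - preciseRep Ω u D φ (γ a τ₁) =
          ∫ τ in τ₁..τ₂, D (γ a τ) (γ' a τ) := by
  have hfin : ∀ f : E → ℝ≥0∞, Measurable f → ∫⁻ x in K, f x ≠ ⊤ →
      ∀ᵐ a ∂μ, ∫⁻ τ in Icc s t, f (γ a τ) ≠ ⊤ := by
    intro f hf hfK
    have hm : Measurable fun a => ∫⁻ τ in Icc s t, f (γ a τ) :=
      Measurable.lintegral_prod_right' (f := fun q : A × ℝ => f (γ q.1 q.2)) (hf.comp hγm)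
    filter_upwards [ae_lt_top hm (ne_top_of_le_ne_top (ENNReal.mul_ne_top hC hfK) (hbound f hf))]
      with a ha using ha.ne
  have hsumK : ∫⁻ x in K, ∑' k,
      (meanOsc (2 * (φ k).rOut) u x + meanOsc (2 * (φ k).rOut) D x) ≠ ⊤ := by
    obtain ⟨R, hR⟩ := hK.isBounded.subset_ball 0
    exact ne_top_of_le_ne_top (h.lintegral_tsum_meanOsc_ne_top R) (lintegral_mono_set hR)
  have h1 := hfin _ h.measurable_tsum_meanOsc hsumK
  have h2 := hfin (fun x => ‖D x‖ₑ) h.stronglyMeasurable_gradient.enorm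
    (h.locallyIntegrable_gradient.integrableOn_isCompact hK).2.ne
  filter_upwards [h1, h2, hmaps] with a ha1 ha2 ha3
  have hγam : Measurable (γ a) := hγm.comp measurable_prodMk_left
  refine h.regular_curve hst hK hKΩ hγam (hγ a) (hγ' a) ha3 ha2 ?_
  have hm : ∀ k, Measurable fun τ =>
      meanOsc (2 * (φ k).rOut) u (γ a τ) + meanOsc (2 * (φ k).rOut) D (γ a τ) := fun k =>
    ((measurable_meanOsc h.stronglyMeasurable _).comp hγam).add
      ((measurable_meanOsc h.stronglyMeasurable_gradient _).comp hγam)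
  rwa [← lintegral_tsum fun k => (hm k).aemeasurable]

end FastMollification

end Curves

/-! ### The Poincaré inequality on balls -/

section Poincare

variable {E F : Type*} [NormedAddCommGroup E] [NormedSpace ℝ E] [FiniteDimensional ℝ E]
  [MeasureSpace E] [BorelSpace E] [(volume : Measure E).IsAddHaarMeasure]
  [NormedAddCommGroup F] [NormedSpace ℝ F]

/-- Change of variables `z = c + s • y`, as an upper bound. -/
theorem setLIntegral_comp_add_smul_le {f : E → ℝ≥0∞} (hf : Measurable f) {S T : Set E}
    (hS : MeasurableSet S) (hT : MeasurableSet T) (c : E) {s : ℝ} (hs : 0 < s)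
    (hST : ∀ y ∈ S, c + s • y ∈ T) :
    ∫⁻ y in S, f (c + s • y) ≤
      ENNReal.ofReal ((s ^ Module.finrank ℝ E)⁻¹) * ∫⁻ z in T, f z := by
  have hm : Measurable fun y : E => s • y := measurable_const_smul s
  have hg : Measurable fun z => T.indicator f (c + z) :=
    (hf.indicator hT).comp (measurable_const_add c)
  calc ∫⁻ y in S, f (c + s • y) ≤ ∫⁻ y, T.indicator f (c + s • y) := by
        rw [← lintegral_indicator hS]
        refine lintegral_mono fun y => ?_
        by_cases hy : y ∈ S
        · rw [indicator_of_mem hy, indicator_of_mem (hST y hy)]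
        · rw [indicator_of_notMem hy]; exact zero_le
    _ = ∫⁻ z, T.indicator f (c + z) ∂(Measure.map (fun y : E => s • y) volume) := by
        rw [lintegral_map hg hm]
    _ = _ := by
        rw [Measure.map_addHaar_smul _ hs.ne', lintegral_smul_measure, smul_eq_mul,
          lintegral_add_left_eq_self (fun z => T.indicator f z) c, lintegral_indicator hT,
          abs_of_pos (inv_pos.2 (pow_pos hs _))]

/-- The segments between points of a ball do not concentrate: near one of its endpoints, the
point of a segment at a given time is a dilation of that endpoint with factor at least `1 / 2`. -/
theorem lintegral_segment_le {f : E → ℝ≥0∞} (hf : Measurable f) (x₀ : E) (r : ℝ) :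
    ∫⁻ a : E × E, ∫⁻ τ in Icc (0 : ℝ) 1, f (a.1 + τ • (a.2 - a.1)) ∂volume
      ∂((volume.restrict (Metric.ball x₀ r)).prod (volume.restrict (Metric.ball x₀ r))) ≤
      2 ^ Module.finrank ℝ E * volume (Metric.ball x₀ r) * ∫⁻ z in Metric.ball x₀ r, f z := by
  set B := Metric.ball x₀ r with hB
  have hBm : MeasurableSet B := Metric.isOpen_ball.measurableSet
  have hmeas : Measurable fun q : (E × E) × ℝ => f (q.1.1 + q.2 • (q.1.2 - q.1.1)) :=
    hf.comp (Continuous.measurable (by fun_prop))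
  have hconst : ∀ s : ℝ, 1 / 2 ≤ s →
      ENNReal.ofReal ((s ^ Module.finrank ℝ E)⁻¹) ≤ 2 ^ Module.finrank ℝ E := by
    intro s hs
    have : (s ^ Module.finrank ℝ E)⁻¹ ≤ 2 ^ Module.finrank ℝ E := by
      rw [← inv_pow]
      refine pow_le_pow_left₀ (inv_nonneg.2 (by linarith)) ?_ _
      exact (inv_anti₀ (by norm_num) hs).trans (by norm_num)
    refine (ENNReal.ofReal_le_ofReal this).trans_eq ?_
    rw [ENNReal.ofReal_pow two_pos.le]; simp
  have hmem : ∀ x ∈ B, ∀ y ∈ B, ∀ τ ∈ Icc (0 : ℝ) 1, x + τ • (y - x) ∈ B := fun x hx y hy τ hτ =>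
    (convex_ball x₀ r).add_smul_sub_mem hx hy hτ
  rw [lintegral_lintegral_swap hmeas.aemeasurable]
  have hτ : ∀ τ ∈ Icc (0 : ℝ) 1,
      ∫⁻ a : E × E, f (a.1 + τ • (a.2 - a.1)) ∂((volume.restrict B).prod (volume.restrict B)) ≤
        2 ^ Module.finrank ℝ E * volume B * ∫⁻ z in B, f z := by
    intro τ hτ
    have hmτ : Measurable fun a : E × E => f (a.1 + τ • (a.2 - a.1)) :=
      hmeas.comp (measurable_id.prodMk measurable_const)
    have hfin : ∫⁻ _ in B, (2 ^ Module.finrank ℝ E * ∫⁻ z in B, f z) =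
        2 ^ Module.finrank ℝ E * volume B * ∫⁻ z in B, f z := by
      rw [setLIntegral_const]; ring
    rcases le_total (1 / 2) τ with h2 | h2
    · rw [lintegral_prod _ hmτ.aemeasurable, ← hfin]
      refine setLIntegral_mono' hBm fun x hx => ?_
      have := setLIntegral_comp_add_smul_le hf hBm hBm ((1 - τ) • x) (s := τ) (by linarith)
        (fun y hy => by
          have := hmem x hx y hy τ hτ
          rwa [show (1 - τ) • x + τ • y = x + τ • (y - x) by module])
      refine le_trans (le_of_eq ?_) (this.trans (by gcongr; exact hconst τ h2))
      refine lintegral_congr fun y => ?_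
      congr 1; module
    · rw [lintegral_prod_symm _ hmτ.aemeasurable, ← hfin]
      refine setLIntegral_mono' hBm fun y hy => ?_
      have := setLIntegral_comp_add_smul_le hf hBm hBm (τ • y) (s := 1 - τ) (by linarith)
        (fun x hx => by
          have := hmem x hx y hy τ hτ
          rwa [show τ • y + (1 - τ) • x = x + τ • (y - x) by module])
      refine le_trans (le_of_eq ?_) (this.trans (by gcongr; exact hconst _ (by linarith)))
      refine lintegral_congr fun x => ?_
      congr 1; module
  calc _ ≤ ∫⁻ _ in Icc (0 : ℝ) 1, 2 ^ Module.finrank ℝ E * volume B * ∫⁻ z in B, f z :=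
        setLIntegral_mono' measurableSet_Icc hτ
    _ = _ := by rw [setLIntegral_const]; simp

namespace FastMollification

variable {Ω : Set E} {u : E → F} {D : E → E →L[ℝ] F} {φ : ℕ → ContDiffBump (0 : E)}

/-- A Poincaré inequality on balls, obtained by integrating the fundamental theorem of calculus
over the segments between points of the ball. -/
theorem lintegral_lintegral_enorm_sub_le [CompleteSpace F] (h : FastMollification Ω u D φ) {x₀ : E}
    {r : ℝ} (hsub : Metric.closedBall x₀ r ⊆ Ω) :
    ∫⁻ x in Metric.ball x₀ r, ∫⁻ y in Metric.ball x₀ r, ‖u x - u y‖ₑ ≤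
      2 ^ Module.finrank ℝ E * volume (Metric.ball x₀ r) *
        (ENNReal.ofReal (2 * r) * ∫⁻ z in Metric.ball x₀ r, ‖D z‖ₑ) := by
  set B := Metric.ball x₀ r with hB
  have hBm : MeasurableSet B := Metric.isOpen_ball.measurableSet
  set μ : Measure (E × E) := (volume.restrict B).prod (volume.restrict B) with hμ
  have hmem : ∀ᵐ a ∂μ, a.1 ∈ B ∧ a.2 ∈ B := by
    rw [hμ, Measure.prod_restrict]
    filter_upwards [ae_restrict_mem (hBm.prod hBm)] with a ha using ha
  have hcurve := h.ae_regular_curve (μ := μ) one_pos (isCompact_closedBall x₀ r) hsub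
    (γ := fun a τ => a.1 + τ • (a.2 - a.1)) (γ' := fun a _ => a.2 - a.1)
    (Continuous.measurable (by unfold Function.uncurry; fun_prop))
    (fun a τ _ => by
      simpa using ((hasDerivAt_id τ).smul_const (a.2 - a.1)).const_add a.1)
    (fun a => continuousOn_const)
    (by
      filter_upwards [hmem] with a ha τ hτ
      exact Metric.ball_subset_closedBall ((convex_ball x₀ r).add_smul_sub_mem ha.1 ha.2 hτ))
    (C := 2 ^ Module.finrank ℝ E * volume B)
    (ENNReal.mul_ne_top (by simp) measure_ball_lt_top.ne)
    (fun f hf => (lintegral_segment_le hf x₀ r).trans (by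
      gcongr; exact Metric.ball_subset_closedBall))
  have hrep : ∀ᵐ x ∂(volume.restrict B), preciseRep Ω u D φ x = u x := by
    rw [ae_restrict_iff' hBm]
    filter_upwards [h.ae_mem_regularSet] with x hx hxB
    exact (hx (hsub (Metric.ball_subset_closedBall hxB))).2
  have hrep1 : ∀ᵐ a ∂μ, preciseRep Ω u D φ a.1 = u a.1 := Measure.quasiMeasurePreserving_fst.ae hrep
  have hrep2 : ∀ᵐ a ∂μ, preciseRep Ω u D φ a.2 = u a.2 := Measure.quasiMeasurePreserving_snd.ae hrep
  have hpt : ∀ᵐ a ∂μ, ‖u a.1 - u a.2‖ₑ ≤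
      ENNReal.ofReal (2 * r) * ∫⁻ τ in Icc (0 : ℝ) 1, ‖D (a.1 + τ • (a.2 - a.1))‖ₑ := by
    filter_upwards [hcurve, hrep1, hrep2, hmem] with a ha h1 h2 h3
    have h4 := ha.2.2 1 (by simp) 0 (by simp)
    have hnorm : ‖a.2 - a.1‖ₑ ≤ ENNReal.ofReal (2 * r) := by
      rw [← ofReal_norm, ← dist_eq_norm]
      refine ENNReal.ofReal_le_ofReal ?_
      have h5 := Metric.mem_ball.1 h3.1
      have h6 := Metric.mem_ball.1 h3.2
      linarith [dist_triangle_right a.2 a.1 x₀]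
    simp only [zero_smul, add_zero, one_smul, add_sub_cancel, h1, h2] at h4
    rw [h4, intervalIntegral.integral_symm, enorm_neg, intervalIntegral.integral_of_le zero_le_one,
      ← lintegral_const_mul' _ _ ENNReal.ofReal_ne_top]
    refine (enorm_integral_le_lintegral_enorm _).trans ?_
    refine (lintegral_mono_set Ioc_subset_Icc_self).trans (lintegral_mono fun τ => ?_)
    rw [mul_comm]
    exact (ContinuousLinearMap.le_opENorm _ _).trans (by gcongr)
  have hum : Measurable fun a : E × E => ‖u a.1 - u a.2‖ₑ :=
    ((h.stronglyMeasurable.comp_measurable measurable_fst).sub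
      (h.stronglyMeasurable.comp_measurable measurable_snd)).enorm
  calc ∫⁻ x in B, ∫⁻ y in B, ‖u x - u y‖ₑ = ∫⁻ a, ‖u a.1 - u a.2‖ₑ ∂μ :=
        (lintegral_prod _ hum.aemeasurable).symm
    _ ≤ ∫⁻ a, ENNReal.ofReal (2 * r) *
        ∫⁻ τ in Icc (0 : ℝ) 1, ‖D (a.1 + τ • (a.2 - a.1))‖ₑ ∂volume ∂μ := lintegral_mono_ae hpt
    _ = ENNReal.ofReal (2 * r) * ∫⁻ a,
        ∫⁻ τ in Icc (0 : ℝ) 1, ‖D (a.1 + τ • (a.2 - a.1))‖ₑ ∂volume ∂μ :=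
        lintegral_const_mul' _ _ ENNReal.ofReal_ne_top
    _ ≤ ENNReal.ofReal (2 * r) * (2 ^ Module.finrank ℝ E * volume B * ∫⁻ z in B, ‖D z‖ₑ) := by
        gcongr
        exact lintegral_segment_le h.stronglyMeasurable_gradient.enorm x₀ r
    _ = _ := by ring

/-- At a regular point, `u` has its precise value as a Lebesgue value along the radii of the
mollifications. -/
theorem tendsto_laverage_enorm_sub [CompleteSpace F] (h : FastMollification Ω u D φ) {x₀ : E}
    (hx₀ : x₀ ∈ regularSet Ω u D φ) :
    Tendsto (fun k => ⨍⁻ x in Metric.ball x₀ (φ k).rOut, ‖u x - preciseRep Ω u D φ x₀‖ₑ ∂volume)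
      atTop (𝓝 0) := by
  set w := preciseRep Ω u D φ x₀ with hw
  set C : ℝ≥0∞ := 2 ^ Module.finrank ℝ E with hC
  have hCt : C ≠ ⊤ := by simp [hC]
  have hlim : Tendsto (fun k => C * (C * (2 * scaledAverage D (φ k) x₀)) +
      ‖mollify (φ k) u x₀ - w‖ₑ) atTop (𝓝 0) := by
    have h1 := (tendsto_iff_edist_tendsto_0).1 (tendsto_preciseRep hx₀)
    simp only [edist_eq_enorm_sub] at h1
    have h2 := ENNReal.Tendsto.const_mul (a := C) (ENNReal.Tendsto.const_mul (a := C)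
      (ENNReal.Tendsto.const_mul (a := 2) hx₀.2.2 (Or.inr (by simp))) (Or.inr hCt)) (Or.inr hCt)
    simpa using h2.add h1
  refine tendsto_of_tendsto_of_tendsto_of_le_of_le' tendsto_const_nhds hlim
    (Eventually.of_forall fun k => zero_le) ?_
  filter_upwards [h.eventually_closedBall_subset isCompact_singleton
    (singleton_subset_iff.2 hx₀.1)] with k hk
  replace hk := hk x₀ rfl
  set r := (φ k).rOut with hr
  have hr0 : 0 < r := (φ k).rOut_pos
  set B := Metric.ball x₀ r with hB
  have hBm : MeasurableSet B := Metric.isOpen_ball.measurableSet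
  have h0 : volume B ≠ 0 := (Metric.measure_ball_pos _ _ hr0).ne'
  have h1 : volume B ≠ ⊤ := measure_ball_lt_top.ne
  have hpt : ∀ x, ‖u x - w‖ₑ ≤
      C * (⨍⁻ y in B, ‖u x - u y‖ₑ ∂volume) + ‖mollify (φ k) u x₀ - w‖ₑ := by
    intro x
    have h3 := enorm_mollify_sub_le (φ k) (h.rOut_eq k) h.locallyIntegrable x₀ (u x)
    calc ‖u x - w‖ₑ = ‖(mollify (φ k) u x₀ - w) - (mollify (φ k) u x₀ - u x)‖ₑ := by
          congr 1; abel
      _ ≤ ‖mollify (φ k) u x₀ - w‖ₑ + ‖mollify (φ k) u x₀ - u x‖ₑ := enorm_sub_le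
      _ ≤ ‖mollify (φ k) u x₀ - w‖ₑ + C * (⨍⁻ y in B, ‖u y - u x‖ₑ ∂volume) := by gcongr
      _ = _ := by
        simp_rw [enorm_sub_rev (u x)]
        rw [add_comm]
  have hP := h.lintegral_lintegral_enorm_sub_le hk
  calc ⨍⁻ x in B, ‖u x - w‖ₑ ∂volume
      ≤ (∫⁻ x in B, (C * (⨍⁻ y in B, ‖u x - u y‖ₑ ∂volume) + ‖mollify (φ k) u x₀ - w‖ₑ)) /
          volume B := by
        rw [setLAverage_eq]
        gcongr with x
        exact hpt x
    _ = C * ((∫⁻ x in B, ∫⁻ y in B, ‖u x - u y‖ₑ) / volume B) / volume B +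
          ‖mollify (φ k) u x₀ - w‖ₑ := by
        rw [lintegral_add_right _ measurable_const, ENNReal.add_div, setLIntegral_const,
          ENNReal.mul_div_cancel_right h0 h1, lintegral_const_mul' _ _ hCt]
        simp_rw [setLAverage_eq, div_eq_mul_inv]
        rw [lintegral_mul_const' _ _ (ENNReal.inv_ne_top.2 h0)]
    _ ≤ C * ((C * volume B * (ENNReal.ofReal (2 * r) * ∫⁻ z in B, ‖D z‖ₑ)) / volume B) /
          volume B + ‖mollify (φ k) u x₀ - w‖ₑ := by gcongr
    _ = C * (C * (2 * scaledAverage D (φ k) x₀)) + ‖mollify (φ k) u x₀ - w‖ₑ := by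
        rw [mul_right_comm C (volume B), ENNReal.mul_div_cancel_right h0 h1, scaledAverage,
          setLAverage_eq, ENNReal.ofReal_mul two_pos.le, ENNReal.ofReal_ofNat]
        simp only [div_eq_mul_inv]
        ring

end FastMollification

end Poincare

/-! ### Tubes of curves with a common tangent -/

section Tubes

variable {E F : Type*} [NormedAddCommGroup E] [NormedSpace ℝ E] [FiniteDimensional ℝ E]
  [MeasureSpace E] [BorelSpace E] [(volume : Measure E).IsAddHaarMeasure]
  [NormedAddCommGroup F] [NormedSpace ℝ F]

theorem exists_tendsto_nhdsGT_of_integrableOn {V g : ℝ → F} {δ : ℝ}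
    (hδ : 0 < δ) (hg : IntegrableOn g (Ioc 0 δ))
    (hV : ∀ s ∈ Ioc 0 δ, ∀ t ∈ Ioc 0 δ, V t - V s = ∫ τ in s..t, g τ) :
    ∃ l, Tendsto V (𝓝[>] 0) (𝓝 l) := by
  have hint : IntervalIntegrable g volume 0 δ := by
    rwa [intervalIntegrable_iff_integrableOn_Ioc_of_le hδ.le]
  have hc : ContinuousOn (fun s => ∫ τ in s..δ, g τ) (uIcc 0 δ) :=
    intervalIntegral.continuousOn_primitive_interval_left
      (by rw [uIcc_of_le hδ.le]; exact (integrableOn_Icc_iff_integrableOn_Ioc).2 hg)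
  have h0 : Tendsto (fun s => ∫ τ in s..δ, g τ) (𝓝[>] 0) (𝓝 (∫ τ in 0..δ, g τ)) := by
    have := (hc 0 left_mem_uIcc).tendsto
    rw [uIcc_of_le hδ.le] at this
    refine this.mono_left ?_
    rw [← nhdsWithin_Ioc_eq_nhdsGT hδ]
    exact nhdsWithin_mono _ Ioc_subset_Icc_self
  refine ⟨V δ - ∫ τ in 0..δ, g τ, ?_⟩
  refine (tendsto_const_nhds.sub h0).congr' ?_
  filter_upwards [Ioc_mem_nhdsGT hδ] with s hs
  rw [← hV s hs δ ⟨hδ, le_rfl⟩]; abel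

namespace FastMollification

variable {Ω : Set E} {u : E → F} {D : E → E →L[ℝ] F} {φ : ℕ → ContDiffBump (0 : E)}

/-- Almost every curve `t ↦ x₀ + t • w + ψ t • a` of a thin tube around a ray is regular. All of
these curves have the same one-sided derivative at `0` if `ψ` and its derivative vanish there. -/
theorem ae_regular_tube [CompleteSpace F] (h : FastMollification Ω u D φ) {x₀ w : E} {ρ δ R : ℝ}
    {ψ ψ' : ℝ → ℝ} (hδ : 0 < δ) (hψ : ∀ t, HasDerivAt ψ (ψ' t) t) (hψ' : Continuous ψ')
    (hpos : ∀ t ∈ Ioc 0 δ, 0 < ψ t) (hsub : Metric.closedBall x₀ R ⊆ Ω)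
    (hmaps : ∀ a ∈ Metric.ball (0 : E) ρ, ∀ t ∈ Ioc 0 δ,
      x₀ + t • w + ψ t • a ∈ Metric.closedBall x₀ R) :
    ∀ᵐ a ∂(volume.restrict (Metric.ball (0 : E) ρ)),
      (∀ t ∈ Ioc 0 δ, x₀ + t • w + ψ t • a ∈ regularSet Ω u D φ) ∧
      ∀ s ∈ Ioc 0 δ, ∀ t ∈ Ioc 0 δ,
        preciseRep Ω u D φ (x₀ + t • w + ψ t • a) - preciseRep Ω u D φ (x₀ + s • w + ψ s • a) =
          ∫ τ in s..t, D (x₀ + τ • w + ψ τ • a) (w + ψ' τ • a) := by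
  have hψc : Continuous ψ := continuous_iff_continuousAt.2 fun t => (hψ t).continuousAt
  have hBm : MeasurableSet (Metric.ball (0 : E) ρ) := Metric.isOpen_ball.measurableSet
  -- away from the vertex the width of the tube is bounded below, and the tube does not concentrate
  have key : ∀ n : ℕ, ∀ᵐ a ∂(volume.restrict (Metric.ball (0 : E) ρ)),
      ∀ s ∈ Icc (δ / (n + 2)) δ, x₀ + s • w + ψ s • a ∈ regularSet Ω u D φ ∧
      ∀ t ∈ Icc (δ / (n + 2)) δ,
        preciseRep Ω u D φ (x₀ + t • w + ψ t • a) - preciseRep Ω u D φ (x₀ + s • w + ψ s • a) =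
          ∫ τ in s..t, D (x₀ + τ • w + ψ τ • a) (w + ψ' τ • a) := by
    intro n
    set s₀ := δ / (n + 2) with hs₀
    have hs₀p : 0 < s₀ := by positivity
    have hs₀δ : s₀ < δ := by
      rw [hs₀, div_lt_iff₀ (by positivity)]
      have : (0 : ℝ) ≤ n := n.cast_nonneg
      nlinarith
    have hsubI : Icc s₀ δ ⊆ Ioc 0 δ := fun t ht => ⟨hs₀p.trans_le ht.1, ht.2⟩
    obtain ⟨m, hm, hmle⟩ : ∃ m : ℝ, 0 < m ∧ ∀ t ∈ Icc s₀ δ, m ≤ ψ t := by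
      obtain ⟨t₀, ht₀, hmin⟩ := isCompact_Icc.exists_isMinOn
        (nonempty_Icc.2 hs₀δ.le) hψc.continuousOn
      exact ⟨ψ t₀, hpos _ (hsubI ht₀), fun t ht => hmin ht⟩
    have hmeas : Measurable (Function.uncurry fun (a : E) (t : ℝ) => x₀ + t • w + ψ t • a) :=
      Continuous.measurable (by unfold Function.uncurry; fun_prop)
    have := h.ae_regular_curve (μ := volume.restrict (Metric.ball (0 : E) ρ)) hs₀δ
      (isCompact_closedBall x₀ R) hsub (γ := fun a t => x₀ + t • w + ψ t • a)
      (γ' := fun a t => w + ψ' t • a) hmeas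
      (fun a t _ => by
        have h1 := (((hasDerivAt_id t).smul_const w).const_add x₀).add ((hψ t).smul_const a)
        rw [one_smul] at h1
        exact h1)
      (fun a => by fun_prop)
      (by
        filter_upwards [ae_restrict_mem hBm] with a ha t ht
        exact hmaps a ha t (hsubI ht))
      (C := ENNReal.ofReal ((m ^ Module.finrank ℝ E)⁻¹) * ENNReal.ofReal (δ - s₀))
      (by finiteness)
      (fun f hf => by
        rw [lintegral_lintegral_swap
          (f := fun (a : E) (t : ℝ) => f (x₀ + t • w + ψ t • a)) (hf.comp hmeas).aemeasurable]
        calc _ ≤ ∫⁻ _ in Icc s₀ δ, ENNReal.ofReal ((m ^ Module.finrank ℝ E)⁻¹) *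
              ∫⁻ z in Metric.closedBall x₀ R, f z := by
              refine setLIntegral_mono' measurableSet_Icc fun t ht => ?_
              refine (setLIntegral_comp_add_smul_le hf hBm Metric.isClosed_closedBall.measurableSet
                (x₀ + t • w) (hpos t (hsubI ht)) fun a ha => hmaps a ha t (hsubI ht)).trans ?_
              gcongr
              exact hmle t ht
          _ = _ := by
              rw [setLIntegral_const, Real.volume_Icc]; ring)
    filter_upwards [this] with a ha s hs
    exact ⟨ha.1 s hs, fun t ht => ha.2.2 s hs t ht⟩
  have hex : ∀ s ∈ Ioc 0 δ, ∀ t ∈ Ioc 0 δ,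
      ∃ n : ℕ, s ∈ Icc (δ / (n + 2)) δ ∧ t ∈ Icc (δ / (n + 2)) δ := by
    intro s hs t ht
    have hmin : 0 < min s t := lt_min hs.1 ht.1
    obtain ⟨n, hn⟩ := exists_nat_ge (δ / min s t)
    have hn' : δ / (n + 2) ≤ min s t := by
      rw [div_le_iff₀ (by positivity)]
      rw [div_le_iff₀ hmin] at hn
      nlinarith
    exact ⟨n, ⟨hn'.trans (min_le_left _ _), hs.2⟩, ⟨hn'.trans (min_le_right _ _), ht.2⟩⟩
  filter_upwards [ae_all_iff.2 key] with a ha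
  refine ⟨fun t ht => ?_, fun s hs t ht => ?_⟩
  · obtain ⟨n, hn, -⟩ := hex t ht t ht
    exact (ha n t hn).1
  · obtain ⟨n, hn, hn'⟩ := hex s hs t ht
    exact (ha n s hn).2 t hn'

/-- At a point where some representative is continuous, the precise representative is continuous
along the regular set. -/
theorem tendsto_preciseRep_nhdsWithin [CompleteSpace F] (h : FastMollification Ω u D φ) {x₀ : E}
    (hx₀ : x₀ ∈ Ω) {f : E → F} (hf : f =ᵐ[volume.restrict Ω] u) (hfc : ContinuousAt f x₀) :
    Tendsto (preciseRep Ω u D φ) (𝓝[regularSet Ω u D φ] x₀) (𝓝 (f x₀)) := by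
  rw [EMetric.tendsto_nhds]
  intro ε hε
  set C : ℝ≥0∞ := 2 ^ Module.finrank ℝ E with hC
  obtain ⟨η, hη, hηε⟩ : ∃ η : ℝ≥0∞, 0 < η ∧ C * η < ε := by
    have : Tendsto (fun η : ℝ≥0∞ => C * η) (𝓝[>] 0) (𝓝 0) := by
      have := ENNReal.Tendsto.const_mul (a := C)
        ((tendsto_id (α := ℝ≥0∞) (x := 𝓝 0)).mono_left (nhdsWithin_le_nhds (s := Ioi 0)))
        (Or.inr (by simp [hC]))
      simpa using this
    obtain ⟨η, h1, h2⟩ := ((this.eventually (gt_mem_nhds hε)).and self_mem_nhdsWithin).exists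
    exact ⟨η, h2, h1⟩
  have hnear : ∀ᶠ x in 𝓝 x₀, x ∈ Ω ∧ edist (f x) (f x₀) < η :=
    (h.isOpen.eventually_mem hx₀).and ((EMetric.tendsto_nhds.1 hfc) η hη)
  obtain ⟨r, hr, hball⟩ := Metric.eventually_nhds_iff_ball.1 hnear
  have hae : ∀ᵐ x ∂volume, x ∈ Ω → f x = u x :=
    (ae_restrict_iff' h.isOpen.measurableSet).1 hf
  filter_upwards [self_mem_nhdsWithin, mem_nhdsWithin_of_mem_nhds
    (Metric.ball_mem_nhds x₀ (half_pos hr))] with y hy hyr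
  refine lt_of_le_of_lt (le_of_tendsto ((tendsto_preciseRep hy).edist tendsto_const_nhds) ?_) hηε
  filter_upwards [h.tendsto_rOut.eventually (gt_mem_nhds (half_pos hr))] with k hk
  rw [edist_eq_enorm_sub]
  refine (enorm_mollify_sub_le (φ k) (h.rOut_eq k) h.locallyIntegrable y (f x₀)).trans ?_
  gcongr
  have h0 : volume (Metric.ball y (φ k).rOut) ≠ 0 :=
    (Metric.measure_ball_pos _ _ (φ k).rOut_pos).ne'
  have h1 : volume (Metric.ball y (φ k).rOut) ≠ ⊤ := measure_ball_lt_top.ne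
  rw [← setLAverage_const h0 h1 η, setLAverage_eq, setLAverage_eq]
  gcongr ?_ / _
  refine lintegral_mono_ae ?_
  rw [ae_restrict_iff' Metric.isOpen_ball.measurableSet]
  filter_upwards [hae] with z hz hzy
  have hzr : z ∈ Metric.ball x₀ r := by
    rw [Metric.mem_ball] at *
    linarith [dist_triangle z y x₀]
  rw [← hz (hball z hzr).1, ← edist_eq_enorm_sub]
  exact (hball z hzr).2.le

end FastMollification

end Tubes

/-! ### The profile of a tube made of pieces of cones -/

section Profile

/-- A smooth function that vanishes for `s ≤ 1` and is the identity for `s ≥ 2`. -/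
noncomputable def smoothRamp (s : ℝ) : ℝ := s * Real.smoothTransition (s - 1)

theorem smoothRamp_of_le_one {s : ℝ} (hs : s ≤ 1) : smoothRamp s = 0 := by
  rw [smoothRamp, Real.smoothTransition.zero_of_nonpos (by linarith), mul_zero]

theorem smoothRamp_of_two_le {s : ℝ} (hs : 2 ≤ s) : smoothRamp s = s := by
  rw [smoothRamp, Real.smoothTransition.one_of_one_le (by linarith), mul_one]

theorem smoothRamp_nonneg {s : ℝ} (hs : 0 ≤ s) : 0 ≤ smoothRamp s :=
  mul_nonneg hs (Real.smoothTransition.nonneg _)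

theorem smoothRamp_le {s : ℝ} (hs : 0 ≤ s) : smoothRamp s ≤ s :=
  mul_le_of_le_one_right hs (Real.smoothTransition.le_one _)

theorem contDiff_smoothRamp : ContDiff ℝ 1 smoothRamp :=
  contDiff_id.mul (Real.smoothTransition.contDiff.comp (contDiff_id.sub contDiff_const))

theorem deriv_smoothRamp_of_lt_one {s : ℝ} (hs : s < 1) : deriv smoothRamp s = 0 := by
  have : smoothRamp =ᶠ[𝓝 s] fun _ => 0 := by
    filter_upwards [Iio_mem_nhds hs] with y hy using smoothRamp_of_le_one (le_of_lt hy)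
  rw [this.deriv_eq, deriv_const]

theorem deriv_smoothRamp_of_two_lt {s : ℝ} (hs : 2 < s) : deriv smoothRamp s = 1 := by
  have : smoothRamp =ᶠ[𝓝 s] fun y => y := by
    filter_upwards [Ioi_mem_nhds hs] with y hy using smoothRamp_of_two_le (le_of_lt hy)
  rw [this.deriv_eq, deriv_id'']

theorem exists_bound_deriv_smoothRamp : ∃ M : ℝ, 0 ≤ M ∧ ∀ s, |deriv smoothRamp s| ≤ M := by
  obtain ⟨M, hM⟩ := (isCompact_Icc (a := (1 : ℝ)) (b := 2)).exists_bound_of_continuousOn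
    (contDiff_smoothRamp.continuous_deriv le_rfl).continuousOn
  refine ⟨max M 1, le_max_of_le_right zero_le_one, fun s => ?_⟩
  rcases lt_or_ge s 1 with h1 | h1
  · rw [deriv_smoothRamp_of_lt_one h1, abs_zero]
    exact le_max_of_le_right zero_le_one
  rcases lt_or_ge 2 s with h2 | h2
  · rw [deriv_smoothRamp_of_two_lt h2, abs_one]
    exact le_max_right _ _
  · exact (hM s ⟨h1, h2⟩).trans (le_max_left _ _)

/-- The width of a tube around a ray at distance `t` from its vertex. The tube is the cone
`profile r t = 2⁻¹ ^ (n + 1) * t` on `[2 * r (n + 1), r n]`, and passes to a cone twice as wide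
on `[r n, 2 * r n]`; this holds when `2 * r (n + 1) ≤ r n` for all `n`. Its derivative is
`∑' n, 2⁻¹ ^ (n + 1) * deriv smoothRamp (t / r n)`. -/
noncomputable def profile (r : ℕ → ℝ) (t : ℝ) : ℝ :=
  ∑' n, (2⁻¹ : ℝ) ^ (n + 1) * (r n * smoothRamp (t / r n))

theorem summable_two_inv_pow_succ : Summable fun n : ℕ => (2⁻¹ : ℝ) ^ (n + 1) :=
  (summable_nat_add_iff 1).2 (summable_geometric_of_lt_one (by norm_num) (by norm_num))

theorem tsum_two_inv_pow_succ : ∑' n : ℕ, (2⁻¹ : ℝ) ^ (n + 1) = 1 := by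
  simp_rw [pow_succ]
  rw [tsum_mul_right, tsum_geometric_of_lt_one (by norm_num) (by norm_num)]
  norm_num

variable {r : ℕ → ℝ}

theorem profile_term_nonneg (hr : ∀ n, 0 < r n) {t : ℝ} (ht : 0 ≤ t) (n : ℕ) :
    0 ≤ (2⁻¹ : ℝ) ^ (n + 1) * (r n * smoothRamp (t / r n)) := by
  have := smoothRamp_nonneg (div_nonneg ht (hr n).le)
  have := hr n
  positivity

theorem profile_term_le (hr : ∀ n, 0 < r n) {t : ℝ} (ht : 0 ≤ t) (n : ℕ) :
    (2⁻¹ : ℝ) ^ (n + 1) * (r n * smoothRamp (t / r n)) ≤ 2⁻¹ ^ (n + 1) * t := by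
  have h1 := smoothRamp_le (div_nonneg ht (hr n).le)
  have h2 : r n * smoothRamp (t / r n) ≤ t := by
    calc r n * smoothRamp (t / r n) ≤ r n * (t / r n) :=
          mul_le_mul_of_nonneg_left h1 (hr n).le
      _ = t := mul_div_cancel₀ _ (hr n).ne'
  gcongr

theorem summable_profile (hr : ∀ n, 0 < r n) {t : ℝ} (ht : 0 ≤ t) :
    Summable fun n => (2⁻¹ : ℝ) ^ (n + 1) * (r n * smoothRamp (t / r n)) :=
  Summable.of_nonneg_of_le (profile_term_nonneg hr ht) (profile_term_le hr ht)
    (summable_two_inv_pow_succ.mul_right t)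

theorem profile_le (hr : ∀ n, 0 < r n) {t : ℝ} (ht : 0 ≤ t) : profile r t ≤ t := by
  calc profile r t ≤ ∑' n : ℕ, (2⁻¹ : ℝ) ^ (n + 1) * t :=
        (summable_profile hr ht).tsum_le_tsum (profile_term_le hr ht)
          (summable_two_inv_pow_succ.mul_right t)
    _ = t := by rw [tsum_mul_right, tsum_two_inv_pow_succ, one_mul]

theorem profile_zero : profile r 0 = 0 := by
  simp [profile, smoothRamp_of_le_one]

theorem hasDerivAt_profile (hr : ∀ n, 0 < r n) (t : ℝ) :
    HasDerivAt (profile r) (∑' n, (2⁻¹ : ℝ) ^ (n + 1) * deriv smoothRamp (t / r n)) t := by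
  obtain ⟨M, -, hM⟩ := exists_bound_deriv_smoothRamp
  have hs : Summable fun n : ℕ => (2⁻¹ : ℝ) ^ (n + 1) * M := summable_two_inv_pow_succ.mul_right M
  unfold profile
  refine hasDerivAt_tsum (g := fun n t => (2⁻¹ : ℝ) ^ (n + 1) * (r n * smoothRamp (t / r n)))
    (g' := fun n t => (2⁻¹ : ℝ) ^ (n + 1) * deriv smoothRamp (t / r n)) (y₀ := 0) hs
    (fun n y => ?_) (fun n y => ?_) (summable_profile hr le_rfl) t
  · have h1 : HasDerivAt smoothRamp (deriv smoothRamp (y / r n)) (y / r n) :=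
      (contDiff_smoothRamp.differentiable (by simp) _).hasDerivAt
    have h2 := ((h1.comp y ((hasDerivAt_id y).div_const (r n))).const_mul (r n)).const_mul
      ((2⁻¹ : ℝ) ^ (n + 1))
    have h3 : r n * (deriv smoothRamp (y / r n) * (1 / r n)) = deriv smoothRamp (y / r n) := by
      field_simp [(hr n).ne']
    rw [h3] at h2
    exact h2
  · rw [norm_mul, norm_pow, Real.norm_eq_abs, Real.norm_eq_abs, abs_of_pos (by norm_num)]
    gcongr
    exact hM _

theorem continuous_deriv_profile :
    Continuous fun t => ∑' n, (2⁻¹ : ℝ) ^ (n + 1) * deriv smoothRamp (t / r n) := by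
  obtain ⟨M, -, hM⟩ := exists_bound_deriv_smoothRamp
  refine continuous_tsum (fun n => ?_) (summable_two_inv_pow_succ.mul_right M) (fun n y => ?_)
  · exact continuous_const.mul ((contDiff_smoothRamp.continuous_deriv le_rfl).comp
      (continuous_id.div_const _))
  · rw [norm_mul, norm_pow, Real.norm_eq_abs, Real.norm_eq_abs, abs_of_pos (by norm_num)]
    gcongr
    exact hM _

/-- The bound does not depend on the scales `r`, which may thus be chosen after it. -/
theorem exists_bound_deriv_profile : ∃ M : ℝ, 0 ≤ M ∧ ∀ (r : ℕ → ℝ) (t : ℝ),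
    |∑' n, (2⁻¹ : ℝ) ^ (n + 1) * deriv smoothRamp (t / r n)| ≤ M := by
  obtain ⟨M, hM0, hM⟩ := exists_bound_deriv_smoothRamp
  refine ⟨M, hM0, fun r t => ?_⟩
  have h1 : HasSum (fun n : ℕ => (2⁻¹ : ℝ) ^ (n + 1) * M) M := by
    have := (summable_two_inv_pow_succ.hasSum.mul_right M)
    rwa [tsum_two_inv_pow_succ, one_mul] at this
  rw [← Real.norm_eq_abs]
  refine tsum_of_norm_bounded h1 fun n => ?_
  rw [norm_mul, norm_pow, Real.norm_eq_abs, Real.norm_eq_abs, abs_of_pos (by norm_num)]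
  gcongr
  exact hM _

theorem deriv_profile_zero :
    ∑' n, (2⁻¹ : ℝ) ^ (n + 1) * deriv smoothRamp (0 / r n) = 0 := by
  simp [deriv_smoothRamp_of_lt_one]

theorem le_profile (hr : ∀ n, 0 < r n) {n : ℕ} {t : ℝ} (ht : 2 * r n ≤ t) :
    (2⁻¹ : ℝ) ^ (n + 1) * t ≤ profile r t := by
  have ht0 : 0 ≤ t := by linarith [hr n]
  have h1 : r n * smoothRamp (t / r n) = t := by
    rw [smoothRamp_of_two_le ((le_div_iff₀ (hr n)).2 ht), mul_div_cancel₀ _ (hr n).ne']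
  have h2 := (summable_profile hr ht0).le_tsum n fun j _ => profile_term_nonneg hr ht0 j
  rwa [h1] at h2

theorem profile_eq (hr : ∀ n, 0 < r n) (hanti : Antitone r) {n : ℕ} {t : ℝ}
    (ht : t ∈ Icc (2 * r (n + 1)) (r n)) : profile r t = 2⁻¹ ^ (n + 1) * t := by
  have ht0 : 0 ≤ t := by linarith [hr (n + 1), ht.1]
  rw [profile, ← (summable_profile hr ht0).sum_add_tsum_nat_add (n + 1), Finset.sum_eq_zero,
    zero_add]
  · have h1 : ∀ i, (2⁻¹ : ℝ) ^ (i + (n + 1) + 1) *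
        (r (i + (n + 1)) * smoothRamp (t / r (i + (n + 1)))) =
        (2⁻¹ : ℝ) ^ (i + 1) * (2⁻¹ ^ (n + 1) * t) := by
      intro i
      have h2 : r (i + (n + 1)) ≤ r (n + 1) := hanti (Nat.le_add_left _ _)
      rw [smoothRamp_of_two_le ((le_div_iff₀ (hr _)).2 (by linarith [ht.1])),
        mul_div_cancel₀ _ (hr _).ne']
      ring
    simp_rw [h1]
    rw [tsum_mul_right, tsum_two_inv_pow_succ, one_mul]
  · intro i hi
    have h2 : r n ≤ r i := hanti (Nat.lt_succ_iff.1 (Finset.mem_range.1 hi))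
    rw [smoothRamp_of_le_one ((div_le_one (hr i)).2 (ht.2.trans h2)), mul_zero, mul_zero]

theorem deriv_profile_eq (hr : ∀ n, 0 < r n) (hanti : Antitone r) {n : ℕ} {t : ℝ}
    (ht : t ∈ Ioo (2 * r (n + 1)) (r n)) :
    ∑' n, (2⁻¹ : ℝ) ^ (n + 1) * deriv smoothRamp (t / r n) = 2⁻¹ ^ (n + 1) := by
  have h1 : profile r =ᶠ[𝓝 t] fun t => 2⁻¹ ^ (n + 1) * t := by
    filter_upwards [Ioo_mem_nhds ht.1 ht.2] with y hy
      using profile_eq hr hanti (Ioo_subset_Icc_self hy)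
  have h2 := (hasDerivAt_profile hr t).congr_of_eventuallyEq h1.symm
  have h3 := (hasDerivAt_id t).const_mul ((2⁻¹ : ℝ) ^ (n + 1))
  simpa using h2.unique h3

theorem profile_pos (hr : ∀ n, 0 < r n) (hr0 : Tendsto r atTop (𝓝 0)) {t : ℝ} (ht : 0 < t) :
    0 < profile r t := by
  obtain ⟨n, hn⟩ := (hr0.eventually (gt_mem_nhds (half_pos ht))).exists
  exact lt_of_lt_of_le (by positivity) (le_profile hr (n := n) (by linarith))

end Profile

/-! ### Integrals over cones and tubes -/

section TubeEstimates

variable {E F : Type*} [NormedAddCommGroup E] [NormedSpace ℝ E] [FiniteDimensional ℝ E]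
  [MeasureSpace E] [BorelSpace E] [(volume : Measure E).IsAddHaarMeasure]
  [NormedAddCommGroup F] [NormedSpace ℝ F]

omit [(volume : Measure E).IsAddHaarMeasure] in
theorem measurable_enorm_clm_apply {X : Type*} [MeasurableSpace X] {D : E → E →L[ℝ] F}
    (hD : StronglyMeasurable D) {f g : X → E} (hf : Measurable f) (hg : Measurable g) :
    Measurable fun x => ‖D (f x) (g x)‖ₑ :=
  (isBoundedBilinearMap_apply.continuous.comp_stronglyMeasurable
    ((hD.comp_measurable hf).prodMk hg.stronglyMeasurable)).enorm

omit [FiniteDimensional ℝ E] [MeasureSpace E] [BorelSpace E]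
  [(volume : Measure E).IsAddHaarMeasure] in
theorem norm_tube_le {x₀ w a : E} {t ψ : ℝ} (ht : 0 ≤ t) (hψ0 : 0 ≤ ψ) (hψ : ψ ≤ t)
    (ha : a ∈ Metric.ball (0 : E) (‖w‖ / 2)) :
    ‖x₀ + t • w + ψ • a - x₀‖ ≤ 3 / 2 * ‖w‖ * t := by
  have ha' : ‖a‖ < ‖w‖ / 2 := by simpa using ha
  have h1 : x₀ + t • w + ψ • a - x₀ = t • w + ψ • a := by abel
  rw [h1]
  refine (norm_add_le _ _).trans ?_
  rw [norm_smul, norm_smul, Real.norm_of_nonneg ht, Real.norm_of_nonneg hψ0]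
  nlinarith [mul_le_mul hψ ha'.le (norm_nonneg a) ht]

omit [FiniteDimensional ℝ E] [MeasureSpace E] [BorelSpace E]
  [(volume : Measure E).IsAddHaarMeasure] in
theorem le_norm_tube {x₀ w a : E} {t ψ : ℝ} (ht : 0 ≤ t) (hψ0 : 0 ≤ ψ) (hψ : ψ ≤ t)
    (ha : a ∈ Metric.ball (0 : E) (‖w‖ / 2)) :
    ‖w‖ / 2 * t ≤ ‖x₀ + t • w + ψ • a - x₀‖ := by
  have ha' : ‖a‖ < ‖w‖ / 2 := by simpa using ha
  have h1 : x₀ + t • w + ψ • a - x₀ = t • w + ψ • a := by abel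
  rw [h1]
  have h2 := norm_sub_le_norm_add (t • w) (ψ • a)
  rw [norm_smul, norm_smul, Real.norm_of_nonneg ht, Real.norm_of_nonneg hψ0] at h2
  nlinarith [mul_le_mul hψ ha'.le (norm_nonneg a) ht]

/-- On a cone around a ray from `x₀`, the derivative along the rays from `x₀` is controlled by the
radial integral at `x₀`. This is polar integration, up to the constant: a point `x` lies on rays of
the cone only at times comparable to `‖x - x₀‖`. -/
theorem lintegral_cone_le {D : E → E →L[ℝ] F} (hD : StronglyMeasurable D) {x₀ w : E}
    (hw : w ≠ 0) {θ α β : ℝ} (hθ : 0 < θ) (hθ1 : θ ≤ 1) (hα : 0 ≤ α) :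
    ∫⁻ a in Metric.ball (0 : E) (‖w‖ / 2), ∫⁻ t in Ioo α β,
        ‖D (x₀ + t • w + (θ * t) • a) (w + θ • a)‖ₑ ≤
      ENNReal.ofReal ((θ ^ Module.finrank ℝ E)⁻¹ * (2 * ‖w‖) ^ (Module.finrank ℝ E + 1) *
        (2 / ‖w‖)) *
      ∫⁻ x in Metric.ball x₀ (2 * ‖w‖ * β),
        ENNReal.ofReal ((‖x - x₀‖ ^ Module.finrank ℝ E)⁻¹) * ‖D x (x - x₀)‖ₑ := by
  set d := Module.finrank ℝ E with hd
  have hw0 : 0 < ‖w‖ := norm_pos_iff.2 hw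
  set A := Metric.ball (0 : E) (‖w‖ / 2) with hA
  set B := Metric.ball x₀ (2 * ‖w‖ * β) with hB
  have hAm : MeasurableSet A := Metric.isOpen_ball.measurableSet
  have hBm : MeasurableSet B := Metric.isOpen_ball.measurableSet
  set G : E → ℝ≥0∞ := fun x => ‖D x (x - x₀)‖ₑ with hG
  have hGm : Measurable G :=
    measurable_enorm_clm_apply hD measurable_id (measurable_id.sub_const x₀)
  -- an upper bound, over the times `t` at which `x` may be met, of `t⁻¹ * ((θ * t) ^ d)⁻¹`: here
  -- `x - x₀` is `t` times the velocity, and the second factor is the inverse Jacobian of `a ↦ x`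
  set κ : E → ℝ := fun x => ((θ ^ d)⁻¹ * ((‖x - x₀‖ / (2 * ‖w‖)) ^ (d + 1))⁻¹) with hκ
  have hκm : Measurable κ := by
    have : Measurable fun x : E => ‖x - x₀‖ := (measurable_id.sub_const x₀).norm
    exact measurable_const.mul (((this.div_const _).pow_const _).inv)
  -- the pairs of a point and a time at which the point may lie on a ray of the cone
  set S : Set (ℝ × E) := {q | ‖q.2 - x₀‖ / (2 * ‖w‖) ≤ q.1 ∧ q.1 ≤ 2 * ‖q.2 - x₀‖ / ‖w‖} with hS
  have hSm : MeasurableSet S := by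
    refine MeasurableSet.inter ?_ ?_
    · exact (isClosed_le (by fun_prop) continuous_fst).measurableSet
    · exact (isClosed_le continuous_fst (by fun_prop)).measurableSet
  have hmeas : Measurable fun q : E × ℝ => ‖D (x₀ + q.2 • w + (θ * q.2) • q.1) (w + θ • q.1)‖ₑ :=
    measurable_enorm_clm_apply hD (Continuous.measurable (by fun_prop))
      (Continuous.measurable (by fun_prop))
  have hH : Measurable fun q : ℝ × E =>
      S.indicator (fun q => ENNReal.ofReal (κ q.2) * G q.2) q :=
    ((hκm.comp measurable_snd).ennreal_ofReal.mul (hGm.comp measurable_snd)).indicator hSm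
  rw [lintegral_lintegral_swap
    (f := fun (a : E) (t : ℝ) => ‖D (x₀ + t • w + (θ * t) • a) (w + θ • a)‖ₑ) hmeas.aemeasurable]
  have hinner : ∀ t ∈ Ioo α β, ∫⁻ a in A, ‖D (x₀ + t • w + (θ * t) • a) (w + θ • a)‖ₑ ≤
      ∫⁻ x in B, S.indicator (fun q => ENNReal.ofReal (κ q.2) * G q.2) (t, x) := by
    intro t ht
    have ht0 : 0 < t := hα.trans_lt ht.1
    have hψt : θ * t ≤ t := mul_le_of_le_one_left ht0.le hθ1
    have hψ0 : 0 < θ * t := mul_pos hθ ht0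
    have hSt : MeasurableSet {x : E | (t, x) ∈ S} := measurable_prodMk_left hSm
    have hmaps : ∀ a ∈ A, x₀ + t • w + (θ * t) • a ∈ B ∩ {x : E | (t, x) ∈ S} := by
      intro a ha
      have h1 := norm_tube_le (x₀ := x₀) ht0.le hψ0.le hψt ha
      have h2 := le_norm_tube (x₀ := x₀) ht0.le hψ0.le hψt ha
      refine ⟨?_, ?_, ?_⟩
      · rw [hB, Metric.mem_ball, dist_eq_norm]
        nlinarith [ht.2]
      · rw [div_le_iff₀ (by positivity)]
        nlinarith
      · rw [le_div_iff₀ hw0]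
        nlinarith
    calc ∫⁻ a in A, ‖D (x₀ + t • w + (θ * t) • a) (w + θ • a)‖ₑ
        = ∫⁻ a in A, ENNReal.ofReal t⁻¹ * G (x₀ + t • w + (θ * t) • a) := by
          refine lintegral_congr fun a => ?_
          have h1 : w + θ • a = t⁻¹ • (x₀ + t • w + (θ * t) • a - x₀) := by
            rw [add_assoc, add_sub_cancel_left, smul_add, smul_smul, smul_smul,
              inv_mul_cancel₀ ht0.ne', one_smul, mul_comm θ, inv_mul_cancel_left₀ ht0.ne']
          rw [h1, map_smul, enorm_smul, Real.enorm_eq_ofReal (inv_nonneg.2 ht0.le)]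
      _ ≤ ENNReal.ofReal t⁻¹ * (ENNReal.ofReal (((θ * t) ^ d)⁻¹) *
            ∫⁻ x in B ∩ {x : E | (t, x) ∈ S}, G x) := by
          rw [lintegral_const_mul' _ _ ENNReal.ofReal_ne_top]
          gcongr
          exact setLIntegral_comp_add_smul_le hGm hAm (hBm.inter hSt) (x₀ + t • w) hψ0 hmaps
      _ = ∫⁻ x in B ∩ {x : E | (t, x) ∈ S}, ENNReal.ofReal (t⁻¹ * ((θ * t) ^ d)⁻¹) * G x := by
          rw [lintegral_const_mul' _ _ ENNReal.ofReal_ne_top,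
            ENNReal.ofReal_mul (inv_nonneg.2 ht0.le), mul_assoc]
      _ ≤ ∫⁻ x in B ∩ {x : E | (t, x) ∈ S}, ENNReal.ofReal (κ x) * G x := by
          refine setLIntegral_mono' (hBm.inter hSt) fun x hx => ?_
          gcongr
          have h1 : 0 < ‖x - x₀‖ := by
            have h2 := hx.2.2
            rw [le_div_iff₀ hw0] at h2
            nlinarith [mul_pos ht0 hw0]
          have h3 : t⁻¹ * ((θ * t) ^ d)⁻¹ = (θ ^ d)⁻¹ * (t ^ (d + 1))⁻¹ := by
            rw [mul_pow, pow_succ, mul_inv, mul_inv]; ring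
          rw [h3]
          simp only [hκ]
          gcongr
          exact hx.2.1
      _ = _ := by
          rw [inter_comm, ← Measure.restrict_restrict hSt, ← lintegral_indicator hSt]
          rfl
  calc _ ≤ ∫⁻ t in Ioo α β, ∫⁻ x in B,
          S.indicator (fun q => ENNReal.ofReal (κ q.2) * G q.2) (t, x) :=
        setLIntegral_mono' measurableSet_Ioo hinner
    _ ≤ ∫⁻ t, ∫⁻ x in B, S.indicator (fun q => ENNReal.ofReal (κ q.2) * G q.2) (t, x) :=
        setLIntegral_le_lintegral _ _
    _ = ∫⁻ x in B, ∫⁻ t, S.indicator (fun q => ENNReal.ofReal (κ q.2) * G q.2) (t, x) :=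
        lintegral_lintegral_swap
          (f := fun t x => S.indicator (fun q => ENNReal.ofReal (κ q.2) * G q.2) (t, x))
          hH.aemeasurable
    _ ≤ ∫⁻ x in B, ENNReal.ofReal ((θ ^ d)⁻¹ * (2 * ‖w‖) ^ (d + 1) * (2 / ‖w‖)) *
          (ENNReal.ofReal ((‖x - x₀‖ ^ d)⁻¹) * G x) := by
        refine lintegral_mono fun x => ?_
        have hI : ∀ t, S.indicator (fun q => ENNReal.ofReal (κ q.2) * G q.2) (t, x) =
            (Icc (‖x - x₀‖ / (2 * ‖w‖)) (2 * ‖x - x₀‖ / ‖w‖)).indicator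
              (fun _ => ENNReal.ofReal (κ x) * G x) t := fun t => rfl
        simp_rw [hI]
        rw [lintegral_indicator_const measurableSet_Icc, Real.volume_Icc, mul_right_comm,
          ← mul_assoc, ← ENNReal.ofReal_mul (by positivity), ← ENNReal.ofReal_mul (by positivity)]
        gcongr ENNReal.ofReal ?_ * _
        rcases eq_or_ne x x₀ with rfl | hx
        · simp only [sub_self, norm_zero, zero_div, mul_zero]
          positivity
        · have hx0 : 0 < ‖x - x₀‖ := norm_pos_iff.2 (sub_ne_zero.2 hx)
          calc κ x * (2 * ‖x - x₀‖ / ‖w‖ - ‖x - x₀‖ / (2 * ‖w‖)) ≤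
                κ x * (2 * ‖x - x₀‖ / ‖w‖) := by
                gcongr
                have : 0 ≤ ‖x - x₀‖ / (2 * ‖w‖) := by positivity
                linarith
            _ = _ := by
                simp only [hκ]
                field_simp
                rw [← mul_pow, div_mul_cancel₀ _ (by positivity), pow_succ']
    _ = _ := lintegral_const_mul' _ _ ENNReal.ofReal_ne_top

/-- Crude estimate for a piece of a tube on which nothing is known about the direction of the
curves. -/
theorem lintegral_tube_le {D : E → E →L[ℝ] F} (hD : StronglyMeasurable D) {x₀ w : E}
    {ψ ψ' : ℝ → ℝ} (hψ : Continuous ψ) (hψ' : Continuous ψ') {ρ s t m V R : ℝ} (hm : 0 < m)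
    (hmψ : ∀ τ ∈ Icc s t, m ≤ ψ τ)
    (hmaps : ∀ a ∈ Metric.ball (0 : E) ρ, ∀ τ ∈ Icc s t,
      x₀ + τ • w + ψ τ • a ∈ Metric.ball x₀ R)
    (hV : ∀ a ∈ Metric.ball (0 : E) ρ, ∀ τ ∈ Icc s t, ‖w + ψ' τ • a‖ ≤ V) :
    ∫⁻ a in Metric.ball (0 : E) ρ, ∫⁻ τ in Icc s t,
        ‖D (x₀ + τ • w + ψ τ • a) (w + ψ' τ • a)‖ₑ ≤
      ENNReal.ofReal (t - s) * ENNReal.ofReal V * ENNReal.ofReal ((m ^ Module.finrank ℝ E)⁻¹) *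
        ∫⁻ x in Metric.ball x₀ R, ‖D x‖ₑ := by
  have hAm : MeasurableSet (Metric.ball (0 : E) ρ) := Metric.isOpen_ball.measurableSet
  have hmeas : Measurable fun q : E × ℝ => ‖D (x₀ + q.2 • w + ψ q.2 • q.1) (w + ψ' q.2 • q.1)‖ₑ :=
    measurable_enorm_clm_apply hD (Continuous.measurable (by fun_prop))
      (Continuous.measurable (by fun_prop))
  rw [lintegral_lintegral_swap
    (f := fun (a : E) (τ : ℝ) => ‖D (x₀ + τ • w + ψ τ • a) (w + ψ' τ • a)‖ₑ) hmeas.aemeasurable]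
  calc _ ≤ ∫⁻ _ in Icc s t, ENNReal.ofReal V * (ENNReal.ofReal ((m ^ Module.finrank ℝ E)⁻¹) *
          ∫⁻ x in Metric.ball x₀ R, ‖D x‖ₑ) := by
        refine setLIntegral_mono' measurableSet_Icc fun τ hτ => ?_
        calc _ ≤ ∫⁻ a in Metric.ball (0 : E) ρ,
                ENNReal.ofReal V * ‖D (x₀ + τ • w + ψ τ • a)‖ₑ := by
              refine setLIntegral_mono' hAm fun a ha => ?_
              refine (ContinuousLinearMap.le_opENorm _ _).trans ?_
              rw [mul_comm]
              gcongr
              rw [← ofReal_norm]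
              exact ENNReal.ofReal_le_ofReal (hV a ha τ hτ)
          _ ≤ _ := by
              rw [lintegral_const_mul' _ _ ENNReal.ofReal_ne_top]
              gcongr
              refine (setLIntegral_comp_add_smul_le hD.enorm hAm
                Metric.isOpen_ball.measurableSet (x₀ + τ • w) (hm.trans_le (hmψ τ hτ))
                fun a ha => hmaps a ha τ hτ).trans ?_
              gcongr
              exact hmψ τ hτ
    _ = _ := by
        rw [setLIntegral_const, Real.volume_Icc]; ring

theorem setLIntegral_ball_eq_laverage (f : E → ℝ≥0∞) (x : E) {r : ℝ} (hr : 0 < r) :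
    ∫⁻ y in Metric.ball x r, f y = ENNReal.ofReal (r ^ Module.finrank ℝ E) *
      volume (Metric.ball (0 : E) 1) * ⨍⁻ y in Metric.ball x r, f y ∂volume := by
  rw [← Measure.addHaar_ball_of_pos _ x hr, setLAverage_eq, ENNReal.mul_div_cancel
    (Metric.measure_ball_pos _ _ hr).ne' measure_ball_lt_top.ne]

end TubeEstimates

/-! ### Tangent curves under radial integrability -/

section TangentCurves

variable {E : Type*} [NormedAddCommGroup E] [NormedSpace ℝ E] [FiniteDimensional ℝ E]
  [MeasureSpace E] [BorelSpace E] [(volume : Measure E).IsAddHaarMeasure]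

namespace FastMollification

variable {Ω : Set E} {u : E → E} {D : E → E →L[ℝ] E} {φ : ℕ → ContDiffBump (0 : E)}

omit [FiniteDimensional ℝ E] [BorelSpace E] [(volume : Measure E).IsAddHaarMeasure] in
theorem antitone_rOut (h : FastMollification Ω u D φ) : Antitone fun k => (φ k).rOut :=
  antitone_nat_of_succ_le fun k => (h.rOut_succ_le k).trans (by linarith [(φ k).rOut_pos])

theorem eventually_mul_le_two_inv_pow {X : ℕ → ℝ≥0∞} (hX : Tendsto X atTop (𝓝 0)) {C : ℝ≥0∞}
    (hC : C ≠ ⊤) (n : ℕ) : ∀ᶠ k in atTop, C * X k ≤ 2⁻¹ ^ n := by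
  have h1 := ENNReal.Tendsto.const_mul hX (Or.inr hC)
  rw [mul_zero] at h1
  exact h1.eventually (ge_mem_nhds (ENNReal.pow_pos (by simp) n))

theorem tendsto_lintegral_ball_rOut (h : FastMollification Ω u D φ) {f : E → ℝ≥0∞} {x₀ : E} {R : ℝ}
    (hR : 0 < R) (hf : ∫⁻ x in Metric.ball x₀ R, f x ≠ ⊤) (hd : Module.finrank ℝ E ≠ 0) :
    Tendsto (fun k => ∫⁻ x in Metric.ball x₀ (φ k).rOut, f x) atTop (𝓝 0) := by
  have hm : ∀ k, MeasurableSet (Metric.ball x₀ (φ k).rOut) := fun k =>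
    Metric.isOpen_ball.measurableSet
  have hvol : Tendsto (fun k => (volume.restrict (Metric.ball x₀ R))
      (Metric.ball x₀ (φ k).rOut)) atTop (𝓝 0) := by
    have h1 : Tendsto (fun k => ENNReal.ofReal ((φ k).rOut ^ Module.finrank ℝ E) *
        volume (Metric.ball (0 : E) 1)) atTop (𝓝 0) := by
      have h2 := (ENNReal.continuous_ofReal.tendsto _).comp
        (h.tendsto_rOut.pow (Module.finrank ℝ E))
      rw [zero_pow hd, ENNReal.ofReal_zero] at h2
      have h3 := ENNReal.Tendsto.mul_const (b := volume (Metric.ball (0 : E) 1)) h2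
        (Or.inr measure_ball_lt_top.ne)
      rwa [zero_mul] at h3
    refine tendsto_of_tendsto_of_tendsto_of_le_of_le tendsto_const_nhds h1 (fun k => zero_le)
      (fun k => ?_)
    exact (Measure.restrict_apply_le _ _).trans_eq
      (Measure.addHaar_ball_of_pos _ _ (φ k).rOut_pos)
  refine (tendsto_setLIntegral_zero hf hvol).congr' ?_
  filter_upwards [h.tendsto_rOut.eventually (gt_mem_nhds hR)] with k hk
  rw [Measure.restrict_restrict (hm k), inter_eq_left.2 (Metric.ball_subset_ball hk.le)]

/-- Tangent curves at a regular point with nonzero value `w`, under the radial integrability of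
the gradient. The tube around the ray in direction `w` shrinks relative to the distance from `x₀`,
so that all its curves are tangent to `w` at `x₀`; it changes its aperture only at scales `r n`
chosen so small that the change costs little, by the smallness of `scaledAverage`. Between these
scales the curves are rays, whose cost is controlled by the radial integral. At times `r n` the
curves see values of `u` close to `w` on average. -/
theorem exists_tangent_curve (h : FastMollification Ω u D φ) {x₀ : E}
    (hx₀ : x₀ ∈ regularSet Ω u D φ) (hw : preciseRep Ω u D φ x₀ ≠ 0) {R : ℝ} (hR : 0 < R)
    (hrad : ∫⁻ x in Metric.ball x₀ R, ENNReal.ofReal ((‖x - x₀‖ ^ Module.finrank ℝ E)⁻¹) *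
      ‖D x (x - x₀)‖ₑ ≠ ⊤) :
    ∃ (a : E) (ψ ψ' : ℝ → ℝ), (∀ t, HasDerivAt ψ (ψ' t) t) ∧ Continuous ψ' ∧ ψ 0 = 0 ∧ ψ' 0 = 0 ∧
      Tendsto (fun t => preciseRep Ω u D φ (x₀ + t • preciseRep Ω u D φ x₀ + ψ t • a)) (𝓝[>] 0)
        (𝓝 (preciseRep Ω u D φ x₀)) := by
  set v := preciseRep Ω u D φ with hv
  set w := v x₀ with hwdef
  set d := Module.finrank ℝ E with hd
  have hnt : Nontrivial E := ⟨w, 0, hw⟩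
  have hd0 : d ≠ 0 := (Module.finrank_pos (R := ℝ) (M := E)).ne'
  have hw0 : 0 < ‖w‖ := norm_pos_iff.2 hw
  obtain ⟨M, hM0, hM⟩ := exists_bound_deriv_profile
  set β₁ := volume (Metric.ball (0 : E) 1) with hβ₁
  have hβ₁t : β₁ ≠ ⊤ := measure_ball_lt_top.ne
  obtain ⟨R₀, hR₀, hR₀Ω⟩ : ∃ R₀ : ℝ, 0 < R₀ ∧ Metric.closedBall x₀ R₀ ⊆ Ω :=
    Metric.nhds_basis_closedBall.mem_iff.1 (h.isOpen.mem_nhds hx₀.1)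
  -- `Z`, `scaledAverage` and `Y` tend to zero at `x₀`; at scale `n` of the tube they are multiplied
  -- by the constants `C₁ n`, `C₂ n` and `C₃ n`, which depend on the aperture but not on the radius
  set Z : ℕ → ℝ≥0∞ := fun k => ∫⁻ x in Metric.ball x₀ (φ k).rOut,
    ENNReal.ofReal ((‖x - x₀‖ ^ d)⁻¹) * ‖D x (x - x₀)‖ₑ with hZ
  have hZ0 : Tendsto Z atTop (𝓝 0) := h.tendsto_lintegral_ball_rOut hR hrad hd0
  set Y : ℕ → ℝ≥0∞ := fun k => ⨍⁻ x in Metric.ball x₀ (φ k).rOut, ‖u x - w‖ₑ ∂volume with hY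
  have hY0 : Tendsto Y atTop (𝓝 0) := h.tendsto_laverage_enorm_sub hx₀
  set V : ℝ := ‖w‖ + M * (‖w‖ / 2) with hV
  have hV0 : 0 ≤ V := by positivity
  set C₁ : ℕ → ℝ≥0∞ := fun n => ENNReal.ofReal
    ((((2⁻¹ : ℝ) ^ (n + 1)) ^ d)⁻¹ * (2 * ‖w‖) ^ (d + 1) * (2 / ‖w‖)) with hC₁
  set C₂ : ℕ → ℝ≥0∞ := fun n => ENNReal.ofReal
    (V * (((2⁻¹ : ℝ) ^ (n + 2)) ^ d)⁻¹ * (4 * ‖w‖) ^ d / (4 * ‖w‖)) * β₁ with hC₂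
  set C₃ : ℕ → ℝ≥0∞ := fun n => ENNReal.ofReal
    ((((2⁻¹ : ℝ) ^ (n + 1)) ^ d)⁻¹ * (4 * ‖w‖) ^ d) * β₁ with hC₃
  have hev : ∀ n : ℕ, ∀ᶠ k in atTop, (C₁ n * Z k ≤ 2⁻¹ ^ n ∧
      C₂ n * scaledAverage D (φ k) x₀ ≤ 2⁻¹ ^ n) ∧ C₃ n * Y k ≤ 2⁻¹ ^ n ∧ (φ k).rOut < R₀ := by
    intro n
    exact ((eventually_mul_le_two_inv_pow hZ0 ENNReal.ofReal_ne_top n).and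
      (eventually_mul_le_two_inv_pow hx₀.2.2 (ENNReal.mul_ne_top ENNReal.ofReal_ne_top hβ₁t) n)).and
      ((eventually_mul_le_two_inv_pow hY0 (ENNReal.mul_ne_top ENNReal.ofReal_ne_top hβ₁t) n).and
      (h.tendsto_rOut.eventually (gt_mem_nhds hR₀)))
  obtain ⟨κ, hκm, hκ⟩ := extraction_forall_of_eventually hev
  set ε : ℕ → ℝ := fun n => (φ (κ n)).rOut with hε
  have hε0 : ∀ n, 0 < ε n := fun n => (φ (κ n)).rOut_pos
  -- up to time `2 * r n` the tube stays in the ball of radius `ε n`, since its points at time `t`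
  -- are at distance at most `3 / 2 * ‖w‖ * t` from `x₀`
  set r : ℕ → ℝ := fun n => ε n / (4 * ‖w‖) with hr
  have hr0 : ∀ n, 0 < r n := fun n => div_pos (hε0 n) (by positivity)
  have hrε : ∀ n, 4 * ‖w‖ * r n = ε n := fun n => mul_div_cancel₀ _ (by positivity)
  have hrhalf : ∀ n, 2 * r (n + 1) ≤ r n := by
    intro n
    have h1 : ε (n + 1) ≤ ε n / 2 :=
      (h.antitone_rOut (Nat.succ_le_of_lt (hκm n.lt_succ_self))).trans (h.rOut_succ_le (κ n))
    have h2 := hrε n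
    have h3 := hrε (n + 1)
    nlinarith
  have hanti : Antitone r := antitone_nat_of_succ_le fun n => by
    linarith [hrhalf n, hr0 (n + 1)]
  have hrlim : Tendsto r atTop (𝓝 0) := by
    simpa using (h.tendsto_rOut.comp hκm.tendsto_atTop).div_const (4 * ‖w‖)
  set ψ := profile r with hψ
  set ψ' : ℝ → ℝ := fun t => ∑' n, (2⁻¹ : ℝ) ^ (n + 1) * deriv smoothRamp (t / r n) with hψ'
  have hψd : ∀ t, HasDerivAt ψ (ψ' t) t := hasDerivAt_profile hr0
  have hψ'c : Continuous ψ' := continuous_deriv_profile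
  have hψc : Continuous ψ := continuous_iff_continuousAt.2 fun t => (hψd t).continuousAt
  have hψpos : ∀ t, 0 < t → 0 < ψ t := fun t ht => profile_pos hr0 hrlim ht
  have hψle : ∀ t, 0 ≤ t → ψ t ≤ t := fun t ht => profile_le hr0 ht
  set A := Metric.ball (0 : E) (‖w‖ / 2) with hA
  have hAm : MeasurableSet A := Metric.isOpen_ball.measurableSet
  have hball : ∀ a ∈ A, ∀ t : ℝ, 0 < t → ∀ ρ : ℝ, 2 * ‖w‖ * t ≤ ρ →
      x₀ + t • w + ψ t • a ∈ Metric.ball x₀ ρ := by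
    intro a ha t ht ρ hρ
    rw [Metric.mem_ball, dist_eq_norm]
    refine (norm_tube_le ht.le (hψpos t ht).le (hψle t ht.le) ha).trans_lt ?_
    nlinarith [mul_pos hw0 ht]
  have hδ : 0 < r 0 := hr0 0
  have htube := h.ae_regular_tube (x₀ := x₀) (w := w) (ρ := ‖w‖ / 2) (R := R₀) hδ hψd hψ'c
    (fun t ht => hψpos t ht.1) hR₀Ω (fun a ha t ht => Metric.ball_subset_closedBall
      (hball a ha t ht.1 R₀ (by
        have h1 := hrε 0
        have h2 : ε 0 < R₀ := (hκ 0).2.2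
        have h3 := mul_le_mul_of_nonneg_left ht.2 hw0.le
        nlinarith [mul_pos hw0 hδ])))
  -- the total cost of the tube is finite
  set g : E → ℝ → ℝ≥0∞ := fun a t => ‖D (x₀ + t • w + ψ t • a) (w + ψ' t • a)‖ₑ with hg
  have hgm : Measurable (Function.uncurry g) :=
    measurable_enorm_clm_apply h.stronglyMeasurable_gradient
      (Continuous.measurable (by fun_prop)) (Continuous.measurable (by fun_prop))
  -- on `[2 * r (n + 1), r n]` the curves are rays from `x₀`
  have hcone : ∀ n : ℕ, ∫⁻ a in A, ∫⁻ t in Ioc (2 * r (n + 1)) (r n), g a t ≤ 2⁻¹ ^ n := by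
    intro n
    refine le_trans ?_ (hκ n).1.1
    have h1 := lintegral_cone_le h.stronglyMeasurable_gradient (x₀ := x₀) hw
      (θ := (2⁻¹ : ℝ) ^ (n + 1)) (α := 2 * r (n + 1)) (β := r n) (by positivity)
      (pow_le_one₀ (by norm_num) (by norm_num)) (by linarith [hr0 (n + 1)])
    calc _ = ∫⁻ a in A, ∫⁻ t in Ioo (2 * r (n + 1)) (r n), g a t := by
          exact lintegral_congr fun a => setLIntegral_congr Ioo_ae_eq_Ioc.symm
      _ = ∫⁻ a in A, ∫⁻ t in Ioo (2 * r (n + 1)) (r n),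
            ‖D (x₀ + t • w + ((2⁻¹ : ℝ) ^ (n + 1) * t) • a) (w + (2⁻¹ : ℝ) ^ (n + 1) • a)‖ₑ := by
          refine lintegral_congr fun a => setLIntegral_congr_fun measurableSet_Ioo fun t ht => ?_
          simp only [hg, hψ, hψ', deriv_profile_eq hr0 hanti ht,
            profile_eq hr0 hanti (Ioo_subset_Icc_self ht)]
      _ ≤ _ := h1
      _ ≤ _ := by
          gcongr
          refine lintegral_mono_set (Metric.ball_subset_ball ?_)
          have := hrε n
          have := hr0 n
          simp only [hε] at *
          nlinarith
  -- on `[r (n + 1), 2 * r (n + 1)]` the aperture changes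
  have htrans : ∀ n : ℕ, ∫⁻ a in A, ∫⁻ t in Icc (r (n + 1)) (2 * r (n + 1)), g a t ≤ 2⁻¹ ^ n := by
    intro n
    set j := n + 1 with hj
    have hrj := hr0 j
    have h1 := lintegral_tube_le h.stronglyMeasurable_gradient (x₀ := x₀) (w := w) hψc hψ'c
      (ρ := ‖w‖ / 2) (s := r j) (t := 2 * r j) (m := (2⁻¹ : ℝ) ^ (j + 2) * r j) (V := V)
      (R := ε j) (by positivity)
      (fun τ hτ => by
        have h2 := le_profile hr0 (n := j + 1) (t := τ) ((hrhalf j).trans hτ.1)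
        refine le_trans ?_ h2
        gcongr
        exact hτ.1)
      (fun a ha τ hτ => hball a ha τ (hrj.trans_le hτ.1) _ (by
        rw [← hrε j]; nlinarith [hτ.2]))
      (fun a ha τ _ => by
        have ha' : ‖a‖ < ‖w‖ / 2 := by simpa [hA] using ha
        refine (norm_add_le _ _).trans ?_
        rw [norm_smul, Real.norm_eq_abs]
        have hMτ : |ψ' τ| ≤ M := hM r τ
        have := mul_le_mul hMτ ha'.le (norm_nonneg a) hM0
        simp only [hV]
        linarith)
    refine (h1.trans (le_of_eq ?_)).trans ((hκ j).1.2.trans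
      (pow_le_pow_right_of_le_one' (ENNReal.inv_le_one.2 one_le_two) (Nat.le_succ n)))
    rw [setLIntegral_ball_eq_laverage _ _ (hε0 j), scaledAverage,
      show 2 * r j - r j = r j by ring]
    have h3 : ENNReal.ofReal (r j) * ENNReal.ofReal V *
        ENNReal.ofReal ((((2⁻¹ : ℝ) ^ (j + 2) * r j) ^ d)⁻¹) * ENNReal.ofReal (ε j ^ d) =
        ENNReal.ofReal (V * (((2⁻¹ : ℝ) ^ (j + 2)) ^ d)⁻¹ * (4 * ‖w‖) ^ d / (4 * ‖w‖)) *
          ENNReal.ofReal (ε j) := by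
      rw [← ENNReal.ofReal_mul (by positivity), ← ENNReal.ofReal_mul (by positivity),
        ← ENNReal.ofReal_mul (by positivity), ← ENNReal.ofReal_mul (by positivity)]
      congr 1
      rw [← hrε j, mul_pow, mul_pow]
      field_simp
    simp only [hC₂]
    calc _ = (ENNReal.ofReal (r j) * ENNReal.ofReal V *
        ENNReal.ofReal ((((2⁻¹ : ℝ) ^ (j + 2) * r j) ^ d)⁻¹) * ENNReal.ofReal (ε j ^ d)) *
        (β₁ * ⨍⁻ y in Metric.ball x₀ (ε j), ‖D y‖ₑ ∂volume) := by ring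
      _ = _ := by rw [h3]; simp only [hε]; ring
  -- the average distance from `u` to `w` over the cross-section of the tube at time `r n`
  have hvalue : ∀ n : ℕ, ∫⁻ a in A, ‖u (x₀ + r n • w + ψ (r n) • a) - w‖ₑ ≤ 2⁻¹ ^ n := by
    intro n
    have hrn := hr0 n
    refine le_trans ?_ (hκ n).2.1
    have hψn : ψ (r n) = (2⁻¹ : ℝ) ^ (n + 1) * r n := profile_eq hr0 hanti ⟨hrhalf n, le_rfl⟩
    have hum : Measurable fun x => ‖u x - w‖ₑ :=
      (h.stronglyMeasurable.sub stronglyMeasurable_const).enorm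
    have h1 := setLIntegral_comp_add_smul_le hum hAm (T := Metric.ball x₀ (ε n))
      Metric.isOpen_ball.measurableSet (x₀ + r n • w) (hψpos (r n) (hr0 n))
      (fun a ha => hball a ha (r n) (hr0 n) _ (by rw [← hrε n]; nlinarith))
    refine h1.trans (le_of_eq ?_)
    rw [setLIntegral_ball_eq_laverage _ _ (hε0 n), hψn, ← mul_assoc, ← mul_assoc,
      ← ENNReal.ofReal_mul (by positivity)]
    simp only [hC₃, hY]
    congr 3
    rw [← hd, ← hrε n, mul_pow, mul_pow]
    field_simp
  have hcover : Ioc 0 (r 0) ⊆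
      ⋃ n, (Ioc (2 * r (n + 1)) (r n) ∪ Icc (r (n + 1)) (2 * r (n + 1))) := by
    intro t ht
    have hex : ∃ n, r n < t := (hrlim.eventually (gt_mem_nhds ht.1)).exists
    have hpos : Nat.find hex ≠ 0 := fun h0 => by
      have := Nat.find_spec hex
      rw [h0] at this
      exact absurd ht.2 (not_le.2 this)
    obtain ⟨n, hn⟩ := Nat.exists_eq_succ_of_ne_zero hpos
    have h1 : r (n + 1) < t := by
      have := Nat.find_spec hex
      rwa [hn] at this
    have h2 : t ≤ r n := not_lt.1 (Nat.find_min hex (by omega))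
    refine mem_iUnion.2 ⟨n, ?_⟩
    rcases lt_or_ge (2 * r (n + 1)) t with h3 | h3
    · exact Or.inl ⟨h3, h2⟩
    · exact Or.inr ⟨h1.le, h3⟩
  have hgeom : ∑' n : ℕ, ((2⁻¹ : ℝ≥0∞) ^ n) ≠ ⊤ := by
    rw [ENNReal.tsum_geometric]; simp
  have hpm : ∀ S : Set ℝ, Measurable fun a => ∫⁻ t in S, g a t := fun S =>
    Measurable.lintegral_prod_right' (f := Function.uncurry g) hgm
  have htotal : ∫⁻ a in A, ∫⁻ t in Ioc 0 (r 0), g a t ≠ ⊤ := by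
    have hle : ∀ a, ∫⁻ t in Ioc 0 (r 0), g a t ≤
        ∑' n, ((∫⁻ t in Ioc (2 * r (n + 1)) (r n), g a t) +
          ∫⁻ t in Icc (r (n + 1)) (2 * r (n + 1)), g a t) := fun a =>
      (lintegral_mono_set hcover).trans ((lintegral_iUnion_le _ _).trans
        (ENNReal.tsum_le_tsum fun n => lintegral_union_le _ _ _))
    have hm : ∀ n, Measurable fun a => (∫⁻ t in Ioc (2 * r (n + 1)) (r n), g a t) +
        ∫⁻ t in Icc (r (n + 1)) (2 * r (n + 1)), g a t := fun n => (hpm _).add (hpm _)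
    refine ne_top_of_le_ne_top ?_ (lintegral_mono hle)
    rw [lintegral_tsum fun n => (hm n).aemeasurable]
    refine ne_top_of_le_ne_top (ENNReal.add_ne_top.2 ⟨hgeom, hgeom⟩) ?_
    rw [← ENNReal.tsum_add]
    refine ENNReal.tsum_le_tsum fun n => ?_
    rw [lintegral_add_left (hpm _)]
    exact add_le_add (hcone n) (htrans n)
  have hum : ∀ n, Measurable fun a => ‖u (x₀ + r n • w + ψ (r n) • a) - w‖ₑ := fun n =>
    ((h.stronglyMeasurable.comp_measurable (Continuous.measurable (by fun_prop))).sub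
      stronglyMeasurable_const).enorm
  have hvtotal : ∫⁻ a in A, ∑' n, ‖u (x₀ + r n • w + ψ (r n) • a) - w‖ₑ ≠ ⊤ := by
    rw [lintegral_tsum fun n => (hum n).aemeasurable]
    exact ne_top_of_le_ne_top hgeom (ENNReal.tsum_le_tsum hvalue)
  -- at each time `r n`, almost every curve is at a point where `v = u`
  have hrep : ∀ n, ∀ᵐ a ∂(volume.restrict A),
      v (x₀ + r n • w + ψ (r n) • a) = u (x₀ + r n • w + ψ (r n) • a) := by
    intro n
    obtain ⟨N, hN, hNm, hN0⟩ := exists_measurable_superset_of_null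
      (ae_iff.1 h.ae_mem_regularSet)
    have hNmeas : Measurable fun a => N.indicator (1 : E → ℝ≥0∞) (x₀ + r n • w + ψ (r n) • a) :=
      (measurable_one.indicator hNm).comp (Continuous.measurable (by fun_prop))
    have h1 := setLIntegral_comp_add_smul_le (measurable_one.indicator hNm) hAm
      MeasurableSet.univ (x₀ + r n • w) (hψpos (r n) (hr0 n)) (fun a _ => mem_univ _)
    rw [Measure.restrict_univ, lintegral_indicator_one hNm, hN0, mul_zero, nonpos_iff_eq_zero,
      lintegral_eq_zero_iff hNmeas] at h1
    filter_upwards [h1, ae_restrict_mem hAm] with a ha haA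
    by_contra hne
    have hmem : x₀ + r n • w + ψ (r n) • a ∈ N := by
      refine hN fun himp => hne (himp (hR₀Ω (Metric.ball_subset_closedBall
        (hball a haA (r n) (hr0 n) R₀ ?_)))).2
      have h2 := (hκ n).2.2
      have h3 := hrε n
      have h4 := hr0 n
      simp only [hε] at h3
      nlinarith
    simp [indicator_of_mem hmem] at ha
  have hgood : ∀ᵐ a ∂(volume.restrict A),
      Tendsto (fun t => v (x₀ + t • w + ψ t • a)) (𝓝[>] 0) (𝓝 w) := by
    filter_upwards [htube, ae_lt_top (hpm _) htotal, ae_lt_top (Measurable.tsum hum) hvtotal,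
      ae_all_iff.2 hrep] with a ha1 ha2 ha3 ha4
    have hint : IntegrableOn (fun t => D (x₀ + t • w + ψ t • a) (w + ψ' t • a)) (Ioc 0 (r 0)) := by
      refine ⟨?_, ha2⟩
      exact (isBoundedBilinearMap_apply.continuous.comp_stronglyMeasurable
        ((h.stronglyMeasurable_gradient.comp_measurable
          (Continuous.measurable (by fun_prop))).prodMk
          (Continuous.stronglyMeasurable (by fun_prop)))).aestronglyMeasurable
    -- the limit exists because the derivative is integrable, and is `w` along the times `r n`
    obtain ⟨l, hl⟩ := exists_tendsto_nhdsGT_of_integrableOn hδ hint ha1.2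
    have hlr : Tendsto (fun n => v (x₀ + r n • w + ψ (r n) • a)) atTop (𝓝 l) :=
      hl.comp (tendsto_nhdsWithin_iff.2 ⟨hrlim, Eventually.of_forall fun n => hr0 n⟩)
    have hlw : Tendsto (fun n => v (x₀ + r n • w + ψ (r n) • a)) atTop (𝓝 w) := by
      rw [tendsto_iff_edist_tendsto_0]
      refine (ENNReal.tendsto_atTop_zero_of_tsum_ne_top ha3.ne).congr fun n => ?_
      rw [edist_eq_enorm_sub, ha4 n]
    rwa [tendsto_nhds_unique hlr hlw] at hl
  have hne : (ae (volume.restrict A)).NeBot := by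
    rw [ae_neBot, Ne, Measure.restrict_eq_zero]
    exact (Metric.measure_ball_pos _ _ (half_pos hw0)).ne'
  obtain ⟨a, ha⟩ := hgood.exists
  exact ⟨a, ψ, ψ', hψd, hψ'c, profile_zero, deriv_profile_zero, ha⟩

end FastMollification

end TangentCurves

/-! ### Sobolev functions of one variable -/

section OneDimensional

variable {F : Type*} [NormedAddCommGroup F] [NormedSpace ℝ F]

/-- Integration by parts against the primitive of an integrable function, by Fubini. -/
theorem integral_deriv_smul_primitive [CompleteSpace F] {G : ℝ → F} {ρ : ℝ}
    (hG : IntegrableOn G (Ioo 0 ρ)) {φ : ℝ → ℝ} (hφ : ContDiff ℝ 1 φ) (hφρ : φ ρ = 0) :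
    ∫ x in Ioo 0 ρ, deriv φ x • ∫ y in (0 : ℝ)..x, G y = - ∫ x in Ioo 0 ρ, φ x • G x := by
  have hφ' : Continuous (deriv φ) := hφ.continuous_deriv le_rfl
  have hφi : IntegrableOn (deriv φ) (Ioo 0 ρ) :=
    (hφ'.continuousOn.integrableOn_compact isCompact_Icc).mono_set Ioo_subset_Icc_self
  set μ := volume.restrict (Ioo 0 ρ) with hμ
  have hT : MeasurableSet {z : ℝ × ℝ | z.2 < z.1} :=
    (isOpen_lt continuous_snd continuous_fst).measurableSet
  have hH : Integrable ({z : ℝ × ℝ | z.2 < z.1}.indicator fun z => deriv φ z.1 • G z.2)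
      (μ.prod μ) := (Integrable.smul_prod hφi hG).indicator hT
  have h1 : ∀ x ∈ Ioo 0 ρ, deriv φ x • ∫ y in (0 : ℝ)..x, G y =
      ∫ y, {z : ℝ × ℝ | z.2 < z.1}.indicator (fun z => deriv φ z.1 • G z.2) (x, y) ∂μ := by
    intro x hx
    have h2 : ∀ y, {z : ℝ × ℝ | z.2 < z.1}.indicator (fun z => deriv φ z.1 • G z.2) (x, y) =
        (Iio x).indicator (fun y => deriv φ x • G y) y := fun y => rfl
    simp_rw [h2]
    rw [integral_indicator measurableSet_Iio, hμ, Measure.restrict_restrict measurableSet_Iio,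
      integral_smul, intervalIntegral.integral_of_le hx.1.le, integral_Ioc_eq_integral_Ioo]
    congr 3
    ext y
    simp only [mem_Ioo, mem_inter_iff, mem_Iio]
    constructor
    · rintro ⟨h3, h4⟩; exact ⟨h4, h3, h4.trans hx.2⟩
    · rintro ⟨h3, h4, -⟩; exact ⟨h4, h3⟩
  have h3 : ∀ y ∈ Ioo 0 ρ, ∫ x, {z : ℝ × ℝ | z.2 < z.1}.indicator
      (fun z => deriv φ z.1 • G z.2) (x, y) ∂μ = - (φ y • G y) := by
    intro y hy
    have h2 : ∀ x, {z : ℝ × ℝ | z.2 < z.1}.indicator (fun z => deriv φ z.1 • G z.2) (x, y) =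
        (Ioi y).indicator (fun x => deriv φ x • G y) x := fun x => rfl
    simp_rw [h2]
    have h4 : Ioi y ∩ Ioo 0 ρ = Ioo y ρ := by
      ext x
      simp only [mem_Ioo, mem_inter_iff, mem_Ioi]
      constructor
      · rintro ⟨h3, -, h5⟩; exact ⟨h3, h5⟩
      · rintro ⟨h3, h4⟩; exact ⟨h3, hy.1.trans h3, h4⟩
    rw [integral_indicator measurableSet_Ioi, hμ, Measure.restrict_restrict measurableSet_Ioi, h4,
      integral_smul_const, ← integral_Ioc_eq_integral_Ioo,
      ← intervalIntegral.integral_of_le hy.2.le, intervalIntegral.integral_deriv_eq_sub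
        (fun x _ => hφ.differentiable (by simp) x) (hφ'.intervalIntegrable _ _), hφρ, zero_sub,
      neg_smul]
  rw [setIntegral_congr_fun measurableSet_Ioo h1, ← integral_neg]
  rw [integral_integral_swap
    (f := fun x y => {z : ℝ × ℝ | z.2 < z.1}.indicator (fun z => deriv φ z.1 • G z.2) (x, y)) hH]
  exact setIntegral_congr_fun measurableSet_Ioo h3

/-- A function on a bounded interval whose increments are the integrals of an integrable function
is in `W^{1,1}`. -/
theorem isSobolevWithGradient_of_integral_eq [CompleteSpace F] {V g g' : ℝ → F} {ρ : ℝ}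
    (hρ : 0 < ρ) (hg : IntegrableOn g (Ioo 0 ρ))
    (hV : ∀ s ∈ Ioo 0 ρ, ∀ t ∈ Ioo 0 ρ, V t - V s = ∫ τ in s..t, g τ)
    (hg' : g' =ᵐ[volume.restrict (Ioo 0 ρ)] g) :
    IsSobolevWithGradient 1 (Ioo 0 ρ) V
      (fun r => ContinuousLinearMap.toSpanSingleton ℝ (g' r)) := by
  set G := (Ioo 0 ρ).indicator g with hGdef
  have hG : Integrable G := (integrable_indicator_iff measurableSet_Ioo).2 hg
  set c := ρ / 2 with hc
  have hcI : c ∈ Ioo 0 ρ := ⟨half_pos hρ, half_lt_self hρ⟩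
  set c₀ := V c - ∫ τ in (0 : ℝ)..c, G τ with hc₀
  have hVW : ∀ t ∈ Ioo 0 ρ, V t = c₀ + ∫ τ in (0 : ℝ)..t, G τ := by
    intro t ht
    have h1 : ∫ τ in c..t, g τ = ∫ τ in c..t, G τ := by
      refine intervalIntegral.integral_congr fun τ hτ => ?_
      rw [hGdef, indicator_of_mem (ordConnected_Ioo.uIcc_subset hcI ht hτ)]
    have h2 := hV c hcI t ht
    rw [h1] at h2
    have h3 := intervalIntegral.integral_add_adjacent_intervals
      (hG.intervalIntegrable (a := 0) (b := c)) (hG.intervalIntegrable (a := c) (b := t))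
    rw [hc₀, ← h3, ← h2]
    abel
  have hWc : Continuous fun t => c₀ + ∫ τ in (0 : ℝ)..t, G τ :=
    continuous_const.add (intervalIntegral.continuous_primitive
      (fun _ _ => hG.intervalIntegrable) 0)
  have hWi : IntegrableOn (fun t => c₀ + ∫ τ in (0 : ℝ)..t, G τ) (Ioo 0 ρ) :=
    (hWc.continuousOn.integrableOn_compact isCompact_Icc).mono_set Ioo_subset_Icc_self
  refine ⟨?_, ?_, ?_⟩
  · rw [memLp_one_iff_integrable]
    exact hWi.congr ((ae_restrict_mem measurableSet_Ioo).mono fun t ht => (hVW t ht).symm)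
  · rw [memLp_one_iff_integrable]
    have h1 : Integrable (fun r => ContinuousLinearMap.toSpanSingleton ℝ (g r))
        (volume.restrict (Ioo 0 ρ)) :=
      (ContinuousLinearMap.toSpanSingletonCLE (𝕜 := ℝ)
        (E := F)).toContinuousLinearMap.integrable_comp hg
    exact h1.congr (hg'.mono fun t ht => by simp only [ht])
  · intro φ hφ hφc hφs w
    have hφρ : ∀ x, x ∉ Ioo 0 ρ → φ x = 0 := fun x hx => by
      by_contra hne
      exact hx (hφs (subset_tsupport φ hne))
    have hφ1 : ContDiff ℝ 1 φ := hφ.of_le (by simp)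
    have hφ' : Continuous (deriv φ) := hφ1.continuous_deriv le_rfl
    have hφi : IntegrableOn (deriv φ) (Ioo 0 ρ) :=
      (hφ'.continuousOn.integrableOn_compact isCompact_Icc).mono_set Ioo_subset_Icc_self
    have hzero : ∫ x in Ioo 0 ρ, deriv φ x = 0 := by
      rw [← integral_Ioc_eq_integral_Ioo, ← intervalIntegral.integral_of_le hρ.le,
        intervalIntegral.integral_deriv_eq_sub
        (fun x _ => hφ1.differentiable (by simp) x) (hφ'.intervalIntegrable _ _),
        hφρ ρ (by simp), hφρ 0 (by simp), sub_zero]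
    have hkey := integral_deriv_smul_primitive hG.integrableOn hφ1 (hφρ ρ (by simp))
    have hPi : IntegrableOn (fun x => deriv φ x • ∫ y in (0 : ℝ)..x, G y) (Ioo 0 ρ) :=
      ((hφ'.smul (intervalIntegral.continuous_primitive
        (fun _ _ => hG.intervalIntegrable) 0)).continuousOn.integrableOn_compact
        isCompact_Icc).mono_set Ioo_subset_Icc_self
    calc ∫ x in Ioo 0 ρ, (fderiv ℝ φ x w) • V x
        = ∫ x in Ioo 0 ρ, w • (deriv φ x • c₀ + deriv φ x • ∫ y in (0 : ℝ)..x, G y) := by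
          refine setIntegral_congr_fun measurableSet_Ioo fun x hx => ?_
          have h1 : fderiv ℝ φ x w = w * deriv φ x := by
            rw [← fderiv_apply_one_eq_deriv, ← smul_eq_mul, ← map_smul, smul_eq_mul, mul_one]
          simp only [h1, hVW x hx, mul_smul, smul_add]
      _ = w • - ∫ x in Ioo 0 ρ, φ x • G x := by
          rw [integral_smul, integral_add (hφi.smul_const c₀) hPi, integral_smul_const, hzero,
            zero_smul, zero_add, hkey]
      _ = - ∫ x in Ioo 0 ρ, φ x • (w • g' x) := by
          rw [smul_neg, ← integral_smul]
          congr 1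
          refine integral_congr_ae ?_
          filter_upwards [hg', ae_restrict_mem measurableSet_Ioo] with x hx hxI
          rw [hx, hGdef, indicator_of_mem hxI, smul_comm]
      _ = _ := by
          simp [ContinuousLinearMap.toSpanSingleton_apply]

end OneDimensional

/-! ### Restriction to rays -/

section Rays

variable {E F : Type*} [NormedAddCommGroup E] [NormedSpace ℝ E] [FiniteDimensional ℝ E]
  [MeasureSpace E] [BorelSpace E] [(volume : Measure E).IsAddHaarMeasure]
  [NormedAddCommGroup F] [NormedSpace ℝ F]

/-- Integration in polar coordinates. -/
theorem lintegral_eq_lintegral_sphere {f : E → ℝ≥0∞} (hf : Measurable f) [Nontrivial E] :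
    ∫⁻ x, f x = ∫⁻ e : Metric.sphere (0 : E) 1, ∫⁻ r in Ioi (0 : ℝ),
      ENNReal.ofReal (r ^ (Module.finrank ℝ E - 1)) * f (r • (e : E)) ∂volume
        ∂(volume : Measure E).toSphere := by
  have hmp := (volume : Measure E).measurePreserving_homeomorphUnitSphereProd
  have hF : Measurable fun q : Metric.sphere (0 : E) 1 × Ioi (0 : ℝ) =>
      f ((q.2 : ℝ) • (q.1 : E)) := hf.comp (Continuous.measurable (by fun_prop))
  have h1 := hmp.lintegral_comp hF
  have h2 : ∀ x : ({0}ᶜ : Set E), f (((homeomorphUnitSphereProd E x).2 : ℝ) •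
      ((homeomorphUnitSphereProd E x).1 : E)) = f x := by
    intro x
    have hx : ‖(x : E)‖ ≠ 0 := norm_ne_zero_iff.2 x.2
    simp [smul_smul, hx]
  simp_rw [h2] at h1
  rw [lintegral_subtype_comap (measurableSet_singleton _).compl, restrict_compl_singleton] at h1
  rw [h1, lintegral_prod _ hF.aemeasurable]
  refine lintegral_congr fun e => ?_
  have hm : Measurable fun r : Ioi (0 : ℝ) =>
      ENNReal.ofReal ((r : ℝ) ^ (Module.finrank ℝ E - 1)) :=
    (Continuous.measurable (by fun_prop : Continuous fun r : Ioi (0 : ℝ) =>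
      (r : ℝ) ^ (Module.finrank ℝ E - 1))).ennreal_ofReal
  have hm' : Measurable fun r : Ioi (0 : ℝ) => f ((r : ℝ) • (e : E)) :=
    hf.comp (Continuous.measurable (by fun_prop))
  rw [Measure.volumeIoiPow, lintegral_withDensity_eq_lintegral_mul _ hm hm']
  exact lintegral_subtype_comap measurableSet_Ioi
    (fun r : ℝ => ENNReal.ofReal (r ^ (Module.finrank ℝ E - 1)) * f (r • (e : E)))

theorem ae_sphere_ae_ray [Nontrivial E] {p : E → Prop} (hp : ∀ᵐ x : E ∂volume, p x) (x₀ : E) :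
    ∀ᵐ e : Metric.sphere (0 : E) 1 ∂(volume : Measure E).toSphere,
      ∀ᵐ r ∂(volume.restrict (Ioi (0 : ℝ))), p (x₀ + r • (e : E)) := by
  obtain ⟨N, hN, hNm, hN0⟩ := exists_measurable_superset_of_null (ae_iff.1 hp)
  set f : E → ℝ≥0∞ := fun x => N.indicator 1 (x₀ + x) with hf
  have hfm : Measurable f := (measurable_one.indicator hNm).comp (measurable_const_add x₀)
  have h0 : ∫⁻ x, f x = 0 := by
    rw [hf, lintegral_add_left_eq_self (fun x => N.indicator 1 x) x₀, lintegral_indicator_one hNm,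
      hN0]
  have hm : Measurable fun q : Metric.sphere (0 : E) 1 × ℝ =>
      ENNReal.ofReal (q.2 ^ (Module.finrank ℝ E - 1)) * f (q.2 • (q.1 : E)) :=
    (Continuous.measurable (by fun_prop)).ennreal_ofReal.mul
      (hfm.comp (Continuous.measurable (by fun_prop)))
  rw [lintegral_eq_lintegral_sphere hfm,
    lintegral_eq_zero_iff (Measurable.lintegral_prod_right' hm)] at h0
  filter_upwards [h0] with e he
  have hme : Measurable fun r : ℝ =>
      ENNReal.ofReal (r ^ (Module.finrank ℝ E - 1)) * f (r • (e : E)) :=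
    hm.comp measurable_prodMk_left
  have he' := (lintegral_eq_zero_iff hme).1 he
  filter_upwards [he', ae_restrict_mem measurableSet_Ioi] with r hr hr0
  by_contra hne
  have hmem : x₀ + r • (e : E) ∈ N := hN hne
  simp only [hf, indicator_of_mem hmem, Pi.one_apply, mul_one, Pi.zero_apply,
    ENNReal.ofReal_eq_zero] at hr
  exact absurd hr (not_le.2 (pow_pos hr0 _))

/-- The radial integral of the gradient at `x₀` is its integral along the rays from `x₀`: the weight
is the inverse of the Jacobian `r ^ (dim E - 1)` of polar coordinates, with one more power of `r`
to normalize the direction `x - x₀`. -/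
theorem lintegral_sphere_lintegral_ray [Nontrivial E] {D : E → E →L[ℝ] F}
    (hD : StronglyMeasurable D) (x₀ : E) (ρ : ℝ) :
    ∫⁻ e : Metric.sphere (0 : E) 1, ∫⁻ r in Ioo (0 : ℝ) ρ,
        ‖D (x₀ + r • (e : E)) e‖ₑ ∂volume ∂(volume : Measure E).toSphere =
      ∫⁻ x in Metric.ball x₀ ρ, ENNReal.ofReal ((‖x - x₀‖ ^ Module.finrank ℝ E)⁻¹) *
        ‖D x (x - x₀)‖ₑ := by
  set f : E → ℝ≥0∞ := (Metric.ball x₀ ρ).indicator fun x =>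
    ENNReal.ofReal ((‖x - x₀‖ ^ Module.finrank ℝ E)⁻¹) * ‖D x (x - x₀)‖ₑ with hf
  have hfm : Measurable f := by
    refine Measurable.indicator ?_ Metric.isOpen_ball.measurableSet
    have h1 : Measurable fun x : E => ‖x - x₀‖ := (measurable_id.sub_const x₀).norm
    exact ((h1.pow_const _).inv).ennreal_ofReal.mul
      (measurable_enorm_clm_apply hD measurable_id (measurable_id.sub_const x₀))
  rw [← lintegral_indicator Metric.isOpen_ball.measurableSet,
    ← lintegral_add_left_eq_self f x₀,
    lintegral_eq_lintegral_sphere (f := fun x => f (x₀ + x))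
      (hfm.comp (measurable_const_add x₀))]
  refine lintegral_congr fun e => ?_
  have he : ‖(e : E)‖ = 1 := by simp
  have h1 : Ioo (0 : ℝ) ρ = Iio ρ ∩ Ioi 0 := by rw [inter_comm, Ioi_inter_Iio]
  rw [h1, ← Measure.restrict_restrict measurableSet_Iio, ← lintegral_indicator measurableSet_Iio]
  refine setLIntegral_congr_fun measurableSet_Ioi fun r hr => ?_
  have hr0 : (0 : ℝ) < r := hr
  have hnorm : ‖r • (e : E)‖ = r := by rw [norm_smul, he, mul_one, Real.norm_of_nonneg hr0.le]
  by_cases hrρ : r < ρ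
  · have hmem : x₀ + r • (e : E) ∈ Metric.ball x₀ ρ := by
      rw [Metric.mem_ball, dist_eq_norm, add_sub_cancel_left, hnorm]; exact hrρ
    simp only [hf, indicator_of_mem hmem, indicator_of_mem (mem_Iio.2 hrρ), add_sub_cancel_left,
      hnorm, map_smul, enorm_smul, Real.enorm_eq_ofReal hr0.le]
    rw [← mul_assoc, ← mul_assoc, ← ENNReal.ofReal_mul (by positivity),
      ← ENNReal.ofReal_mul (by positivity)]
    have h2 : r ^ (Module.finrank ℝ E - 1) * (r ^ Module.finrank ℝ E)⁻¹ * r = 1 := by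
      have h3 : r ^ Module.finrank ℝ E = r ^ (Module.finrank ℝ E - 1) * r := by
        rw [← pow_succ, Nat.sub_add_cancel Module.finrank_pos]
      rw [h3]
      field_simp
    rw [h2, ENNReal.ofReal_one, one_mul]
  · have hmem : x₀ + r • (e : E) ∉ Metric.ball x₀ ρ := by
      rw [Metric.mem_ball, dist_eq_norm, add_sub_cancel_left, hnorm]; exact hrρ
    simp only [hf, indicator_of_notMem hmem, indicator_of_notMem (mt mem_Iio.1 hrρ), mul_zero]

namespace FastMollification

variable {Ω : Set E} {u : E → F} {D : E → E →L[ℝ] F} {φ : ℕ → ContDiffBump (0 : E)}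

/-- Almost every ray from `x₀` satisfies the fundamental theorem of calculus away from its
endpoints. Here `x₀` need not be regular. -/
theorem ae_regular_ray [CompleteSpace F] [Nontrivial E] (h : FastMollification Ω u D φ) {x₀ : E}
    {ρ : ℝ} (hρ : 0 < ρ) (hsub : Metric.ball x₀ ρ ⊆ Ω) :
    ∀ᵐ e : Metric.sphere (0 : E) 1 ∂(volume : Measure E).toSphere,
      ∀ s ∈ Ioo 0 ρ, ∀ t ∈ Ioo 0 ρ,
        preciseRep Ω u D φ (x₀ + t • (e : E)) - preciseRep Ω u D φ (x₀ + s • (e : E)) =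
          ∫ τ in s..t, D (x₀ + τ • (e : E)) e := by
  -- outside a neighbourhood of `x₀` the rays do not concentrate
  have key : ∀ n : ℕ, ∀ᵐ e : Metric.sphere (0 : E) 1 ∂(volume : Measure E).toSphere,
      ∀ s ∈ Icc (ρ / (n + 3)) (ρ - ρ / (n + 3)), ∀ t ∈ Icc (ρ / (n + 3)) (ρ - ρ / (n + 3)),
        preciseRep Ω u D φ (x₀ + t • (e : E)) - preciseRep Ω u D φ (x₀ + s • (e : E)) =
          ∫ τ in s..t, D (x₀ + τ • (e : E)) e := by
    intro n
    set s₀ := ρ / (n + 3) with hs₀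
    set t₀ := ρ - s₀ with ht₀
    have hs₀p : 0 < s₀ := by positivity
    have hst : s₀ < t₀ := by
      have : 2 * s₀ < ρ := by
        rw [hs₀, ← mul_div_assoc, div_lt_iff₀ (by positivity)]
        have : (0 : ℝ) ≤ n := n.cast_nonneg
        nlinarith
      linarith
    have hK : Metric.closedBall x₀ t₀ ⊆ Ω :=
      (Metric.closedBall_subset_ball (by linarith)).trans hsub
    have hmaps : ∀ e : Metric.sphere (0 : E) 1, ∀ τ ∈ Icc s₀ t₀,
        x₀ + τ • (e : E) ∈ Metric.closedBall x₀ t₀ := by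
      intro e τ hτ
      rw [Metric.mem_closedBall, dist_eq_norm, add_sub_cancel_left, norm_smul,
        Real.norm_of_nonneg (hs₀p.le.trans hτ.1)]
      simpa using hτ.2
    have := h.ae_regular_curve (μ := (volume : Measure E).toSphere) hst
      (isCompact_closedBall x₀ t₀) hK (γ := fun e τ => x₀ + τ • (e : E)) (γ' := fun e _ => (e : E))
      (Continuous.measurable (by unfold Function.uncurry; fun_prop))
      (fun e τ _ => by simpa using ((hasDerivAt_id τ).smul_const (e : E)).const_add x₀)
      (fun e => continuousOn_const) (Eventually.of_forall hmaps)
      (C := ENNReal.ofReal ((s₀ ^ (Module.finrank ℝ E - 1))⁻¹)) ENNReal.ofReal_ne_top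
      (fun f hf => by
        have hKm : MeasurableSet (Metric.closedBall x₀ t₀) :=
          Metric.isClosed_closedBall.measurableSet
        rw [← lintegral_indicator hKm, ← lintegral_add_left_eq_self _ x₀,
          lintegral_eq_lintegral_sphere
            (f := fun x => (Metric.closedBall x₀ t₀).indicator f (x₀ + x))
            ((hf.indicator hKm).comp (measurable_const_add x₀)),
          ← lintegral_const_mul' _ _ ENNReal.ofReal_ne_top]
        refine lintegral_mono fun e => ?_
        rw [← lintegral_const_mul' _ _ ENNReal.ofReal_ne_top]
        refine le_trans (setLIntegral_mono' measurableSet_Icc fun τ hτ => ?_)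
          (lintegral_mono_set (s := Icc s₀ t₀) fun τ hτ => hs₀p.trans_le hτ.1)
        simp only [indicator_of_mem (hmaps e τ hτ)]
        rw [← mul_assoc, ← ENNReal.ofReal_mul (by positivity)]
        refine le_mul_of_one_le_left zero_le ?_
        rw [ENNReal.one_le_ofReal, ← div_eq_inv_mul, one_le_div (by positivity)]
        exact pow_le_pow_left₀ hs₀p.le hτ.1 _)
    filter_upwards [this] with e he using he.2.2
  filter_upwards [ae_all_iff.2 key] with e he s hs t ht
  have hmin : 0 < min (min s t) (min (ρ - s) (ρ - t)) :=
    lt_min (lt_min hs.1 ht.1) (lt_min (by linarith [hs.2]) (by linarith [ht.2]))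
  obtain ⟨n, hn⟩ := exists_nat_ge (ρ / min (min s t) (min (ρ - s) (ρ - t)))
  have hn' : ρ / (n + 3) ≤ min (min s t) (min (ρ - s) (ρ - t)) := by
    rw [div_le_iff₀ (by positivity)]
    rw [div_le_iff₀ hmin] at hn
    nlinarith
  rw [le_min_iff, le_min_iff, le_min_iff] at hn'
  exact he n s ⟨hn'.1.1, by linarith [hn'.2.1]⟩ t ⟨hn'.1.2, by linarith [hn'.2.2]⟩

end FastMollification

end Rays

/-! ### Existence of fast mollifications, measurability, continuity points -/

section Existence

variable {E F : Type*} [NormedAddCommGroup E] [NormedSpace ℝ E] [FiniteDimensional ℝ E]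
  [MeasureSpace E] [BorelSpace E] [(volume : Measure E).IsAddHaarMeasure]
  [NormedAddCommGroup F] [NormedSpace ℝ F]

theorem FastMollification.exists {Ω : Set E} (hΩ : IsOpen Ω) {u : E → F} {D : E → E →L[ℝ] F}
    (hu : StronglyMeasurable u) (hD : StronglyMeasurable D) (hui : LocallyIntegrable u volume)
    (hDi : LocallyIntegrable D volume)
    (hweak : ∀ ψ : E → ℝ, ContDiff ℝ ∞ ψ → HasCompactSupport ψ → tsupport ψ ⊆ Ω →
      ∀ w : E, ∫ x, (fderiv ℝ ψ x w) • u x = - ∫ x, ψ x • D x w) :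
    ∃ φ : ℕ → ContDiffBump (0 : E), FastMollification Ω u D φ := by
  set r : ℕ → ℝ := fun m => 2⁻¹ ^ m with hr
  have hr0 : ∀ m, 0 < r m := fun m => by positivity
  have hrs : ∀ m, r m = 2 * r (m + 1) := fun m => by simp only [hr, pow_succ]; ring
  have hrt : Tendsto r atTop (𝓝 0) :=
    tendsto_pow_atTop_nhds_zero_of_lt_one (by norm_num) (by norm_num)
  have hrt' : Tendsto (fun m => 2 * r m) atTop (𝓝[>] 0) :=
    tendsto_nhdsWithin_iff.2 ⟨by simpa using hrt.const_mul 2,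
      Eventually.of_forall fun m => mul_pos two_pos (hr0 m)⟩
  have hev : ∀ k : ℕ, ∀ᶠ m in atTop,
      (∫⁻ x in Metric.ball (0 : E) k, meanOsc (2 * r m) u x ≤ 2⁻¹ ^ k) ∧
      ∫⁻ x in Metric.ball (0 : E) k, meanOsc (2 * r m) D x ≤ 2⁻¹ ^ k := by
    intro k
    have hk : (0 : ℝ≥0∞) < 2⁻¹ ^ k := ENNReal.pow_pos (by simp) k
    exact ((((tendsto_lintegral_meanOsc hu hui k).comp hrt').eventually (gt_mem_nhds hk)).mono
      fun _ h => le_of_lt h).and ((((tendsto_lintegral_meanOsc hD hDi k).comp hrt').eventually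
        (gt_mem_nhds hk)).mono fun _ h => le_of_lt h)
  obtain ⟨m, hm, hmk⟩ := extraction_forall_of_eventually hev
  refine ⟨fun k => ⟨r (m k + 1), r (m k), hr0 _, by linarith [hrs (m k), hr0 (m k + 1)]⟩, ?_⟩
  exact
    { isOpen := hΩ
      stronglyMeasurable := hu
      stronglyMeasurable_gradient := hD
      locallyIntegrable := hui
      locallyIntegrable_gradient := hDi
      integral_eq := hweak
      rOut_eq := fun k => hrs (m k)
      rOut_succ_le := fun k => by
        have h1 : r (m (k + 1)) ≤ r (m k + 1) :=
          pow_le_pow_of_le_one (by norm_num) (by norm_num) (hm (Nat.lt_succ_self k))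
        simpa only [hrs (m k), mul_div_cancel_left₀ _ (two_ne_zero' ℝ)] using h1
      tendsto_rOut := hrt.comp hm.tendsto_atTop
      lintegral_meanOsc_le := fun k => (hmk k).1
      lintegral_meanOsc_gradient_le := fun k => (hmk k).2 }

namespace FastMollification

variable {Ω : Set E} {u : E → F} {D : E → E →L[ℝ] F} {φ : ℕ → ContDiffBump (0 : E)}

theorem measurableSet_regularSet [CompleteSpace F] (h : FastMollification Ω u D φ) :
    MeasurableSet (regularSet Ω u D φ) := by
  refine h.isOpen.measurableSet.inter (MeasurableSet.inter ?_ ?_)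
  · exact StronglyMeasurable.measurableSet_exists_tendsto fun k =>
      (continuous_mollify (φ k) h.locallyIntegrable).stronglyMeasurable
  · refine measurableSet_tendsto _ fun k => ?_
    unfold scaledAverage
    simp_rw [setLAverage_eq, Measure.addHaar_ball_center]
    exact ((measurable_lintegral_ball (G := fun _ y => ‖D y‖ₑ)
      (h.stronglyMeasurable_gradient.comp_measurable measurable_snd).enorm _).div_const _).const_mul
        _

theorem measurable_preciseRep [CompleteSpace F] [MeasurableSpace F] [BorelSpace F]
    (h : FastMollification Ω u D φ) : Measurable (preciseRep Ω u D φ) := by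
  refine measurable_of_tendsto_metrizable (f := fun k =>
    (regularSet Ω u D φ).indicator (mollify (φ k) u)) (fun k =>
      (continuous_mollify (φ k) h.locallyIntegrable).measurable.indicator
        h.measurableSet_regularSet) (tendsto_pi_nhds.2 fun x => ?_)
  by_cases hx : x ∈ regularSet Ω u D φ
  · simpa only [indicator_of_mem hx] using tendsto_preciseRep hx
  · simp only [indicator_of_notMem hx, preciseRep_of_notMem hx, tendsto_const_nhds]

end FastMollification

end Existence

section ContinuityPoints

variable {E : Type*} [NormedAddCommGroup E] [NormedSpace ℝ E] [FiniteDimensional ℝ E]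
  [MeasureSpace E] [BorelSpace E] [(volume : Measure E).IsAddHaarMeasure]

namespace FastMollification

variable {Ω : Set E} {u : E → E} {D : E → E →L[ℝ] E} {φ : ℕ → ContDiffBump (0 : E)}

/-- Tangent curves at a regular point where some representative is continuous: any curve along which
the points are regular will do, and the parabolas `t ↦ x₀ + t • w + t ^ 2 • a` have this property
for almost every `a`. -/
theorem exists_tangent_curve_of_continuousAt (h : FastMollification Ω u D φ) {x₀ : E}
    (hx₀ : x₀ ∈ regularSet Ω u D φ) {f : E → E} (hf : f =ᵐ[volume.restrict Ω] u)
    (hfc : ContinuousAt f x₀) :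
    ∃ (a : E) (ψ ψ' : ℝ → ℝ), (∀ t, HasDerivAt ψ (ψ' t) t) ∧ Continuous ψ' ∧ ψ 0 = 0 ∧ ψ' 0 = 0 ∧
      Tendsto (fun t => preciseRep Ω u D φ (x₀ + t • preciseRep Ω u D φ x₀ + ψ t • a)) (𝓝[>] 0)
        (𝓝 (preciseRep Ω u D φ x₀)) := by
  have : CompleteSpace E := FiniteDimensional.complete ℝ E
  set w := preciseRep Ω u D φ x₀ with hw
  have hlim := h.tendsto_preciseRep_nhdsWithin hx₀.1 hf hfc
  have hwf : w = f x₀ := tendsto_nhds_unique (tendsto_pure_nhds _ x₀)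
    (hlim.mono_left (pure_le_nhdsWithin hx₀))
  rw [← hwf] at hlim
  obtain ⟨R, hR, hRΩ⟩ := Metric.nhds_basis_closedBall.mem_iff.1 (h.isOpen.mem_nhds hx₀.1)
  set δ : ℝ := min 1 (R / (‖w‖ + 1)) with hδdef
  have hδ : 0 < δ := by positivity
  have hδR : δ * (‖w‖ + 1) ≤ R := by
    rw [← le_div_iff₀ (by positivity)]
    exact min_le_right _ _
  have htube := h.ae_regular_tube (x₀ := x₀) (w := w) (ρ := 1) (δ := δ) (R := R)
    (ψ := fun t => t ^ 2) (ψ' := fun t => 2 * t) hδ (fun t => by simpa using hasDerivAt_pow 2 t)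
    (by fun_prop) (fun t ht => pow_pos ht.1 2) hRΩ (fun a ha t ht => by
      have ha' : ‖a‖ ≤ 1 := by simpa using (Metric.mem_ball.1 ha).le
      have ht1 : t ≤ 1 := ht.2.trans (min_le_left _ _)
      rw [Metric.mem_closedBall, dist_eq_norm, add_assoc, add_sub_cancel_left]
      calc ‖t • w + t ^ 2 • a‖ ≤ ‖t • w‖ + ‖t ^ 2 • a‖ := norm_add_le _ _
        _ = t * ‖w‖ + t ^ 2 * ‖a‖ := by
          rw [norm_smul, norm_smul, Real.norm_of_nonneg ht.1.le, Real.norm_of_nonneg (sq_nonneg t)]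
        _ ≤ t * ‖w‖ + t * 1 := by
          have := ht.1
          gcongr
          nlinarith
        _ ≤ δ * (‖w‖ + 1) := by
          rw [← mul_add]
          gcongr
          exact ht.2
        _ ≤ R := hδR)
  have hne : (ae ((volume : Measure E).restrict (Metric.ball (0 : E) 1))).NeBot := by
    rw [ae_neBot, Ne, Measure.restrict_eq_zero]
    exact (Metric.measure_ball_pos _ _ one_pos).ne'
  obtain ⟨a, ha, -⟩ := htube.exists
  refine ⟨a, fun t => t ^ 2, fun t => 2 * t, fun t => by simpa using hasDerivAt_pow 2 t,
    by fun_prop, by simp, by simp, ?_⟩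
  refine hlim.comp (tendsto_nhdsWithin_iff.2 ⟨?_, ?_⟩)
  · have hc : Continuous fun t : ℝ => x₀ + t • w + t ^ 2 • a := by fun_prop
    simpa using (hc.tendsto 0).mono_left (nhdsWithin_le_nhds (s := Ioi 0))
  · filter_upwards [Ioc_mem_nhdsGT hδ] with t ht using ha t ht

end FastMollification

end ContinuityPoints

/-! ### Self-continuity and radial limits of Sobolev fields -/

section Reduction

variable {E : Type*} [NormedAddCommGroup E] [NormedSpace ℝ E] [FiniteDimensional ℝ E]
  [MeasureSpace E] [BorelSpace E] [(volume : Measure E).IsAddHaarMeasure]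

/-- A function in `L^p(Ω)`, extended by zero, is locally integrable on the whole space. -/
theorem MeasureTheory.MemLp.exists_locallyIntegrable_extension {G : Type*} [NormedAddCommGroup G]
    {p : ℝ≥0∞} (hp : 1 ≤ p) {Ω : Set E} (hΩ : IsOpen Ω) {f : E → G}
    (hf : MemLp f p (volume.restrict Ω)) :
    ∃ g : E → G, StronglyMeasurable g ∧ LocallyIntegrable g volume ∧
      g =ᵐ[volume.restrict Ω] f ∧ ∀ x ∉ Ω, g x = 0 := by
  have hfg := hf.1.ae_eq_mk
  set g₀ := hf.1.mk f
  refine ⟨Ω.indicator g₀, hf.1.stronglyMeasurable_mk.indicator hΩ.measurableSet, fun x => ?_,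
    ?_, fun x hx => indicator_of_notMem hx _⟩
  · refine ⟨Metric.ball x 1, Metric.ball_mem_nhds x one_pos, ?_⟩
    have hfin : IsFiniteMeasure ((volume.restrict Ω).restrict (Metric.ball x 1)) :=
      isFiniteMeasure_restrict.2
        (ne_top_of_le_ne_top measure_ball_lt_top.ne (Measure.restrict_apply_le _ _))
    rw [IntegrableOn, integrable_indicator_iff hΩ.measurableSet, IntegrableOn,
      Measure.restrict_restrict hΩ.measurableSet, inter_comm,
      ← Measure.restrict_restrict Metric.isOpen_ball.measurableSet]
    exact ((memLp_congr_ae hfg).1 hf).restrict _ |>.integrable hp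
  · filter_upwards [hfg, ae_restrict_mem hΩ.measurableSet] with x hx hxΩ
    rw [indicator_of_mem hxΩ, hx]

theorem IsSobolevWithGradient.exists_fastMollification {F : Type*} [NormedAddCommGroup F]
    [NormedSpace ℝ F] {p : ℝ≥0∞} (hp : 1 ≤ p) {Ω : Set E} (hΩ : IsOpen Ω)
    {u : E → F} {Du : E → E →L[ℝ] F} (hu : IsSobolevWithGradient p Ω u Du) :
    ∃ (u' : E → F) (D' : E → E →L[ℝ] F) (φ : ℕ → ContDiffBump (0 : E)),
      u' =ᵐ[volume.restrict Ω] u ∧ D' =ᵐ[volume.restrict Ω] Du ∧ FastMollification Ω u' D' φ := by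
  obtain ⟨u', hum, hui, huae, hu0⟩ := hu.memLp.exists_locallyIntegrable_extension hp hΩ
  obtain ⟨D', hDm, hDi, hDae, hD0⟩ := hu.memLp_gradient.exists_locallyIntegrable_extension hp hΩ
  obtain ⟨φ, hφ⟩ := FastMollification.exists hΩ hum hDm hui hDi fun ψ hψ hψc hψΩ w => by
    rw [← setIntegral_eq_integral_of_forall_compl_eq_zero (s := Ω)
        (f := fun x => (fderiv ℝ ψ x w) • u' x) (fun x hx => by rw [hu0 x hx, smul_zero]),
      ← setIntegral_eq_integral_of_forall_compl_eq_zero (s := Ω) (f := fun x => ψ x • D' x w)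
        (fun x hx => by rw [hD0 x hx, zero_apply, smul_zero])]
    refine Eq.trans (integral_congr_ae ?_)
      ((hu.integral_eq ψ hψ hψc hψΩ w).trans (congrArg _ (integral_congr_ae ?_)))
    · filter_upwards [huae] with x hx
      rw [hx]
    · filter_upwards [hDae] with x hx
      rw [hx]
  exact ⟨u', D', φ, huae, hDae, hφ⟩

end Reduction

/-- A curve defined for all times may be used to show self-continuity, as it stays in the open set
`Ω` for a short time. -/
theorem isSelfContinuousAt_of_hasDerivAt {N : ℕ} {Ω : Set (EuclideanSpace ℝ (Fin N))}
    (hΩ : IsOpen Ω) {f : EuclideanSpace ℝ (Fin N) → EuclideanSpace ℝ (Fin N)}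
    {x : EuclideanSpace ℝ (Fin N)} (hx : x ∈ Ω) {γ γ' : ℝ → EuclideanSpace ℝ (Fin N)}
    (hγ : ∀ t, HasDerivAt γ (γ' t) t) (hγ' : Continuous γ') (h0 : γ 0 = x) (h0' : γ' 0 = f x)
    (hf : Tendsto (fun t => f (γ t)) (𝓝[>] 0) (𝓝 (f x))) : IsSelfContinuousAt Ω f x := by
  have hmem : ∀ᶠ t in 𝓝 0, γ t ∈ Ω :=
    (hγ 0).continuousAt.eventually_mem (hΩ.mem_nhds (by rwa [h0]))
  obtain ⟨ε, hε, hεΩ⟩ := Metric.eventually_nhds_iff_ball.1 hmem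
  have hderiv : ∀ t ∈ Ico 0 ε, derivWithin γ (Ico 0 ε) t = γ' t := fun t ht =>
    (hγ t).hasDerivWithinAt.derivWithin (uniqueDiffOn_Ico 0 ε t ht)
  have hC1 : ContDiff ℝ 1 γ := by
    rw [contDiff_one_iff_deriv]
    exact ⟨fun t => (hγ t).differentiableAt, by rwa [show deriv γ = γ' from
      funext fun t => (hγ t).deriv]⟩
  refine ⟨ε, hε, γ, hC1.contDiffOn, fun t ht => hεΩ t ?_, h0,
    (hderiv 0 ⟨le_rfl, hε⟩).trans h0', ?_⟩
  · rw [Metric.mem_ball, Real.dist_0_eq_abs, abs_of_nonneg ht.1]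
    exact ht.2
  · have h1 : Tendsto γ' (𝓝[>] 0) (𝓝 (f x)) := by
      rw [← h0']
      exact (hγ'.tendsto 0).mono_left nhdsWithin_le_nhds
    rw [← sub_self (f x)]
    refine (h1.sub hf).congr' ?_
    filter_upwards [Ioo_mem_nhdsGT hε] with t ht
    rw [hderiv t ⟨ht.1.le, ht.2⟩]

/-- The precise representative is self-continuous: by a constant curve where it vanishes, and by a
tangent curve at the other points, which are regular. -/
theorem FastMollification.isSelfContinuousAt {N : ℕ} {Ω : Set (EuclideanSpace ℝ (Fin N))}
    {u : EuclideanSpace ℝ (Fin N) → EuclideanSpace ℝ (Fin N)}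
    {D : EuclideanSpace ℝ (Fin N) → EuclideanSpace ℝ (Fin N) →L[ℝ] EuclideanSpace ℝ (Fin N)}
    {φ : ℕ → ContDiffBump (0 : EuclideanSpace ℝ (Fin N))} (h : FastMollification Ω u D φ)
    {x : EuclideanSpace ℝ (Fin N)} (hx : x ∈ Ω)
    (hrad : IsDiscontinuityPoint Ω u x → ∃ R : ℝ, 0 < R ∧
      ∫⁻ y in Metric.ball x R, ENNReal.ofReal ((‖y - x‖ ^ N)⁻¹) * ‖D y (y - x)‖ₑ ≠ ⊤) :
    IsSelfContinuousAt Ω (preciseRep Ω u D φ) x := by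
  by_cases hv : preciseRep Ω u D φ x = 0
  · refine isSelfContinuousAt_of_hasDerivAt h.isOpen hx (γ := fun _ => x) (γ' := fun _ => 0)
      (fun t => hasDerivAt_const t x) continuous_const rfl hv.symm tendsto_const_nhds
  have hreg : x ∈ regularSet Ω u D φ := by
    by_contra hne
    exact hv (preciseRep_of_notMem hne)
  obtain ⟨a, ψ, ψ', hψ, hψc, hψ0, hψ0', hlim⟩ : ∃ (a : EuclideanSpace ℝ (Fin N)) (ψ ψ' : ℝ → ℝ),
      (∀ t, HasDerivAt ψ (ψ' t) t) ∧ Continuous ψ' ∧ ψ 0 = 0 ∧ ψ' 0 = 0 ∧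
      Tendsto (fun t => preciseRep Ω u D φ (x + t • preciseRep Ω u D φ x + ψ t • a)) (𝓝[>] 0)
        (𝓝 (preciseRep Ω u D φ x)) := by
    by_cases hd : IsDiscontinuityPoint Ω u x
    · obtain ⟨R, hR, hRfin⟩ := hrad hd
      refine h.exists_tangent_curve hreg hv hR ?_
      simpa only [finrank_euclideanSpace_fin] using hRfin
    · simp only [IsDiscontinuityPoint, not_forall, not_not] at hd
      obtain ⟨f, hf, hfc⟩ := hd
      exact h.exists_tangent_curve_of_continuousAt hreg hf hfc
  refine isSelfContinuousAt_of_hasDerivAt h.isOpen hx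
    (γ := fun t => x + t • preciseRep Ω u D φ x + ψ t • a)
    (γ' := fun t => preciseRep Ω u D φ x + ψ' t • a) (fun t => ?_) (by fun_prop)
    (by simp [hψ0]) (by simp [hψ0']) hlim
  have h1 := (((hasDerivAt_id t).smul_const (preciseRep Ω u D φ x)).const_add x).add
    ((hψ t).smul_const a)
  rw [one_smul] at h1
  exact h1

section RadialLimits

variable {E F : Type*} [NormedAddCommGroup E] [NormedSpace ℝ E] [FiniteDimensional ℝ E]
  [MeasureSpace E] [BorelSpace E] [(volume : Measure E).IsAddHaarMeasure]
  [NormedAddCommGroup F] [NormedSpace ℝ F]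

/-- On almost every ray from a point with finite radial integral, the precise representative is in
`W^{1,1}` and has a limit at the vertex. The gradient enters only through its class `D₀`. -/
theorem FastMollification.ae_sobolev_ray [CompleteSpace F] [Nontrivial E] {Ω : Set E} {u : E → F}
    {D D₀ : E → E →L[ℝ] F} {φ : ℕ → ContDiffBump (0 : E)} (h : FastMollification Ω u D φ)
    (hD₀ : D =ᵐ[volume.restrict Ω] D₀) {x₀ : E} {ρ : ℝ} (hρ : 0 < ρ)
    (hsub : Metric.ball x₀ ρ ⊆ Ω)
    (hrad : ∫⁻ x in Metric.ball x₀ ρ, ENNReal.ofReal ((‖x - x₀‖ ^ Module.finrank ℝ E)⁻¹) *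
      ‖D x (x - x₀)‖ₑ ≠ ⊤) :
    ∀ᵐ e : Metric.sphere (0 : E) 1 ∂(volume : Measure E).toSphere,
      IsSobolevWithGradient 1 (Ioo 0 ρ) (fun r : ℝ => preciseRep Ω u D φ (x₀ + r • (e : E)))
        (fun r : ℝ => ContinuousLinearMap.toSpanSingleton ℝ (D₀ (x₀ + r • (e : E)) e)) ∧
      ∃ l : F, Tendsto (fun r : ℝ => preciseRep Ω u D φ (x₀ + r • (e : E))) (𝓝[>] 0) (𝓝 l) := by
  have hDm := h.stronglyMeasurable_gradient
  have hm : Measurable fun q : Metric.sphere (0 : E) 1 × ℝ =>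
      ‖D (x₀ + q.2 • (q.1 : E)) (q.1 : E)‖ₑ :=
    measurable_enorm_clm_apply hDm (f := fun q : Metric.sphere (0 : E) 1 × ℝ =>
      x₀ + q.2 • (q.1 : E)) (g := fun q => (q.1 : E))
      (Continuous.measurable (by fun_prop)) (Continuous.measurable (by fun_prop))
  have hfin : ∀ᵐ e : Metric.sphere (0 : E) 1 ∂(volume : Measure E).toSphere,
      ∫⁻ r in Ioo (0 : ℝ) ρ, ‖D (x₀ + r • (e : E)) e‖ₑ < ⊤ := by
    refine ae_lt_top (Measurable.lintegral_prod_right' hm) ?_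
    rwa [lintegral_sphere_lintegral_ray hDm]
  have hae := ae_sphere_ae_ray ((ae_restrict_iff' h.isOpen.measurableSet).1 hD₀) x₀
  filter_upwards [h.ae_regular_ray hρ hsub, hfin, hae] with e he hefin heae
  have hcurve : Measurable fun r : ℝ => x₀ + r • (e : E) := Continuous.measurable (by fun_prop)
  have hgi : IntegrableOn (fun r : ℝ => D (x₀ + r • (e : E)) e) (Ioo 0 ρ) := by
    refine ⟨?_, hefin⟩
    exact ((ContinuousLinearMap.apply ℝ F (e : E)).continuous.comp_stronglyMeasurable
      (hDm.comp_measurable hcurve)).aestronglyMeasurable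
  refine ⟨isSobolevWithGradient_of_integral_eq hρ hgi he ?_, ?_⟩
  · have hsub' : Ioo (0 : ℝ) ρ ⊆ Ioi 0 := fun r hr => hr.1
    filter_upwards [ae_restrict_of_ae_restrict_of_subset hsub' heae,
      ae_restrict_mem measurableSet_Ioo] with r hr hrρ
    have hmem : x₀ + r • (e : E) ∈ Ω := by
      refine hsub ?_
      rw [Metric.mem_ball, dist_eq_norm, add_sub_cancel_left, norm_smul,
        Real.norm_of_nonneg hrρ.1.le]
      simpa using hrρ.2
    rw [hr hmem]
  · have hsub' : Ioc (0 : ℝ) (ρ / 2) ⊆ Ioo 0 ρ := fun r hr => ⟨hr.1, by linarith [hr.2]⟩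
    exact exists_tendsto_nhdsGT_of_integrableOn (half_pos hρ) (hgi.mono_set hsub')
      fun s hs t ht => he s (hsub' hs) t (hsub' ht)

end RadialLimits

theorem mainTheorem3 {N : ℕ} (hN : 2 ≤ N) {p : ℝ≥0∞} (hp : 1 ≤ p)
    (Ω : Set (EuclideanSpace ℝ (Fin N))) (hΩ : IsOpen Ω)
    (u : EuclideanSpace ℝ (Fin N) → EuclideanSpace ℝ (Fin N))
    (Du : EuclideanSpace ℝ (Fin N) → EuclideanSpace ℝ (Fin N) →L[ℝ] EuclideanSpace ℝ (Fin N))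
    (hu : IsSobolevWithGradient p Ω u Du)
    (ρ : EuclideanSpace ℝ (Fin N) → ℝ)
    (hρ : ∀ x₀ ∈ Ω, IsDiscontinuityPoint Ω u x₀ →
      0 < ρ x₀ ∧ Metric.ball x₀ (ρ x₀) ⊆ Ω ∧
      IntegrableOn (fun x => (‖x - x₀‖ ^ N)⁻¹ * ‖Du x (x - x₀)‖)
        (Metric.ball x₀ (ρ x₀)) volume) :
    ∃ v : EuclideanSpace ℝ (Fin N) → EuclideanSpace ℝ (Fin N),
      v =ᵐ[volume.restrict Ω] u ∧
      IsSelfContinuousOn Ω v ∧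
      ∀ x₀ ∈ Ω, IsDiscontinuityPoint Ω u x₀ →
        ∀ᵐ e : Metric.sphere (0 : EuclideanSpace ℝ (Fin N)) 1
            ∂(volume : Measure (EuclideanSpace ℝ (Fin N))).toSphere,
          IsSobolevWithGradient 1 (Ioo 0 (ρ x₀))
            (fun r : ℝ => v (x₀ + r • (e : EuclideanSpace ℝ (Fin N))))
            (fun r : ℝ => ContinuousLinearMap.toSpanSingleton ℝ
              (Du (x₀ + r • (e : EuclideanSpace ℝ (Fin N))) e)) ∧
          ∃ l : EuclideanSpace ℝ (Fin N),
            Tendsto (fun r : ℝ => v (x₀ + r • (e : EuclideanSpace ℝ (Fin N))))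
              (𝓝[>] 0) (𝓝 l) := by
  have hnt : Nontrivial (EuclideanSpace ℝ (Fin N)) :=
    Module.nontrivial_of_finrank_pos (R := ℝ) (by rw [finrank_euclideanSpace_fin]; omega)
  obtain ⟨u', D', φ, huae, hDae, h⟩ := hu.exists_fastMollification hp hΩ
  have hrad : ∀ x₀ ∈ Ω, IsDiscontinuityPoint Ω u x₀ →
      ∫⁻ x in Metric.ball x₀ (ρ x₀), ENNReal.ofReal ((‖x - x₀‖ ^ N)⁻¹) *
        ‖D' x (x - x₀)‖ₑ ≠ ⊤ := by
    intro x₀ hx₀ hd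
    obtain ⟨-, hsub, hint⟩ := hρ x₀ hx₀ hd
    refine ne_of_eq_of_ne (lintegral_congr_ae ?_) hint.2.ne
    filter_upwards [ae_restrict_of_ae_restrict_of_subset hsub hDae] with x hx
    rw [hx, enorm_mul, enorm_norm, Real.enorm_of_nonneg (by positivity)]
  refine ⟨preciseRep Ω u' D' φ, ?_, ⟨h.measurable_preciseRep, fun x hx => ?_⟩, fun x₀ hx₀ hd => ?_⟩
  · refine EventuallyEq.trans ?_ huae
    filter_upwards [ae_restrict_of_ae h.ae_mem_regularSet, ae_restrict_mem hΩ.measurableSet]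
      with x hx hxΩ using (hx hxΩ).2
  · refine h.isSelfContinuousAt hx fun hd => ?_
    have hd' : IsDiscontinuityPoint Ω u x := fun w hw => hd w (hw.trans huae.symm)
    exact ⟨ρ x, (hρ x hx hd').1, hrad x hx hd'⟩
  · obtain ⟨hρ0, hsub, -⟩ := hρ x₀ hx₀ hd
    refine h.ae_sobolev_ray hDae hρ0 hsub ?_
    simpa only [finrank_euclideanSpace_fin] using hrad x₀ hx₀ hd
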